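/- **Theorem (anisotropic Crouzeix–Raviart interpolation error estimate).** Let $d\in\{2,3\}$ and let $T\subset\mathbb R^d$ be a nondegenerate closed simplex with vertices $p_1,\dots,p_{d+1}$, let $F_i$ be the face opposite $p_i$, and let $\lambda_i$ be the barycentric coordinates. For $\varphi\in W^{1,1}(T)$ put $$I_T^{CR}\varphi:=\sum_{i=1}^{d+1}\Big(\frac1{|F_i|}\int_{F_i}\varphi\,ds\Big)\theta_i,\qquad \theta_i:=d\Big(\frac1d-\lambda_i\Big),$$ where $\varphi$ on $F_i$ is understood as the trace. Write $|v|_{W^{1,p}(T)}:=\big(\sum_{j=1}^d\|\partial v/\partial x_j\|_{L^p(T)}^p\big)^{1/p}$. *Labelling of the vertices.* If $d=2$: $\overline{p_2p_3}$ is a longest edge, $h_1:=|p_1-p_2|$, $h_2:=|p_1-p_3|$, and $h_2\le h_1$. If $d=3$: let $m$ be the midpoint of $\overline{p_1p_2}$. The simplex is of one of two types: in type (i) $\overline{p_1p_3}$, in type (ii) $\overline{p_2p_3}$, is a shortest edge $L_{\min}$ of $T$; $\overline{p_1p_2}$ is a longest one among the four edges sharing exactly one endpoint with $L_{\min}$;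 $p_4$ lies in the closed half-space $\{x:(x-m)\cdot(p_1-p_2)\ge 0\}$; and $p_3$ lies in this half-space in type (i), and in the opposite closed half-space $\{x:(x-m)\cdot(p_1-p_2)\le 0\}$ in type (ii). Put $h_1:=|p_1-p_2|$, $h_2:=|L_{\min}|$, $h_3:=|p_1-p_4|$. *Directions.* $r_1:=\frac{p_2-p_1}{|p_2-p_1|}$; for $d=2$, $r_2:=\frac{p_3-p_1}{|p_3-p_1|}$; for $d=3$, $r_3:=\frac{p_4-p_1}{|p_4-p_1|}$ and $r_2:=\frac{p_3-p_1}{|p_3-p_1|}$ in type (i), $r_2:=\frac{p_3-p_2}{|p_3-p_2|}$ in type (ii). Write $\partial\varphi/\partial r_i:=(r_i\cdot\nabla)\varphi$. *Standard position.* Let $\Phi_T(\tilde x)=A_T\tilde x+b_T$, with $A_T\in O(d)$ and $b_T\in\mathbb R^d$, be such that $p_i=\Phi_T(\tilde p_i)$ for all $i$, where for $d=2$ $$\tilde p_1=(0,0),\quad \tilde p_2=(h_1,0),\quad \tilde p_3=(h_2s,h_2t),\qquad s^2+t^2=1,\ t>0,$$ and for $d=3$ $$\tilde p_1=0,\quad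 \tilde p_2=(h_1,0,0),\quad \tilde p_4=(h_3s_{21},h_3s_{22},h_3t_2),\quad \tilde p_3=\begin{cases}(h_2s_1,h_2t_1,0)&\text{type (i)},\\(h_1-h_2s_1,h_2t_1,0)&\text{type (ii)},\end{cases}$$ with $s_1^2+t_1^2=1$, $s_1,t_1>0$, $h_2s_1\le h_1/2$, $s_{21}^2+s_{22}^2+t_2^2=1$, $t_2>0$, $h_3s_{21}\le h_1/2$. Put $\widetilde{\mathscr H}_1:=h_1$, $\widetilde{\mathscr H}_2:=h_2t$ if $d=2$, and $\widetilde{\mathscr H}_1:=h_1$, $\widetilde{\mathscr H}_2:=h_2t_1$, $\widetilde{\mathscr H}_3:=h_3t_2$ if $d=3$. Let $p,q\in[1,\infty)$ satisfy $1-\frac dp\ge-\frac dq$ (that is, $W^{1,p}(T)\hookrightarrow L^q(T)$). 1. There is a constant $c>0$, depending only on $d,p,q$ (in particular not on $T$), such that for every such $T$ and every $\varphi\in W^{2,p}(T)$ one has $I_T^{CR}\varphi-\varphi\in W^{1,q}(T)$ and $$|I_T^{CR}\varphi-\varphi|_{W^{1,q}(T)}\le c\,|T|^{\frac1q-\frac1p}\sum_{i=1}^d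 h_i\Big|\frac{\partial\varphi}{\partial r_i}\Big|_{W^{1,p}(T)}.$$ 2. If $d=2$, there is a constant $c>0$ depending only on $p,q$, and if $d=3$, for every $M>0$ there is a constant $c>0$ depending only on $p,q,M$, such that for every such $T$, where for $d=3$ moreover $|s_{22}|\le M\,\dfrac{h_2t_1}{h_3}$, and every $\varphi\in W^{2,p}(T)$, $$|I_T^{CR}\varphi-\varphi|_{W^{1,q}(T)}\le c\,|T|^{\frac1q-\frac1p}\sum_{i=1}^d\widetilde{\mathscr H}_i\Big|\frac{\partial(\varphi\circ\Phi_T)}{\partial\tilde x_i}\Big|_{W^{1,p}(\Phi_T^{-1}(T))}.$$ -/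

import Mathlib

open MeasureTheory Filter Topology
open scoped ContDiff

namespace AnisoCR

noncomputable section

/-- Euclidean space `ℝᵈ`. -/
abbrev E (d : ℕ) := EuclideanSpace ℝ (Fin d)

/-! ### Weak derivatives and Sobolev spaces on an open set -/

/-- `g` is a weak partial derivative `∂f/∂xᵢ` on the open set `Ω`:
`∫_Ω f ∂ᵢψ = -∫_Ω g ψ` for all test functions `ψ ∈ C_c^∞(Ω)`. -/
def HasWeakPartial {d : ℕ} (Ω : Set (E d)) (i : Fin d) (f g : E d → ℝ) : Prop :=
  LocallyIntegrableOn f Ω ∧ LocallyIntegrableOn g Ω ∧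
    ∀ ψ : E d → ℝ, ContDiff ℝ ∞ ψ → HasCompactSupport ψ → tsupport ψ ⊆ Ω →
      ∫ x in Ω, f x * fderiv ℝ ψ x (EuclideanSpace.single i 1) = -∫ x in Ω, g x * ψ x

open Classical in
/-- The weak partial derivative `∂f/∂xᵢ` on `Ω` (unique up to null sets); `0` if there is none. -/
def weakPartial {d : ℕ} (Ω : Set (E d)) (i : Fin d) (f : E d → ℝ) : E d → ℝ :=
  if h : ∃ g, HasWeakPartial Ω i f g then h.choose else 0

/-- `f ∈ W^{k,p}(Ω)`: all weak derivatives of order at most `k` exist and lie in `Lᵖ(Ω)`. -/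
def MemSobolev {d : ℕ} (Ω : Set (E d)) (p : ℝ) : ℕ → (E d → ℝ) → Prop
  | 0, f => MemLp f (ENNReal.ofReal p) (volume.restrict Ω)
  | k + 1, f => MemLp f (ENNReal.ofReal p) (volume.restrict Ω) ∧
      ∀ i, ∃ g, HasWeakPartial Ω i f g ∧ MemSobolev Ω p k g

/-- The seminorm `|f|_{W^{1,p}(Ω)} = (∑ᵢ ‖∂f/∂xᵢ‖_{Lᵖ(Ω)}ᵖ)^{1/p}`. -/
def sobolevSeminorm {d : ℕ} (Ω : Set (E d)) (p : ℝ) (f : E d → ℝ) : ℝ :=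
  (∑ i, ∫ x in Ω, |weakPartial Ω i f x| ^ p) ^ (1 / p)

/-- The (weak) directional derivative `∂f/∂v = (v · ∇) f` on `Ω`. -/
def dirDeriv {d : ℕ} (Ω : Set (E d)) (v : E d) (f : E d → ℝ) : E d → ℝ :=
  fun x => ∑ j, v j * weakPartial Ω j f x

/-! ### Simplices, traces and the Crouzeix–Raviart interpolation -/

/-- The closed simplex `T` with vertices `P`. -/
def simplex {d : ℕ} (P : AffineBasis (Fin (d + 1)) ℝ (E d)) : Set (E d) :=
  convexHull ℝ (Set.range P)

/-- The face `Fᵢ` of `T` opposite to the vertex `P i`. -/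
def face {d : ℕ} (P : AffineBasis (Fin (d + 1)) ℝ (E d)) (i : Fin (d + 1)) : Set (E d) :=
  convexHull ℝ (P '' {i}ᶜ)

/-- The surface measure on the face `Fᵢ`. -/
def faceMeasure {d : ℕ} (P : AffineBasis (Fin (d + 1)) ℝ (E d)) (i : Fin (d + 1)) :
    Measure (E d) :=
  (Measure.euclideanHausdorffMeasure (d - 1)).restrict (face P i)

/-- `g ∈ L¹(Fᵢ)` is the trace on `Fᵢ` of `φ ∈ W^{1,1}(T)`: there are functions smooth up to the
boundary that converge to `φ` in `W^{1,1}(T)` and whose restrictions to `Fᵢ` converge to `g`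
in `L¹(Fᵢ)`. -/
def IsFaceTrace {d : ℕ} (P : AffineBasis (Fin (d + 1)) ℝ (E d)) (i : Fin (d + 1))
    (φ g : E d → ℝ) : Prop :=
  MemLp g 1 (faceMeasure P i) ∧
  ∃ u : ℕ → E d → ℝ, (∀ n, ContDiff ℝ ∞ (u n)) ∧
    Tendsto (fun n => eLpNorm (fun x => u n x - φ x) 1
      (volume.restrict (interior (simplex P)))) atTop (𝓝 0) ∧
    (∀ j, Tendsto (fun n => eLpNorm
      (fun x => fderiv ℝ (u n) x (EuclideanSpace.single j 1) -
        weakPartial (interior (simplex P)) j φ x) 1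
      (volume.restrict (interior (simplex P)))) atTop (𝓝 0)) ∧
    Tendsto (fun n => eLpNorm (fun x => u n x - g x) 1 (faceMeasure P i)) atTop (𝓝 0)

open Classical in
/-- The trace of `φ` on the face `Fᵢ` (unique up to null sets); `0` if there is none. -/
def faceTrace {d : ℕ} (P : AffineBasis (Fin (d + 1)) ℝ (E d)) (i : Fin (d + 1))
    (φ : E d → ℝ) : E d → ℝ :=
  if h : ∃ g, IsFaceTrace P i φ g then h.choose else 0

/-- The degree of freedom `χᵢ(φ) = |Fᵢ|⁻¹ ∫_{Fᵢ} φ ds`. -/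
def faceMean {d : ℕ} (P : AffineBasis (Fin (d + 1)) ℝ (E d)) (i : Fin (d + 1))
    (φ : E d → ℝ) : ℝ :=
  1 / (faceMeasure P i).real Set.univ * ∫ x, faceTrace P i φ x ∂(faceMeasure P i)

/-- The nodal basis function `θᵢ = d (1/d - λᵢ)`, with `λᵢ` the barycentric coordinates of `T`. -/
def crBasis {d : ℕ} (P : AffineBasis (Fin (d + 1)) ℝ (E d)) (i : Fin (d + 1)) (x : E d) : ℝ :=
  d * (1 / d - P.coord i x)

/-- The local Crouzeix–Raviart interpolation `I_T^{CR} φ = ∑ᵢ χᵢ(φ) θᵢ`. -/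
def crInterp {d : ℕ} (P : AffineBasis (Fin (d + 1)) ℝ (E d)) (φ : E d → ℝ) : E d → ℝ :=
  fun x => ∑ i, faceMean P i φ * crBasis P i x

/-- The unit vector pointing from `x` to `y`. -/
def unitVec {d : ℕ} (x y : E d) : E d := (1 / ‖y - x‖) • (y - x)

/-- The map `Φ_T(x) = A_T x + b_T` with `A_T ∈ O(d)`. -/
def rigidMap {d : ℕ} (A : E d ≃ₗᵢ[ℝ] E d) (b : E d) : E d → E d := fun x => A x + b

/-! ### Triangles -/

/-- The labelling of a triangle: `p₂p₃` is the longest edge and `|p₁p₃| ≤ |p₁p₂|`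
(vertices are numbered from `0` in the code). -/
structure TriLabelled (P : Fin 3 → E 2) : Prop where
  longest : ∀ i j, dist (P i) (P j) ≤ dist (P 1) (P 2)
  h_le : dist (P 0) (P 2) ≤ dist (P 0) (P 1)

/-- `h₁ = |p₁p₂|`, `h₂ = |p₁p₃|`. -/
def triH (P : Fin 3 → E 2) : Fin 2 → ℝ := ![dist (P 0) (P 1), dist (P 0) (P 2)]

/-- The directions `r₁, r₂` of the edges `p₁p₂`, `p₁p₃`. -/
def triR (P : Fin 3 → E 2) : Fin 2 → E 2 := ![unitVec (P 0) (P 1), unitVec (P 0) (P 2)]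

/-- The parameters of a triangle in standard position. -/
structure TriParam where
  (h₁ h₂ s t : ℝ)
  h₁_pos : 0 < h₁
  h₂_pos : 0 < h₂
  unit : s ^ 2 + t ^ 2 = 1
  t_pos : 0 < t

/-- The vertices of the triangle `T̃` in standard position. -/
def TriParam.vertex (θ : TriParam) : Fin 3 → E 2 :=
  ![!₂[0, 0], !₂[θ.h₁, 0], !₂[θ.h₂ * θ.s, θ.h₂ * θ.t]]

/-- The parameters `H̃₁ = h₁`, `H̃₂ = h₂ t`. -/
def TriParam.H (θ : TriParam) : Fin 2 → ℝ := ![θ.h₁, θ.h₂ * θ.t]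

/-! ### Tetrahedra -/

/-- The two types of tetrahedra: (i) and (ii). -/
inductive TetType
  | one
  | two

/-- The vertex joined to `p₃` by the edge of length `h₂`: `p₁` for type (i), `p₂` for type (ii). -/
def TetType.base : TetType → Fin 4
  | .one => 0
  | .two => 1

/-- The signed position of `x` relative to the plane through the midpoint of `p₁p₂` perpendicular
to `p₁ - p₂`; it is positive on the side of `p₁`. -/
def bisectorSide (P : Fin 4 → E 3) (x : E 3) : ℝ :=
  inner ℝ (x - midpoint ℝ (P 0) (P 1)) (P 0 - P 1)

/-- The labelling of a tetrahedron of type `τ`: the edge from `p₁` (type (i)) or `p₂` (type (ii))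
to `p₃` is a shortest edge, `p₁p₂` is a longest one of the four edges that share an endpoint with
it, `p₄` lies in the half-space of `p₁` bounded by the perpendicular bisector plane of `p₁p₂`,
and `p₃` lies in the same half-space as `p₄` for type (i), in the opposite one for type (ii). -/
structure TetLabelled (τ : TetType) (P : Fin 4 → E 3) : Prop where
  shortest : ∀ i j, i ≠ j → dist (P τ.base) (P 2) ≤ dist (P i) (P j)
  longest : ∀ k, k ≠ τ.base → k ≠ 2 →
    dist (P τ.base) (P k) ≤ dist (P 0) (P 1) ∧ dist (P 2) (P k) ≤ dist (P 0) (P 1)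
  side_four : 0 ≤ bisectorSide P (P 3)
  side_three_one : τ = .one → 0 ≤ bisectorSide P (P 2)
  side_three_two : τ = .two → bisectorSide P (P 2) ≤ 0

/-- `h₁ = |p₁p₂|`, `h₂ = |p₁p₃|` (type (i)) or `|p₂p₃|` (type (ii)), `h₃ = |p₁p₄|`. -/
def tetH (τ : TetType) (P : Fin 4 → E 3) : Fin 3 → ℝ :=
  ![dist (P 0) (P 1), dist (P τ.base) (P 2), dist (P 0) (P 3)]

/-- The directions `r₁, r₂, r₃` of the edges of lengths `h₁, h₂, h₃`. -/
def tetR (τ : TetType) (P : Fin 4 → E 3) : Fin 3 → E 3 :=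
  ![unitVec (P 0) (P 1), unitVec (P τ.base) (P 2), unitVec (P 0) (P 3)]

/-- The parameters of a tetrahedron in standard position. -/
structure TetParam where
  (h₁ h₂ h₃ s₁ t₁ s₂₁ s₂₂ t₂ : ℝ)
  h₁_pos : 0 < h₁
  h₂_pos : 0 < h₂
  h₃_pos : 0 < h₃
  unit₁ : s₁ ^ 2 + t₁ ^ 2 = 1
  s₁_pos : 0 < s₁
  t₁_pos : 0 < t₁
  h₂_s₁_le : h₂ * s₁ ≤ h₁ / 2
  unit₂ : s₂₁ ^ 2 + s₂₂ ^ 2 + t₂ ^ 2 = 1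
  t₂_pos : 0 < t₂
  h₃_s₂₁_le : h₃ * s₂₁ ≤ h₁ / 2

/-- The vertices of the tetrahedron `T̃` of type `τ` in standard position. -/
def TetParam.vertex (θ : TetParam) (τ : TetType) : Fin 4 → E 3 :=
  ![!₂[0, 0, 0], !₂[θ.h₁, 0, 0],
    match τ with
    | .one => !₂[θ.h₂ * θ.s₁, θ.h₂ * θ.t₁, 0]
    | .two => !₂[θ.h₁ - θ.h₂ * θ.s₁, θ.h₂ * θ.t₁, 0],
    !₂[θ.h₃ * θ.s₂₁, θ.h₃ * θ.s₂₂, θ.h₃ * θ.t₂]]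

/-- The parameters `H̃₁ = h₁`, `H̃₂ = h₂ t₁`, `H̃₃ = h₃ t₂`. -/
def TetParam.H (θ : TetParam) : Fin 3 → ℝ := ![θ.h₁, θ.h₂ * θ.t₁, θ.h₃ * θ.t₂]

/-! ### The two right-hand sides -/

/-- `|T|^{1/q-1/p} ∑ᵢ hᵢ |∂φ/∂rᵢ|_{W^{1,p}(T)}`. -/
def edgeBound {d : ℕ} (P : AffineBasis (Fin (d + 1)) ℝ (E d)) (p q : ℝ)
    (h : Fin d → ℝ) (r : Fin d → E d) (φ : E d → ℝ) : ℝ :=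
  volume.real (simplex P) ^ (1 / q - 1 / p) *
    ∑ i, h i * sobolevSeminorm (interior (simplex P)) p
      (dirDeriv (interior (simplex P)) (r i) φ)

/-- `|T|^{1/q-1/p} ∑ᵢ H̃ᵢ |∂(φ ∘ Φ)/∂x̃ᵢ|_{W^{1,p}(Φ⁻¹(T))}`. -/
def rotatedBound {d : ℕ} (P : AffineBasis (Fin (d + 1)) ℝ (E d)) (p q : ℝ)
    (H : Fin d → ℝ) (Φ : E d → E d) (φ : E d → ℝ) : ℝ :=
  volume.real (simplex P) ^ (1 / q - 1 / p) *
    ∑ i, H i * sobolevSeminorm (interior (Φ ⁻¹' simplex P)) p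
      (weakPartial (interior (Φ ⁻¹' simplex P)) i (φ ∘ Φ))

end

end AnisoCR

open AnisoCR

/-! The gradient of the Crouzeix–Raviart interpolant is the mean of the gradient of `φ` over `T`.
Hence each component of the gradient of the error is `m - v`, where `v = ∂φ/∂xⱼ` and `m` is its mean
over `T`, and the theorem becomes a Sobolev–Poincaré inequality for the first derivatives of `φ`.

Anisotropy costs nothing if that inequality is written in affine-invariant form. With normalized
Lebesgue measure on `T`, the `L^q` norm of `v - m` is at most `C` times the sum over `k` of the
`L^p` norms of the derivatives of `v` along the edges `P k.succ - P 0`. Affine maps between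
simplices preserve both the measures and the edges, so `C` depends on `d, p, q` only
(`exists_weak_sobolev_poincare`). Returning to Lebesgue measure produces the power `|T|^(1/q-1/p)`
(`exists_memLp_sub_mean`). It remains to write each edge as a combination of the vectors `hᵢ rᵢ`
with bounded coefficients and to interchange the two derivatives (`exists_crInterp_estimate`). For
the first estimate the coefficients are 0 and 1. For the second one takes `rᵢ = A eᵢ`, and the
coefficients are the entries of the edges in standard position divided by the `H i`
(`exists_crInterp_rotated_estimate`); the labelling and, for `d = 3`, the bound on `s₂₂` keep them
bounded.

The Sobolev–Poincaré inequality is first proved for smooth functions. The case from `W^{1,1}` to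
`L^{d/(d-1)}` comes from Gagliardo's argument along lines parallel to the axes, near one vertex of
the reference simplex at a time (`exists_lintegral_rpow_le_edgeGrad`). Applying it to powers of
`|u|` gives the other critical exponents, and averaging over segments gives the Poincaré part.
Density of smooth functions (`exists_contDiff_approx`) and Fatou's lemma extend it to weakly
differentiable functions.

The formula for the gradient of the interpolant rests on `faceMean_eq`. Integrating along the rays
from `pᵢ` turns a face mean into the mean over `T` of `φ + (x - pᵢ) · ∇φ / d`. This also constructs
the traces. Since the linear parts of the barycentric coordinates sum to zero and reproduce vectors
from the vertices, only the mean of `∇φ` survives in the gradient (`fderiv_crInterp`). -/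

namespace AnisoCR

/-! ### Calculus of weak partial derivatives. -/

section WeakDerivatives

variable {d : ℕ} {Ω : Set (E d)} {i j : Fin d} {f g f' g' : E d → ℝ}

lemma integrable_mul_of_tsupport_subset (hf : LocallyIntegrableOn f Ω) {ψ : E d → ℝ}
    (hψ : Continuous ψ) (hc : HasCompactSupport ψ) (hs : tsupport ψ ⊆ Ω) :
    Integrable (fun x => f x * ψ x) := by
  have h1 : IntegrableOn (fun x => f x * ψ x) (tsupport ψ) :=
    (hf.integrableOn_compact_subset hs hc).mul_continuousOn hψ.continuousOn hc
  rwa [integrableOn_iff_integrable_of_support_subset] at h1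
  intro x hx
  exact subset_tsupport _ (right_ne_zero_of_mul hx)

lemma contDiff_fderiv_apply {ψ : E d → ℝ} (h : ContDiff ℝ ∞ ψ) (v : E d) :
    ContDiff ℝ ∞ (fun x => fderiv ℝ ψ x v) :=
  (h.fderiv_right (m := ∞) (by simp)).clm_apply contDiff_const

lemma HasWeakPartial.integrable_left (h : HasWeakPartial Ω i f g) {ψ : E d → ℝ}
    (hψ : ContDiff ℝ ∞ ψ) (hc : HasCompactSupport ψ) (hs : tsupport ψ ⊆ Ω) :
    IntegrableOn (fun x => f x * fderiv ℝ ψ x (EuclideanSpace.single i 1)) Ω :=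
  (integrable_mul_of_tsupport_subset h.1 (contDiff_fderiv_apply hψ _).continuous
    (hc.fderiv_apply ℝ _) ((tsupport_fderiv_apply_subset ℝ _).trans hs)).integrableOn

lemma HasWeakPartial.integrable_right (h : HasWeakPartial Ω i f g) {ψ : E d → ℝ}
    (hψ : ContDiff ℝ ∞ ψ) (hc : HasCompactSupport ψ) (hs : tsupport ψ ⊆ Ω) :
    IntegrableOn (fun x => g x * ψ x) Ω :=
  (integrable_mul_of_tsupport_subset h.2.1 hψ.continuous hc hs).integrableOn

lemma LocallyIntegrableOn.congr_ae (hf : LocallyIntegrableOn f Ω)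
    (h : f =ᵐ[volume.restrict Ω] f') : LocallyIntegrableOn f' Ω := by
  intro x hx
  obtain ⟨s, hs, hfs⟩ := hf x hx
  refine ⟨s ∩ Ω, inter_mem hs self_mem_nhdsWithin, ?_⟩
  exact (hfs.mono_set Set.inter_subset_left).congr
    (ae_mono (Measure.restrict_mono Set.inter_subset_right le_rfl) h)

/-- Weak derivatives do not see null sets. This allows the arbitrarily chosen `weakPartial` to be
exchanged with any concrete representative. -/
lemma HasWeakPartial.congr (h : HasWeakPartial Ω i f g) (hf : f =ᵐ[volume.restrict Ω] f')
    (hg : g =ᵐ[volume.restrict Ω] g') : HasWeakPartial Ω i f' g' := by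
  refine ⟨LocallyIntegrableOn.congr_ae h.1 hf, LocallyIntegrableOn.congr_ae h.2.1 hg, ?_⟩
  intro ψ h1 h2 h3
  have e1 : ∫ x in Ω, f' x * fderiv ℝ ψ x (EuclideanSpace.single i 1)
      = ∫ x in Ω, f x * fderiv ℝ ψ x (EuclideanSpace.single i 1) :=
    integral_congr_ae (by filter_upwards [hf] with x hx; rw [hx])
  have e2 : ∫ x in Ω, g' x * ψ x = ∫ x in Ω, g x * ψ x :=
    integral_congr_ae (by filter_upwards [hg] with x hx; rw [hx])
  rw [e1, e2, h.2.2 ψ h1 h2 h3]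

lemma HasWeakPartial.add (h : HasWeakPartial Ω i f g) (h' : HasWeakPartial Ω i f' g') :
    HasWeakPartial Ω i (fun x => f x + f' x) (fun x => g x + g' x) := by
  refine ⟨h.1.add h'.1, h.2.1.add h'.2.1, ?_⟩
  intro ψ h1 h2 h3
  simp only [add_mul]
  rw [integral_add (h.integrable_left h1 h2 h3) (h'.integrable_left h1 h2 h3),
    integral_add (h.integrable_right h1 h2 h3) (h'.integrable_right h1 h2 h3),
    h.2.2 ψ h1 h2 h3, h'.2.2 ψ h1 h2 h3]
  ring

lemma HasWeakPartial.const_mul (h : HasWeakPartial Ω i f g) (c : ℝ) :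
    HasWeakPartial Ω i (fun x => c * f x) (fun x => c * g x) := by
  refine ⟨h.1.smul c, h.2.1.smul c, ?_⟩
  intro ψ h1 h2 h3
  simp only [mul_assoc]
  rw [integral_const_mul, integral_const_mul, h.2.2 ψ h1 h2 h3]
  ring

lemma HasWeakPartial.sub (h : HasWeakPartial Ω i f g) (h' : HasWeakPartial Ω i f' g') :
    HasWeakPartial Ω i (fun x => f x - f' x) (fun x => g x - g' x) := by
  simpa [sub_eq_add_neg] using h.add (h'.const_mul (-1))

lemma HasWeakPartial.zero : HasWeakPartial Ω i (fun _ => (0 : ℝ)) (fun _ => 0) :=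
  ⟨locallyIntegrableOn_zero, locallyIntegrableOn_zero, by simp⟩

lemma HasWeakPartial.sum {ι : Type*} (s : Finset ι) {F G : ι → E d → ℝ}
    (h : ∀ k ∈ s, HasWeakPartial Ω i (F k) (G k)) :
    HasWeakPartial Ω i (fun x => ∑ k ∈ s, F k x) (fun x => ∑ k ∈ s, G k x) := by
  classical
  induction s using Finset.induction_on with
  | empty => simpa using HasWeakPartial.zero
  | insert a s ha ih =>
    simp only [Finset.sum_insert ha]
    exact (h a (by simp)).add (ih fun k hk => h k (by simp [hk]))

/-- This is the fundamental lemma of the calculus of variations, applied to `g - g'`. -/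
lemma HasWeakPartial.unique (hΩ : IsOpen Ω) (h : HasWeakPartial Ω i f g)
    (h' : HasWeakPartial Ω i f g') : g =ᵐ[volume.restrict Ω] g' := by
  have h0 := hΩ.ae_eq_zero_of_integral_contDiff_smul_eq_zero (μ := volume)
    (f := fun x => g x - g' x) (h.2.1.sub h'.2.1) (by
      intro ψ h1 h2 h3
      have e : ∀ x, ψ x • (g x - g' x) = g x * ψ x - g' x * ψ x := by
        intro x; simp only [smul_eq_mul]; ring
      simp only [e]
      rw [integral_sub (integrable_mul_of_tsupport_subset h.2.1 h1.continuous h2 h3)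
        (integrable_mul_of_tsupport_subset h'.2.1 h1.continuous h2 h3)]
      have r : ∀ k : E d → ℝ, ∫ x in Ω, k x * ψ x = ∫ x, k x * ψ x := fun k =>
        setIntegral_eq_integral_of_forall_compl_eq_zero (by
          intro x hx
          rw [image_eq_zero_of_notMem_tsupport (fun hx' => hx (h3 hx')), mul_zero])
      have e1 := h.2.2 ψ h1 h2 h3
      have e2 := h'.2.2 ψ h1 h2 h3
      rw [r] at e1 e2
      linarith)
  rw [Filter.EventuallyEq, ae_restrict_iff' hΩ.measurableSet]
  filter_upwards [h0] with x hx hxΩ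
  linarith [hx hxΩ]

lemma HasWeakPartial.weakPartial (h : HasWeakPartial Ω i f g) :
    HasWeakPartial Ω i f (weakPartial Ω i f) := by
  have h' : ∃ g, HasWeakPartial Ω i f g := ⟨g, h⟩
  rw [AnisoCR.weakPartial, dif_pos h']
  exact h'.choose_spec

lemma HasWeakPartial.weakPartial_ae_eq (hΩ : IsOpen Ω) (h : HasWeakPartial Ω i f g) :
    AnisoCR.weakPartial Ω i f =ᵐ[volume.restrict Ω] g :=
  h.weakPartial.unique hΩ h

lemma fderiv_fderiv_apply_comm {ψ : E d → ℝ} (h : ContDiff ℝ ∞ ψ) (v w x : E d) :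
    fderiv ℝ (fun y => fderiv ℝ ψ y v) x w = fderiv ℝ (fun y => fderiv ℝ ψ y w) x v := by
  have hd : DifferentiableAt ℝ (fderiv ℝ ψ) x :=
    ((h.fderiv_right (m := ∞) (by simp)).differentiable (by simp)).differentiableAt
  have e : ∀ v w, fderiv ℝ (fun y => fderiv ℝ ψ y v) x w = fderiv ℝ (fderiv ℝ ψ) x w v := by
    intro v w
    rw [fderiv_clm_apply hd (by fun_prop)]
    simp
  rw [e, e]
  exact (h.contDiffAt.isSymmSndFDerivAt (by simpa using WithTop.coe_le_coe.2 (le_top (a := (2 : ℕ∞))))) w v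

/-- Weak second derivatives commute. -/
lemma HasWeakPartial.comm {gj gij : E d → ℝ} (h : HasWeakPartial Ω i f g)
    (hj : HasWeakPartial Ω j f gj) (hij : HasWeakPartial Ω j g gij) :
    HasWeakPartial Ω i gj gij := by
  refine ⟨hj.2.1, hij.2.1, ?_⟩
  intro ψ h1 h2 h3
  have t : ∀ v, tsupport (fun x => fderiv ℝ ψ x v) ⊆ Ω := fun v =>
    (tsupport_fderiv_apply_subset ℝ _).trans h3
  have e1 := hj.2.2 _ (contDiff_fderiv_apply h1 (EuclideanSpace.single i 1))
    (h2.fderiv_apply ℝ _) (t _)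
  have e2 := h.2.2 _ (contDiff_fderiv_apply h1 (EuclideanSpace.single j 1))
    (h2.fderiv_apply ℝ _) (t _)
  have e3 := hij.2.2 ψ h1 h2 h3
  simp only [fderiv_fderiv_apply_comm h1 (EuclideanSpace.single i 1)
    (EuclideanSpace.single j 1)] at e1
  linarith

/-- Classical derivatives are weak derivatives. -/
lemma hasWeakPartial_of_contDiff (hf : ContDiff ℝ 1 f) (i : Fin d) :
    HasWeakPartial Ω i f (fun x => fderiv ℝ f x (EuclideanSpace.single i 1)) := by
  have hc : Continuous (fun x => fderiv ℝ f x (EuclideanSpace.single i 1)) :=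
    (hf.continuous_fderiv (by simp)).clm_apply continuous_const
  refine ⟨hf.continuous.locallyIntegrable.locallyIntegrableOn _,
    hc.locallyIntegrable.locallyIntegrableOn _, ?_⟩
  intro ψ h1 h2 h3
  have t : tsupport (fun x => fderiv ℝ ψ x (EuclideanSpace.single i 1)) ⊆ Ω :=
    (tsupport_fderiv_apply_subset ℝ _).trans h3
  rw [setIntegral_eq_integral_of_forall_compl_eq_zero (by
      intro x hx
      rw [image_eq_zero_of_notMem_tsupport (fun hx' => hx (t hx')), mul_zero]),
    setIntegral_eq_integral_of_forall_compl_eq_zero (by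
      intro x hx
      rw [image_eq_zero_of_notMem_tsupport (fun hx' => hx (h3 hx')), mul_zero])]
  have hψd : Continuous (fun x => fderiv ℝ ψ x (EuclideanSpace.single i 1)) :=
    (contDiff_fderiv_apply h1 _).continuous
  exact integral_mul_fderiv_eq_neg_fderiv_mul_of_integrable
    ((hc.mul h1.continuous).integrable_of_hasCompactSupport h2.mul_left)
    ((hf.continuous.mul hψd).integrable_of_hasCompactSupport (h2.fderiv_apply ℝ _).mul_left)
    ((hf.continuous.mul h1.continuous).integrable_of_hasCompactSupport h2.mul_left)
    (fun x _ => hf.differentiable (by simp) x) (fun x _ => h1.differentiable (by simp) x)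

end WeakDerivatives

/-! ### The Sobolev seminorm in terms of `Lᵖ` norms of weak derivatives. -/

lemma sum_rpow_le_rpow_sum {ι : Type*} (s : Finset ι) {a : ι → ℝ} (ha : ∀ i, 0 ≤ a i) {p : ℝ}
    (hp : 1 ≤ p) : (∑ i ∈ s, a i ^ p) ^ (1 / p) ≤ ∑ i ∈ s, a i := by
  have hS : 0 ≤ ∑ i ∈ s, a i := Finset.sum_nonneg fun i _ => ha i
  have h1 : ∑ i ∈ s, a i ^ p ≤ (∑ i ∈ s, a i) ^ p := by
    -- Splitting off one factor, each `a i ^ (p - 1)` can be bounded by the same power of the whole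
    -- sum.
    have e : ∀ x : ℝ, 0 ≤ x → x ^ p = x * x ^ (p - 1) := by
      intro x hx
      rw [← Real.rpow_one_add' hx (by linarith)]
      congr 1; ring
    rw [e _ hS, Finset.sum_mul]
    refine Finset.sum_le_sum fun i hi => ?_
    rw [e _ (ha i)]
    exact mul_le_mul_of_nonneg_left (Real.rpow_le_rpow (ha i)
      (Finset.single_le_sum (fun i _ => ha i) hi) (by linarith)) (ha i)
  calc (∑ i ∈ s, a i ^ p) ^ (1 / p) ≤ ((∑ i ∈ s, a i) ^ p) ^ (1 / p) :=
        Real.rpow_le_rpow (Finset.sum_nonneg fun i _ => Real.rpow_nonneg (ha i) _) h1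
          (by positivity)
    _ = ∑ i ∈ s, a i := by
        rw [← Real.rpow_mul hS, mul_one_div_cancel (by linarith), Real.rpow_one]

section Seminorm

variable {d : ℕ} {Ω : Set (E d)} {p : ℝ} {f : E d → ℝ}

lemma MemLp.integral_abs_rpow {μ : Measure (E d)} (hp : 1 ≤ p)
    (hf : MemLp f (ENNReal.ofReal p) μ) :
    ∫ x, |f x| ^ p ∂μ = (eLpNorm f (ENNReal.ofReal p) μ).toReal ^ p := by
  have hp0 : 0 < p := by linarith
  have h := hf.eLpNorm_eq_integral_rpow_norm (by simpa using hp0) ENNReal.ofReal_ne_top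
  have h0 : 0 ≤ ∫ x, |f x| ^ p ∂μ := integral_nonneg fun x => by positivity
  simp only [ENNReal.toReal_ofReal hp0.le, Real.norm_eq_abs] at h
  rw [h, ENNReal.toReal_ofReal (by positivity), ← Real.rpow_mul h0,
    inv_mul_cancel₀ hp0.ne', Real.rpow_one]

/-- The seminorm is defined through the chosen `weakPartial`; by uniqueness any other weak gradient
computes it. -/
lemma sobolevSeminorm_eq (hΩ : IsOpen Ω) (hp : 1 ≤ p) {g : Fin d → E d → ℝ}
    (h : ∀ i, HasWeakPartial Ω i f (g i))
    (hg : ∀ i, MemLp (g i) (ENNReal.ofReal p) (volume.restrict Ω)) :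
    sobolevSeminorm Ω p f =
      (∑ i, (eLpNorm (g i) (ENNReal.ofReal p) (volume.restrict Ω)).toReal ^ p) ^ (1 / p) := by
  unfold sobolevSeminorm
  congr 1
  refine Finset.sum_congr rfl fun i _ => ?_
  rw [← MemLp.integral_abs_rpow hp (hg i)]
  refine integral_congr_ae ?_
  filter_upwards [(h i).weakPartial_ae_eq hΩ] with x hx
  rw [hx]

lemma sobolevSeminorm_le_sum (hΩ : IsOpen Ω) (hp : 1 ≤ p) {g : Fin d → E d → ℝ}
    (h : ∀ i, HasWeakPartial Ω i f (g i))
    (hg : ∀ i, MemLp (g i) (ENNReal.ofReal p) (volume.restrict Ω)) :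
    sobolevSeminorm Ω p f ≤
      ∑ i, (eLpNorm (g i) (ENNReal.ofReal p) (volume.restrict Ω)).toReal := by
  rw [sobolevSeminorm_eq hΩ hp h hg]
  exact sum_rpow_le_rpow_sum _ (fun _ => ENNReal.toReal_nonneg) hp

lemma eLpNorm_le_sobolevSeminorm (hΩ : IsOpen Ω) (hp : 1 ≤ p) {g : Fin d → E d → ℝ}
    (h : ∀ i, HasWeakPartial Ω i f (g i))
    (hg : ∀ i, MemLp (g i) (ENNReal.ofReal p) (volume.restrict Ω)) (i : Fin d) :
    (eLpNorm (g i) (ENNReal.ofReal p) (volume.restrict Ω)).toReal ≤ sobolevSeminorm Ω p f := by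
  rw [sobolevSeminorm_eq hΩ hp h hg]
  have h0 := ENNReal.toReal_nonneg (a := eLpNorm (g i) (ENNReal.ofReal p) (volume.restrict Ω))
  calc _ = ((eLpNorm (g i) (ENNReal.ofReal p) (volume.restrict Ω)).toReal ^ p) ^ (1 / p) := by
        rw [← Real.rpow_mul h0, mul_one_div_cancel (by linarith), Real.rpow_one]
    _ ≤ _ := by
        refine Real.rpow_le_rpow (by positivity) ?_ (by positivity)
        exact Finset.single_le_sum (f := fun i =>
          (eLpNorm (g i) (ENNReal.ofReal p) (volume.restrict Ω)).toReal ^ p)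
          (fun i _ => by positivity) (Finset.mem_univ i)

lemma sobolevSeminorm_nonneg : 0 ≤ sobolevSeminorm Ω p f := by
  unfold sobolevSeminorm
  refine Real.rpow_nonneg (Finset.sum_nonneg fun i _ => integral_nonneg fun x => ?_) _
  positivity

/-- `dirDeriv` is built from the chosen weak partials, so it agrees with the combination of the `g
k` only almost everywhere; linearity is applied to the latter. -/
lemma hasWeakPartial_dirDeriv (hΩ : IsOpen Ω) {g : Fin d → E d → ℝ} {h : Fin d → Fin d → E d → ℝ}
    (hg : ∀ i, HasWeakPartial Ω i f (g i)) (hh : ∀ i j, HasWeakPartial Ω j (g i) (h i j))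
    (r : E d) (j : Fin d) :
    HasWeakPartial Ω j (dirDeriv Ω r f) (fun x => ∑ k, r k * h k j x) := by
  refine (HasWeakPartial.sum Finset.univ fun k _ => (hh k j).const_mul (r k)).congr ?_ .rfl
  have : ∀ᵐ x ∂(volume.restrict Ω), ∀ k, weakPartial Ω k f x = g k x :=
    ae_all_iff.2 fun k => (hg k).weakPartial_ae_eq hΩ
  filter_upwards [this] with x hx
  simp only [dirDeriv, hx]

end Seminorm

/-! ### Rigid motions: invariance of measures and norms, chain rule. -/

section Rigid

variable {d : ℕ} {Ω : Set (E d)} {f : E d → ℝ} (A : E d ≃ₗᵢ[ℝ] E d) (b : E d)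

/-- A rigid map as an isometry equivalence. -/
noncomputable def rigidEquiv : E d ≃ᵢ E d := A.toIsometryEquiv.trans (IsometryEquiv.addRight b)

lemma rigidMap_measurePreserving : MeasurePreserving (rigidMap A b) :=
  (measurePreserving_add_right volume b).comp A.measurePreserving

lemma rigidMap_measurableEmbedding : MeasurableEmbedding (rigidMap A b) :=
  (rigidEquiv A b).toHomeomorph.measurableEmbedding

lemma rigidMap_preimage_interior (s : Set (E d)) :
    interior (rigidMap A b ⁻¹' s) = rigidMap A b ⁻¹' interior s :=
  ((rigidEquiv A b).toHomeomorph.preimage_interior s).symm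

lemma eLpNorm_comp_rigidMap {μ : ENNReal} (hf : AEStronglyMeasurable f (volume.restrict Ω)) :
    eLpNorm (f ∘ rigidMap A b) μ (volume.restrict (rigidMap A b ⁻¹' Ω)) =
      eLpNorm f μ (volume.restrict Ω) :=
  eLpNorm_comp_measurePreserving hf
    ((rigidMap_measurePreserving A b).restrict_preimage_emb (rigidMap_measurableEmbedding A b) Ω)

lemma LocallyIntegrableOn.comp_rigidMap (hf : LocallyIntegrableOn f Ω) :
    LocallyIntegrableOn (f ∘ rigidMap A b) (rigidMap A b ⁻¹' Ω) := by
  intro x hx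
  obtain ⟨s, hs, hfs⟩ := hf _ hx
  refine ⟨rigidMap A b ⁻¹' s, ?_, ?_⟩
  · have hc : Continuous (rigidMap A b) := (rigidEquiv A b).continuous
    exact (tendsto_nhdsWithin_of_tendsto_nhds_of_eventually_within _
      (hc.continuousAt.tendsto.mono_left nhdsWithin_le_nhds) self_mem_nhdsWithin) hs
  · exact ((rigidMap_measurePreserving A b).integrableOn_comp_preimage
      (rigidMap_measurableEmbedding A b)).2 hfs

/-- Chain rule for weak derivatives under a rigid map. -/
lemma HasWeakPartial.comp_rigidMap {g : Fin d → E d → ℝ}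
    (h : ∀ i, HasWeakPartial Ω i f (g i)) (k : Fin d) :
    HasWeakPartial (rigidMap A b ⁻¹' Ω) k (f ∘ rigidMap A b)
      ((fun y => ∑ i, A (EuclideanSpace.single k 1) i * g i y) ∘ rigidMap A b) := by
  have hG : LocallyIntegrableOn (fun y => ∑ i, A (EuclideanSpace.single k 1) i * g i y) Ω := by
    have := fun s : Finset (Fin d) => Finset.induction_on (motive := fun s =>
      LocallyIntegrableOn (fun y => ∑ i ∈ s, A (EuclideanSpace.single k 1) i * g i y) Ω) s
      (by simpa using locallyIntegrableOn_zero) (by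
        intro a s ha ih
        simp only [Finset.sum_insert ha]
        exact ((h a).2.1.smul (A (EuclideanSpace.single k 1) a)).add ih)
    exact this _
  refine ⟨LocallyIntegrableOn.comp_rigidMap A b (h k).1,
    LocallyIntegrableOn.comp_rigidMap A b hG, ?_⟩
  intro ψ h1 h2 h3
  -- The weak derivative downstairs is tested against `ψ ∘ Φ⁻¹`; measure preservation then carries
  -- the identity back.
  set Ψ : E d → E d := fun y => A.symm (y - b) with hΨ
  have hΨΦ : ∀ x, Ψ (rigidMap A b x) = x := by intro x; simp [hΨ, rigidMap]
  have hΨc : ContDiff ℝ ∞ Ψ := A.symm.contDiff.comp (contDiff_id.sub contDiff_const)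
  set χ : E d → ℝ := ψ ∘ Ψ with hχ
  have c1 : ContDiff ℝ ∞ χ := h1.comp hΨc
  have hΨe : Ψ = (rigidEquiv A b).symm := by
    funext y; simp [hΨ, rigidEquiv, sub_eq_add_neg]
  have c2 : HasCompactSupport χ := by
    rw [hχ, hΨe]
    exact h2.comp_homeomorph (rigidEquiv A b).toHomeomorph.symm
  have c3 : tsupport χ ⊆ Ω := by
    intro y hy
    have : Ψ y ∈ tsupport ψ := by
      have hcl : IsClosed (Ψ ⁻¹' tsupport ψ) := (isClosed_tsupport ψ).preimage hΨc.continuous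
      refine closure_minimal ?_ hcl hy
      intro z hz
      exact subset_tsupport ψ hz
    have := h3 this
    simpa [hΨ, rigidMap] using this
  have hd : ∀ x, fderiv ℝ ψ x (EuclideanSpace.single k 1) =
      ∑ i, A (EuclideanSpace.single k 1) i *
        fderiv ℝ χ (rigidMap A b x) (EuclideanSpace.single i 1) := by
    intro x
    have e1 : ψ = χ ∘ rigidMap A b := by
      funext z; simp [hχ, hΨΦ]
    have hfd : HasFDerivAt (rigidMap A b) (A : E d →L[ℝ] E d) x :=
      (A : E d →L[ℝ] E d).hasFDerivAt.add_const b
    have e2 : fderiv ℝ ψ x = (fderiv ℝ χ (rigidMap A b x)).comp (A : E d →L[ℝ] E d) := by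
      conv_lhs => rw [e1]
      exact ((c1.differentiable (by simp) _).hasFDerivAt.comp x hfd).fderiv
    rw [e2]
    have e3 : A (EuclideanSpace.single k 1) =
        ∑ i, A (EuclideanSpace.single k 1) i • EuclideanSpace.single i (1 : ℝ) := by
      ext j; simp [Pi.single_apply]
    change fderiv ℝ χ (rigidMap A b x) (A (EuclideanSpace.single k 1)) = _
    conv_lhs => rw [e3]
    simp
  have key := fun i => (h i).2.2 χ c1 c2 c3
  have T := fun F : E d → ℝ => (rigidMap_measurePreserving A b).setIntegral_preimage_emb
    (rigidMap_measurableEmbedding A b) F Ω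
  calc ∫ x in rigidMap A b ⁻¹' Ω, (f ∘ rigidMap A b) x * fderiv ℝ ψ x (EuclideanSpace.single k 1)
      = ∫ y in Ω, f y * ∑ i, A (EuclideanSpace.single k 1) i *
          fderiv ℝ χ y (EuclideanSpace.single i 1) := by
        rw [← T]
        simp only [hd, Function.comp]
    _ = ∑ i, A (EuclideanSpace.single k 1) i *
          ∫ y in Ω, f y * fderiv ℝ χ y (EuclideanSpace.single i 1) := by
        simp only [Finset.mul_sum, mul_left_comm (f _)]
        rw [integral_finsetSum]
        · simp only [integral_const_mul]
        · exact fun i _ => ((h i).integrable_left c1 c2 c3).const_mul _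
    _ = -∑ i, A (EuclideanSpace.single k 1) i * ∫ y in Ω, g i y * χ y := by
        simp [key]
    _ = -∫ y in Ω, (∑ i, A (EuclideanSpace.single k 1) i * g i y) * χ y := by
        simp only [Finset.sum_mul, mul_assoc]
        rw [integral_finsetSum]
        · simp only [integral_const_mul]
        · exact fun i _ => ((h i).integrable_right c1 c2 c3).const_mul _
    _ = _ := by
        rw [← T]
        simp only [hχ, Function.comp, hΨΦ]

end Rigid

/-! ### Mollification combined with dilation. -/

section Approximation

open scoped Convolution ENNReal

variable {d : ℕ}

/-- Jensen's inequality for the power `p`, read off from the monotonicity of `Lᵖ` norms in the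
exponent on a probability space. -/
lemma lintegral_rpow_le_of_isProbabilityMeasure {α : Type*} [MeasurableSpace α] {m : Measure α}
    [IsProbabilityMeasure m] {g : α → ℝ≥0∞} (hg : AEMeasurable g m) {p : ℝ} (hp : 1 ≤ p) :
    (∫⁻ y, g y ∂m) ^ p ≤ ∫⁻ y, g y ^ p ∂m := by
  have hp0 : 0 < p := by linarith
  have h := eLpNorm'_le_eLpNorm'_of_exponent_le (μ := m) (f := g) one_pos hp
    hg.aestronglyMeasurable
  simp only [eLpNorm', enorm_eq_self, ENNReal.rpow_one, div_one] at h
  calc (∫⁻ y, g y ∂m) ^ p ≤ ((∫⁻ y, g y ^ p ∂m) ^ (1 / p)) ^ p := by gcongr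
    _ = _ := by rw [← ENNReal.rpow_mul, one_div_mul_cancel hp0.ne', ENNReal.rpow_one]

/-- Convolution with a normed bump function is a contraction on `Lᵖ`. -/
lemma eLpNorm_normed_convolution_le (η : ContDiffBump (0 : E d)) {f : E d → ℝ}
    (hf : Measurable f) {p : ℝ} (hp : 1 ≤ p) :
    eLpNorm (η.normed volume ⋆[ContinuousLinearMap.lsmul ℝ ℝ, volume] f) (ENNReal.ofReal p) volume
      ≤ eLpNorm f (ENNReal.ofReal p) volume := by
  have hp0 : 0 < p := by linarith
  set w : E d → ℝ≥0∞ := fun y => ‖η.normed volume y‖ₑ with hw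
  have hwm : Measurable w := η.continuous_normed.enorm.measurable
  have hw1 : ∫⁻ y, w y = 1 := by
    have : ∀ y, w y = ENNReal.ofReal (η.normed volume y) := fun y =>
      Real.enorm_of_nonneg (η.nonneg_normed y)
    simp only [this]
    rw [← ofReal_integral_eq_lintegral_ofReal η.integrable_normed
      (Eventually.of_forall η.nonneg_normed), η.integral_normed, ENNReal.ofReal_one]
  -- The normed bump is a probability density, so the convolution is an average of translates:
  -- Jensen pointwise, then Tonelli and translation invariance.
  have : IsProbabilityMeasure (volume.withDensity w) :=
    ⟨by rw [withDensity_apply _ MeasurableSet.univ, Measure.restrict_univ, hw1]⟩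
  have hfm : Measurable (fun z : E d × E d => ‖f (z.1 - z.2)‖ₑ ^ p) :=
    ((hf.comp measurable_sub).enorm).pow_const p
  have key : ∀ x, ‖(η.normed volume ⋆[ContinuousLinearMap.lsmul ℝ ℝ, volume] f) x‖ₑ ^ p ≤
      ∫⁻ y, w y * ‖f (x - y)‖ₑ ^ p := by
    intro x
    have hg : Measurable fun y => ‖f (x - y)‖ₑ := (hf.comp (measurable_const.sub measurable_id)).enorm
    calc _ ≤ (∫⁻ y, w y * ‖f (x - y)‖ₑ) ^ p := by
          gcongr
          rw [convolution_lsmul]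
          refine (enorm_integral_le_lintegral_enorm _).trans_eq ?_
          simp only [smul_eq_mul, enorm_mul, hw]
      _ = (∫⁻ y, ‖f (x - y)‖ₑ ∂(volume.withDensity w)) ^ p := by
          rw [lintegral_withDensity_eq_lintegral_mul _ hwm hg]; rfl
      _ ≤ ∫⁻ y, ‖f (x - y)‖ₑ ^ p ∂(volume.withDensity w) :=
          lintegral_rpow_le_of_isProbabilityMeasure hg.aemeasurable hp
      _ = _ := by
          rw [lintegral_withDensity_eq_lintegral_mul _ hwm (hg.pow_const p)]; rfl
  rw [eLpNorm_eq_lintegral_rpow_enorm_toReal (by simpa using hp0) ENNReal.ofReal_ne_top,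
    eLpNorm_eq_lintegral_rpow_enorm_toReal (by simpa using hp0) ENNReal.ofReal_ne_top,
    ENNReal.toReal_ofReal hp0.le]
  refine ENNReal.rpow_le_rpow ?_ (by positivity)
  calc _ ≤ ∫⁻ x, ∫⁻ y, w y * ‖f (x - y)‖ₑ ^ p := lintegral_mono key
    _ = ∫⁻ y, ∫⁻ x, w y * ‖f (x - y)‖ₑ ^ p :=
        lintegral_lintegral_swap (((hwm.comp measurable_snd).mul hfm).aemeasurable)
    _ = ∫⁻ y, w y * ∫⁻ x, ‖f x‖ₑ ^ p := by
        refine lintegral_congr fun y => ?_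
        rw [lintegral_const_mul _ (by fun_prop)]
        rw [lintegral_sub_right_eq_self (fun x => ‖f x‖ₑ ^ p) y]
    _ = _ := by rw [lintegral_mul_const _ hwm, hw1, one_mul]

lemma map_dilate (c : E d) {t : ℝ} (ht0 : 0 < t) :
    Measure.map (fun x : E d => c + t • (x - c)) volume =
      ENNReal.ofReal |(t ^ d)⁻¹| • volume := by
  have e : (fun x : E d => c + t • (x - c)) = (fun x => (c - t • c) + x) ∘ (fun x => t • x) := by
    funext x; simp only [Function.comp, smul_sub]; abel
  rw [e, ← Measure.map_map (measurable_const_add _) (measurable_const_smul t),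
    Measure.map_addHaar_smul _ ht0.ne', Measure.map_smul, map_add_left_eq_self]
  simp

lemma ofReal_abs_inv_pow_le (d : ℕ) {t : ℝ} (ht : 1 / 2 ≤ t) :
    ENNReal.ofReal |(t ^ d)⁻¹| ≤ 2 ^ d := by
  have ht0 : 0 < t := by linarith
  rw [abs_of_pos (by positivity), ← inv_pow, ENNReal.ofReal_pow (by positivity)]
  gcongr
  rw [← ENNReal.ofReal_ofNat]
  refine ENNReal.ofReal_le_ofReal ?_
  rw [inv_le_comm₀ ht0 (by norm_num)]
  linarith

/-- The change of variables gives the factor `t^(-d/p)`, which for `t ≥ 1/2` and `p ≥ 1` is at most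
`2^d`, uniformly in `t`. -/
lemma eLpNorm_comp_dilate_le (c : E d) {t : ℝ} (ht : 1 / 2 ≤ t) {F : E d → ℝ}
    (hF : AEStronglyMeasurable F volume) {p : ℝ} (hp : 1 ≤ p) :
    eLpNorm (fun x => F (c + t • (x - c))) (ENNReal.ofReal p) volume ≤
      2 ^ d * eLpNorm F (ENNReal.ofReal p) volume := by
  have ht0 : 0 < t := by linarith
  have hmap := map_dilate c ht0
  have hle := ofReal_abs_inv_pow_le d ht
  have hm : AEMeasurable (fun x : E d => c + t • (x - c)) volume :=
    (by fun_prop : Continuous fun x : E d => c + t • (x - c)).measurable.aemeasurable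
  have h := eLpNorm_map_measure (p := ENNReal.ofReal p) (g := F)
    (f := fun x : E d => c + t • (x - c)) (μ := volume)
    (by rw [hmap]; exact hF.smul_measure _) hm
  change eLpNorm (F ∘ fun x : E d => c + t • (x - c)) _ _ ≤ _
  rw [← h, hmap, eLpNorm_smul_measure_of_ne_top ENNReal.ofReal_ne_top]
  rw [smul_eq_mul]
  gcongr
  rw [show (1 / ENNReal.ofReal p).toReal = 1 / p by
    rw [ENNReal.toReal_div, ENNReal.toReal_one, ENNReal.toReal_ofReal (by linarith)]]
  have h1 : (1 : ℝ≥0∞) ≤ 2 ^ d := one_le_pow₀ (by norm_num)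
  calc ENNReal.ofReal |(t ^ d)⁻¹| ^ (1 / p) ≤ (2 ^ d : ℝ≥0∞) ^ (1 / p) := by gcongr
    _ ≤ (2 ^ d : ℝ≥0∞) ^ (1 : ℝ) :=
        ENNReal.rpow_le_rpow_of_exponent_le h1 (by rw [div_le_one (by linarith)]; exact hp)
    _ = _ := ENNReal.rpow_one _

/-- Convolution with a bump function followed by a dilation with centre `c`. -/
noncomputable def mollify (c : E d) (t : ℝ) (η : ContDiffBump (0 : E d)) (f : E d → ℝ) : E d → ℝ :=
  fun x => (η.normed volume ⋆[ContinuousLinearMap.lsmul ℝ ℝ, volume] f) (c + t • (x - c))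

lemma contDiff_mollify (c : E d) (t : ℝ) (η : ContDiffBump (0 : E d)) {f : E d → ℝ}
    (hf : LocallyIntegrable f) : ContDiff ℝ ∞ (mollify c t η f) :=
  (η.hasCompactSupport_normed.contDiff_convolution_left _ η.contDiff_normed hf).comp
    (by fun_prop)

lemma mollify_sub (c : E d) (t : ℝ) (η : ContDiffBump (0 : E d)) {f g : E d → ℝ}
    (hf : LocallyIntegrable f) (hg : LocallyIntegrable g) :
    mollify c t η (fun x => f x - g x) = fun x => mollify c t η f x - mollify c t η g x := by
  funext x
  simp only [mollify, convolution_lsmul]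
  have hI : ∀ {h : E d → ℝ}, LocallyIntegrable h → Integrable fun y =>
      η.normed volume y • h (c + t • (x - c) - y) := fun hh =>
    (η.hasCompactSupport_normed.convolutionExists_left (ContinuousLinearMap.lsmul ℝ ℝ)
      η.continuous_normed hh) (c + t • (x - c))
  rw [← integral_sub (hI hf) (hI hg)]
  simp only [smul_eq_mul, mul_sub]

lemma eLpNorm_mollify_le (c : E d) {t : ℝ} (ht : 1 / 2 ≤ t) (η : ContDiffBump (0 : E d))
    {f : E d → ℝ} (hf : Measurable f) (hfi : LocallyIntegrable f) {p : ℝ} (hp : 1 ≤ p) :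
    eLpNorm (mollify c t η f) (ENNReal.ofReal p) volume ≤
      2 ^ d * eLpNorm f (ENNReal.ofReal p) volume := by
  refine (eLpNorm_comp_dilate_le c ht ?_ hp).trans ?_
  · exact (η.hasCompactSupport_normed.contDiff_convolution_left (n := 0) _ η.contDiff_normed
      hfi).continuous.aestronglyMeasurable
  · gcongr
    exact eLpNorm_normed_convolution_le η hf hp

/-- A continuous function with compact support is uniformly continuous, and both the averaging
radius and the displacement `(t - 1)(x - c)` tend to zero uniformly on the bounded set `Ω`.
Convergence is therefore uniform on `Ω`, and `Ω` has finite measure. -/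
lemma tendsto_eLpNorm_mollify_sub_of_hasCompactSupport {Ω : Set (E d)} (hb : Bornology.IsBounded Ω)
    (c : E d) {t : ℕ → ℝ} (ht : Tendsto t atTop (𝓝 1)) {η : ℕ → ContDiffBump (0 : E d)}
    (hη : Tendsto (fun n => (η n).rOut) atTop (𝓝 0)) {h : E d → ℝ} (hc : Continuous h)
    (hs : HasCompactSupport h) {p : ℝ≥0∞} :
    Tendsto (fun n => eLpNorm (fun x => mollify c (t n) (η n) h x - h x) p (volume.restrict Ω))
      atTop (𝓝 0) := by
  have huc := hs.uniformContinuous_of_continuous hc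
  obtain ⟨R, hR0, hR⟩ : ∃ R > 0, ∀ x ∈ Ω, ‖x - c‖ ≤ R := by
    obtain ⟨R, hR⟩ := hb.subset_closedBall c
    refine ⟨max R 1, by positivity, fun x hx => ?_⟩
    have := hR hx
    rw [Metric.mem_closedBall, dist_eq_norm] at this
    exact this.trans (le_max_left _ _)
  have hfin : volume Ω < ⊤ := hb.measure_lt_top
  set K : ℝ≥0∞ := volume.restrict Ω Set.univ ^ p.toReal⁻¹ with hK
  have hKt : K ≠ ⊤ := by
    rw [hK, Measure.restrict_apply_univ]
    exact ENNReal.rpow_ne_top_of_nonneg (by positivity) hfin.ne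
  have hunif : ∀ ε > 0, ∀ᶠ n in atTop, ∀ x ∈ Ω, ‖mollify c (t n) (η n) h x - h x‖ ≤ ε := by
    intro ε hε
    obtain ⟨δ, hδ, hd⟩ := Metric.uniformContinuous_iff.1 huc (ε / 2) (half_pos hε)
    have ht' : ∀ᶠ n in atTop, |t n - 1| * R < δ := by
      have : Tendsto (fun n => |t n - 1| * R) atTop (𝓝 (|1 - 1| * R)) :=
        ((ht.sub_const 1).abs).mul_const R
      simp only [sub_self, abs_zero, zero_mul] at this
      exact this.eventually_lt_const hδ
    filter_upwards [ht', hη.eventually_lt_const hδ] with n h1 h2 x hx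
    have a1 : dist (mollify c (t n) (η n) h x) (h (c + t n • (x - c))) ≤ ε / 2 :=
      (η n).dist_normed_convolution_le hc.aestronglyMeasurable fun y hy =>
        (hd ((Metric.mem_ball.1 hy).trans h2)).le
    have a2 : dist (h (c + t n • (x - c))) (h x) < ε / 2 := by
      apply hd
      have : c + t n • (x - c) - x = (t n - 1) • (x - c) := by
        rw [sub_smul, one_smul]; abel
      rw [dist_eq_norm, this, norm_smul, Real.norm_eq_abs]
      exact (mul_le_mul_of_nonneg_left (hR x hx) (abs_nonneg _)).trans_lt h1
    rw [← dist_eq_norm]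
    linarith [dist_triangle (mollify c (t n) (η n) h x) (h (c + t n • (x - c))) (h x)]
  rw [ENNReal.tendsto_nhds_zero]
  intro ε hε
  obtain ⟨δ, hδ, hδε⟩ : ∃ δ : ℝ, 0 < δ ∧ K * ENNReal.ofReal δ ≤ ε := by
    have hcont : Tendsto (fun δ : ℝ => K * ENNReal.ofReal δ) (𝓝[>] 0) (𝓝 (K * ENNReal.ofReal 0)) :=
      (ENNReal.Tendsto.const_mul (ENNReal.continuous_ofReal.tendsto 0) (Or.inr hKt)).mono_left
        nhdsWithin_le_nhds
    simp only [ENNReal.ofReal_zero, mul_zero] at hcont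
    obtain ⟨δ, h1, h2⟩ := ((hcont.eventually_lt_const hε).and self_mem_nhdsWithin).exists
    exact ⟨δ, h2, h1.le⟩
  filter_upwards [hunif δ hδ] with n hn
  refine (eLpNorm_le_of_ae_bound (C := δ) ?_).trans hδε
  have hmeas : NullMeasurableSet {x | ‖mollify c (t n) (η n) h x - h x‖ ≤ δ} volume := by
    refine (measurableSet_le ?_ measurable_const).nullMeasurableSet
    exact (((contDiff_mollify c (t n) (η n) hc.locallyIntegrable).continuous.sub
      hc).norm).measurable
  rw [ae_restrict_iff₀ (hmeas.mono_ac Measure.restrict_le_self.absolutelyContinuous)]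
  exact Eventually.of_forall hn

/-- Continuous functions with compact support are dense in `Lᵖ` and the operators `mollify` are
uniformly bounded there for `t ≥ 1/2`, so convergence extends from the former. -/
lemma tendsto_eLpNorm_mollify_sub {Ω : Set (E d)} (hb : Bornology.IsBounded Ω)
    (c : E d) {t : ℕ → ℝ} (ht : Tendsto t atTop (𝓝 1)) {η : ℕ → ContDiffBump (0 : E d)}
    (hη : Tendsto (fun n => (η n).rOut) atTop (𝓝 0)) {f : E d → ℝ} (hfm : Measurable f)
    (hfi : LocallyIntegrable f) {p : ℝ} (hp : 1 ≤ p) (hf : MemLp f (ENNReal.ofReal p)) :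
    Tendsto (fun n => eLpNorm (fun x => mollify c (t n) (η n) f x - f x) (ENNReal.ofReal p)
      (volume.restrict Ω)) atTop (𝓝 0) := by
  have hp1 : 1 ≤ ENNReal.ofReal p := by simpa using hp
  rw [ENNReal.tendsto_nhds_zero]
  intro ε hε
  have hD : (2 ^ d + 2 : ℝ≥0∞) ≠ ⊤ := by finiteness
  have hε' : ε / (2 ^ d + 2) ≠ 0 := (ENNReal.div_pos hε.ne' hD).ne'
  obtain ⟨h, hs, hfh, hc, -⟩ :=
    hf.exists_hasCompactSupport_eLpNorm_sub_le ENNReal.ofReal_ne_top hε'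
  -- The error budget: `2^d κ` for the mollified `f - h`, and `κ` each for the error of `h` and for
  -- `f - h` itself.
  set κ := ε / (2 ^ d + 2) with hκ
  have hsub : LocallyIntegrable (fun x => f x - h x) := hfi.sub hc.locallyIntegrable
  filter_upwards [ENNReal.tendsto_nhds_zero.1
    (tendsto_eLpNorm_mollify_sub_of_hasCompactSupport hb c ht hη hc hs (p := ENNReal.ofReal p)) κ
    (pos_iff_ne_zero.2 hε'), ht.eventually_const_le (by norm_num : (1 / 2 : ℝ) < 1)] with n hn htn
  have e : (fun x => mollify c (t n) (η n) f x - f x) =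
      (mollify c (t n) (η n) (fun x => f x - h x) +
        (fun x => mollify c (t n) (η n) h x - h x)) - (f - h) := by
    funext x
    rw [mollify_sub c _ _ hfi hc.locallyIntegrable]
    simp only [Pi.add_apply, Pi.sub_apply]
    ring
  have m1 : AEStronglyMeasurable (mollify c (t n) (η n) (fun x => f x - h x))
      (volume.restrict Ω) := (contDiff_mollify c (t n) (η n) hsub).continuous.aestronglyMeasurable
  have m2 : AEStronglyMeasurable (fun x => mollify c (t n) (η n) h x - h x)
      (volume.restrict Ω) := ((contDiff_mollify c (t n) (η n)
        hc.locallyIntegrable).continuous.sub hc).aestronglyMeasurable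
  have m3 : AEStronglyMeasurable (f - h) (volume.restrict Ω) :=
    (hfm.sub hc.measurable).aestronglyMeasurable
  rw [e]
  calc _ ≤ (eLpNorm (mollify c (t n) (η n) (fun x => f x - h x)) (ENNReal.ofReal p)
            (volume.restrict Ω) +
          eLpNorm (fun x => mollify c (t n) (η n) h x - h x) (ENNReal.ofReal p)
            (volume.restrict Ω)) + eLpNorm (f - h) (ENNReal.ofReal p) (volume.restrict Ω) :=
        (eLpNorm_sub_le (m1.add m2) m3 hp1).trans (by gcongr; exact eLpNorm_add_le m1 m2 hp1)
    _ ≤ (2 ^ d * κ + κ) + κ := by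
        gcongr
        · refine (eLpNorm_mono_measure _ Measure.restrict_le_self).trans ?_
          refine (eLpNorm_mollify_le c htn (η n) (hfm.sub hc.measurable) hsub hp).trans ?_
          gcongr
        · exact (eLpNorm_mono_measure _ Measure.restrict_le_self).trans hfh
    _ = (2 ^ d + 2) * κ := by ring
    _ ≤ ε := by rw [hκ]; exact ENNReal.mul_div_le

/-- Mollification commutes with weak derivatives, away from the boundary. -/
lemma fderiv_mollify {Ω : Set (E d)} (c : E d) (t : ℝ) (η : ContDiffBump (0 : E d))
    {f g : E d → ℝ} (hf : LocallyIntegrable f) {i : Fin d} (h : HasWeakPartial Ω i f g)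
    (hf0 : ∀ x ∉ Ω, f x = 0) (hg0 : ∀ x ∉ Ω, g x = 0) {x : E d}
    (hx : Metric.closedBall (c + t • (x - c)) η.rOut ⊆ Ω) :
    fderiv ℝ (mollify c t η f) x (EuclideanSpace.single i 1) = t * mollify c t η g x := by
  set y := c + t • (x - c) with hy
  set w : E d → ℝ := η.normed volume with hw
  have hwc : ContDiff ℝ ∞ w := η.contDiff_normed
  have h1 : HasFDerivAt (w ⋆[ContinuousLinearMap.lsmul ℝ ℝ, volume] f)
      ((fderiv ℝ w ⋆[(ContinuousLinearMap.lsmul ℝ ℝ).precompL (E d), volume] f) y) y :=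
    η.hasCompactSupport_normed.hasFDerivAt_convolution_left _ (hwc.of_le (by simp)) hf y
  have h2 : HasFDerivAt (fun x : E d => c + t • (x - c))
      (t • ContinuousLinearMap.id ℝ (E d)) x :=
    (((hasFDerivAt_id x).sub_const c).const_smul t).const_add c
  have h3 : HasFDerivAt (mollify c t η f) _ x := HasFDerivAt.comp x h1 h2
  rw [h3.fderiv]
  have hex : ConvolutionExistsAt (fderiv ℝ w) f y
      ((ContinuousLinearMap.lsmul ℝ ℝ).precompL (E d)) volume :=
    (η.hasCompactSupport_normed.fderiv ℝ).convolutionExists_left _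
      (hwc.continuous_fderiv (by simp)) hf y
  have h4 : ((fderiv ℝ w ⋆[(ContinuousLinearMap.lsmul ℝ ℝ).precompL (E d), volume] f) y)
      (EuclideanSpace.single i 1) =
      ∫ z, fderiv ℝ w (y - z) (EuclideanSpace.single i 1) * f z := by
    rw [convolution_eq_swap,
      ContinuousLinearMap.integral_apply (convolutionExistsAt_iff_integrable_swap.1 hex)]
    simp
  simp only [ContinuousLinearMap.comp_apply, _root_.smul_apply,
    ContinuousLinearMap.id_apply, map_smul, smul_eq_mul]
  rw [h4]
  congr 1
  -- The derivative of the convolution at `y` pairs `f` with the derivative of this reflected bump.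
  -- It is an admissible test function because the ball of radius `η.rOut` around `y` lies in `Ω`.
  -- The factor `t` has already been split off by the chain rule.
  set ψ : E d → ℝ := fun z => w (y - z) with hψ
  have hψc : ContDiff ℝ ∞ ψ := hwc.comp (contDiff_const.sub contDiff_id)
  have hsupp : tsupport ψ ⊆ Metric.closedBall y η.rOut := by
    refine closure_minimal ?_ Metric.isClosed_closedBall
    intro z hz
    have : y - z ∈ Function.support w := hz
    rw [hw, η.support_normed_eq] at this
    rw [Metric.mem_closedBall, dist_comm, dist_eq_norm]
    exact (mem_ball_zero_iff.1 this).le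
  have hψs : HasCompactSupport ψ :=
    HasCompactSupport.intro (isCompact_closedBall y η.rOut) fun z hz =>
      image_eq_zero_of_notMem_tsupport fun h => hz (hsupp h)
  have hd : ∀ z, fderiv ℝ ψ z (EuclideanSpace.single i 1) =
      -fderiv ℝ w (y - z) (EuclideanSpace.single i 1) := by
    intro z
    have a1 : HasFDerivAt w (fderiv ℝ w (y - z)) (y - z) :=
      (hwc.differentiable (by simp) _).hasFDerivAt
    have a2 : HasFDerivAt (fun z : E d => y - z) (-ContinuousLinearMap.id ℝ (E d)) z :=
      (hasFDerivAt_id z).const_sub y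
    have a3 : HasFDerivAt ψ _ z := HasFDerivAt.comp z a1 a2
    rw [a3.fderiv]
    simp
  have hwk := h.2.2 ψ hψc hψs (hsupp.trans hx)
  rw [setIntegral_eq_integral_of_forall_compl_eq_zero (fun z hz => by rw [hf0 z hz, zero_mul]),
    setIntegral_eq_integral_of_forall_compl_eq_zero (fun z hz => by rw [hg0 z hz, zero_mul])] at hwk
  simp only [hd, mul_neg] at hwk
  rw [integral_neg, neg_inj] at hwk
  simp only [mollify, ← hy, convolution_lsmul_swap, smul_eq_mul]
  rw [← hw]
  simp only [mul_comm (fderiv ℝ w _ _)]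
  rw [hwk]
  simp only [hψ, mul_comm]

end Approximation

/-! ### Density of smooth functions in `W^{1,p}` of a bounded convex open set. -/

section Density

open scoped ENNReal

variable {d : ℕ} {Ω : Set (E d)}

/-- Convolution needs a function on the whole space. The zero extension may fail to be weakly
differentiable across the boundary, but it is only used at points whose mollification ball stays in
`Ω`. -/
lemma exists_measurable_zero_extension (hΩ : IsOpen Ω) (hb : Bornology.IsBounded Ω) {p : ℝ}
    (hp : 1 ≤ p) {v : E d → ℝ} (hv : MemLp v (ENNReal.ofReal p) (volume.restrict Ω)) :
    ∃ f : E d → ℝ, Measurable f ∧ LocallyIntegrable f ∧ MemLp f (ENNReal.ofReal p) ∧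
      (∀ x ∉ Ω, f x = 0) ∧ v =ᵐ[volume.restrict Ω] f := by
  have hfin : IsFiniteMeasure (volume.restrict Ω) :=
    ⟨by rw [Measure.restrict_apply_univ]; exact hb.measure_lt_top⟩
  set m := hv.1.mk v with hm
  have hmm : MemLp m (ENNReal.ofReal p) (volume.restrict Ω) := hv.ae_eq hv.1.ae_eq_mk
  have hmi : Integrable m (volume.restrict Ω) := hmm.integrable (by simpa using hp)
  refine ⟨Ω.indicator m, hv.1.stronglyMeasurable_mk.measurable.indicator hΩ.measurableSet,
    ?_, ?_, fun x hx => Set.indicator_of_notMem hx _, ?_⟩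
  · exact ((integrable_indicator_iff hΩ.measurableSet).2 hmi).locallyIntegrable
  · exact (memLp_indicator_iff_restrict hΩ.measurableSet).2 hmm
  · refine hv.1.ae_eq_mk.trans ?_
    exact (indicator_ae_eq_restrict hΩ.measurableSet).symm

/-- Functions that are smooth up to the boundary are dense in `W^{1,p}` of a bounded convex open
set. -/
theorem exists_contDiff_approx (hΩ : IsOpen Ω) (hb : Bornology.IsBounded Ω) (hconv : Convex ℝ Ω)
    (hne : Ω.Nonempty) {p : ℝ} (hp : 1 ≤ p) {v : E d → ℝ} {g : Fin d → E d → ℝ}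
    (hv : MemLp v (ENNReal.ofReal p) (volume.restrict Ω))
    (hg : ∀ i, MemLp (g i) (ENNReal.ofReal p) (volume.restrict Ω))
    (hw : ∀ i, HasWeakPartial Ω i v (g i)) :
    ∃ u : ℕ → E d → ℝ, (∀ n, ContDiff ℝ ∞ (u n)) ∧
      Tendsto (fun n => eLpNorm (fun x => u n x - v x) (ENNReal.ofReal p) (volume.restrict Ω))
        atTop (𝓝 0) ∧
      ∀ i, Tendsto (fun n => eLpNorm
        (fun x => fderiv ℝ (u n) x (EuclideanSpace.single i 1) - g i x) (ENNReal.ofReal p)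
        (volume.restrict Ω)) atTop (𝓝 0) := by
  have hp1 : 1 ≤ ENNReal.ofReal p := by simpa using hp
  obtain ⟨f, hfm, hfi, hfp, hf0, hvf⟩ := exists_measurable_zero_extension hΩ hb hp hv
  choose G hGm hGi hGp hG0 hgG using fun i => exists_measurable_zero_extension hΩ hb hp (hg i)
  obtain ⟨c, hc⟩ := hne
  obtain ⟨r, hr, hcr⟩ := Metric.nhds_basis_closedBall.mem_iff.1 (hΩ.mem_nhds hc)
  -- With `s = 1 / (n + 2)`, the dilation of ratio `1 - s` about `c` moves `Ω` inwards far enough to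
  -- leave room for mollification at radius `s r`, where `r` is the radius of a ball about `c` in
  -- `Ω`.
  set t : ℕ → ℝ := fun n => 1 - 1 / ((n : ℝ) + 2) with ht
  have hlim : Tendsto (fun n : ℕ => 1 / ((n : ℝ) + 2)) atTop (𝓝 0) := by
    have := (tendsto_one_div_add_atTop_nhds_zero_nat (𝕜 := ℝ)).comp (tendsto_add_atTop_nat 1)
    refine this.congr fun n => ?_
    simp only [Function.comp]; push_cast; ring
  have ht1 : Tendsto t atTop (𝓝 1) := by simpa only [sub_zero] using hlim.const_sub 1
  have hpos : ∀ n : ℕ, 0 < 1 / ((n : ℝ) + 2) := fun n => by positivity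
  let η : ℕ → ContDiffBump (0 : E d) := fun n =>
    ⟨1 / ((n : ℝ) + 2) * r / 2, 1 / ((n : ℝ) + 2) * r,
      by have := hpos n; positivity, half_lt_self (mul_pos (hpos n) hr)⟩
  have hη : Tendsto (fun n => (η n).rOut) atTop (𝓝 0) := by
    simpa only [zero_mul] using hlim.mul_const r
  have hball : ∀ n, ∀ x ∈ Ω, Metric.closedBall (c + t n • (x - c)) (η n).rOut ⊆ Ω := by
    intro n x hx y hy
    set s := 1 / ((n : ℝ) + 2) with hs
    have hs0 : 0 < s := hpos n
    have hs1 : s ≤ 1 := by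
      rw [hs, div_le_one (by positivity)]
      have : (0 : ℝ) ≤ n := Nat.cast_nonneg n
      linarith
    rw [mem_closedBall_iff_norm] at hy
    change ‖y - (c + t n • (x - c))‖ ≤ s * r at hy
    -- A point `y` of the small ball is `(1 - s) x + s z` with this `z` in the ball of radius `r`
    -- about `c`, so convexity places it in `Ω`.
    have hz : c + s⁻¹ • (y - (c + t n • (x - c))) ∈ Ω := by
      apply hcr
      rw [mem_closedBall_iff_norm, add_sub_cancel_left, norm_smul, Real.norm_of_nonneg (by positivity)]
      rw [inv_mul_le_iff₀ hs0]
      exact hy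
    have := hconv hx hz (by linarith : (0 : ℝ) ≤ 1 - s) hs0.le (by ring)
    convert! this using 1
    rw [smul_add, smul_smul, mul_inv_cancel₀ hs0.ne', one_smul]
    simp only [ht, ← hs, smul_sub, sub_smul, one_smul]
    abel
  refine ⟨fun n => mollify c (t n) (η n) f, fun n => contDiff_mollify c _ _ hfi, ?_, fun i => ?_⟩
  · refine (tendsto_eLpNorm_mollify_sub hb c ht1 hη hfm hfi hp hfp).congr fun n => ?_
    refine eLpNorm_congr_ae ?_
    filter_upwards [hvf] with x hx
    rw [hx]
  · have hwf : HasWeakPartial Ω i f (G i) := (hw i).congr hvf (hgG i)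
    have h1 := tendsto_eLpNorm_mollify_sub hb c ht1 hη (hGm i) (hGi i) hp (hGp i)
    -- Because of the chain rule factor `t n`, the derivative error is `t n` times the mollification
    -- error of `G i` plus `(t n - 1) • G i`; both vanish in the limit.
    have h2 : Tendsto (fun n => ‖t n‖ₑ * eLpNorm (fun x => mollify c (t n) (η n) (G i) x - G i x)
        (ENNReal.ofReal p) (volume.restrict Ω) + ‖t n - 1‖ₑ * eLpNorm (G i) (ENNReal.ofReal p)
        (volume.restrict Ω)) atTop (𝓝 (‖(1 : ℝ)‖ₑ * 0 + ‖(1 : ℝ) - 1‖ₑ * eLpNorm (G i)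
          (ENNReal.ofReal p) (volume.restrict Ω))) := by
      refine Tendsto.add (ENNReal.Tendsto.mul ht1.enorm (Or.inr (by simp)) h1 (Or.inr (by simp)))
        (ENNReal.Tendsto.mul_const (ht1.sub_const 1).enorm (Or.inr ?_))
      exact ((hGp i).mono_measure Measure.restrict_le_self).eLpNorm_ne_top
    simp only [mul_zero, sub_self, enorm_zero, zero_mul, add_zero] at h2
    refine tendsto_of_tendsto_of_tendsto_of_le_of_le tendsto_const_nhds h2 (fun _ => zero_le)
      fun n => ?_
    have e : (fun x => fderiv ℝ (mollify c (t n) (η n) f) x (EuclideanSpace.single i 1) - g i x)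
        =ᵐ[volume.restrict Ω] (t n • fun x => mollify c (t n) (η n) (G i) x - G i x) +
          (t n - 1) • G i := by
      filter_upwards [hgG i, ae_restrict_mem hΩ.measurableSet] with x hx hxΩ
      rw [fderiv_mollify c (t n) (η n) hfi hwf hf0 (hG0 i) (hball n x hxΩ), hx]
      simp only [Pi.add_apply, Pi.smul_apply, smul_eq_mul]
      ring
    rw [eLpNorm_congr_ae e]
    refine (eLpNorm_add_le ?_ ?_ hp1).trans ?_
    · exact (((contDiff_mollify c (t n) (η n) (hGi i)).continuous.measurable.sub
        (hGm i)).const_smul _).aestronglyMeasurable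
    · exact ((hGm i).const_smul _).aestronglyMeasurable
    · rw [eLpNorm_const_smul, eLpNorm_const_smul]

end Density

/-! ### The Gagliardo inequality on part of the reference simplex. -/

section GridLines

open scoped ENNReal

/-- A value of `w` is at most the mean of `|w|` over the interval plus the total variation. The
lower bound `δ` on the length makes the weight of the mean term uniform. -/
lemma enorm_le_lintegral_Icc_of_contDiff {w : ℝ → ℝ} (hw : ContDiff ℝ 1 w) {a b s δ : ℝ}
    (hδ : 0 < δ) (hab : a + δ ≤ b) (hs : s ∈ Set.Icc a b) :
    ‖w s‖ₑ ≤ ∫⁻ y in Set.Icc a b, (‖deriv w y‖ₑ + ENNReal.ofReal δ⁻¹ * ‖w y‖ₑ) := by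
  set D := ∫⁻ y in Set.Icc a b, ‖deriv w y‖ₑ with hD
  have h1 : ∀ y ∈ Set.Icc a b, ‖w s‖ₑ ≤ ‖w y‖ₑ + D := by
    intro y hy
    have key : ∀ y ∈ Set.Icc a b, ∀ z ∈ Set.Icc a b, y ≤ z → ‖w z - w y‖ₑ ≤ D := by
      intro y hy z hz hyz
      refine (enorm_sub_le_lintegral_deriv_of_contDiffOn_Icc hw.contDiffOn hyz).trans ?_
      exact lintegral_mono_set (Set.Icc_subset_Icc hy.1 hz.2)
    have h2 : ‖w s - w y‖ₑ ≤ D := by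
      rcases le_total y s with h | h
      · exact key y hy s hs h
      · rw [← enorm_neg, neg_sub]; exact key s hs y hy h
    calc ‖w s‖ₑ = ‖w y + (w s - w y)‖ₑ := by congr 1; ring
      _ ≤ ‖w y‖ₑ + ‖w s - w y‖ₑ := enorm_add_le _ _
      _ ≤ _ := by gcongr
  have hwm : Measurable fun y => ‖w y‖ₑ := hw.continuous.enorm.measurable
  have hdm : Measurable fun y => ‖deriv w y‖ₑ := (hw.continuous_deriv le_rfl).enorm.measurable
  have hba : 0 < b - a := by linarith
  set m := ENNReal.ofReal (b - a) with hm
  have hm0 : m ≠ 0 := by simpa [hm] using hba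
  have hmt : m ≠ ⊤ := ENNReal.ofReal_ne_top
  have h2 : m * ‖w s‖ₑ ≤ (∫⁻ y in Set.Icc a b, ‖w y‖ₑ) + m * D := by
    calc m * ‖w s‖ₑ = ∫⁻ y in Set.Icc a b, ‖w s‖ₑ := by
          rw [setLIntegral_const, Real.volume_Icc, mul_comm]
      _ ≤ ∫⁻ y in Set.Icc a b, (‖w y‖ₑ + D) :=
          setLIntegral_mono (hwm.add_const _) h1
      _ = _ := by
          rw [lintegral_add_right _ measurable_const, setLIntegral_const, Real.volume_Icc,
            mul_comm D]
  rw [lintegral_add_left hdm, lintegral_const_mul _ hwm]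
  have h3 : ‖w s‖ₑ ≤ m⁻¹ * (∫⁻ y in Set.Icc a b, ‖w y‖ₑ) + D := by
    calc ‖w s‖ₑ = m⁻¹ * (m * ‖w s‖ₑ) := by
          rw [← mul_assoc, ENNReal.inv_mul_cancel hm0 hmt, one_mul]
      _ ≤ m⁻¹ * ((∫⁻ y in Set.Icc a b, ‖w y‖ₑ) + m * D) := by gcongr
      _ = _ := by rw [mul_add, ← mul_assoc m⁻¹ m, ENNReal.inv_mul_cancel hm0 hmt, one_mul]
  rw [add_comm]
  refine h3.trans ?_
  gcongr
  rw [hm, ← ENNReal.ofReal_inv_of_pos hba]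
  exact ENNReal.ofReal_le_ofReal (inv_anti₀ hδ (by linarith))

/-- The reference simplex. -/
def refSimplex (d : ℕ) : Set (Fin d → ℝ) := {x | (∀ i, 0 ≤ x i) ∧ ∑ i, x i ≤ 1}

lemma isClosed_refSimplex (d : ℕ) : IsClosed (refSimplex d) := by
  have : refSimplex d = (⋂ i, {x | 0 ≤ x i}) ∩ {x | ∑ i, x i ≤ 1} := by
    ext x; simp [refSimplex]
  rw [this]
  exact (isClosed_iInter fun i => isClosed_le continuous_const (continuous_apply i)).inter
    (isClosed_le (by fun_prop) continuous_const)

lemma sum_update {d : ℕ} (x : Fin d → ℝ) (i : Fin d) (t : ℝ) :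
    ∑ j, Function.update x i t j = ∑ j, x j - x i + t := by
  rw [← Finset.add_sum_erase _ _ (Finset.mem_univ i),
    ← Finset.add_sum_erase Finset.univ x (Finset.mem_univ i), Function.update_self,
    Finset.sum_congr rfl fun j hj => Function.update_of_ne (Finset.ne_of_mem_erase hj) t x]
  ring

/-- The Sobolev inequality for `W^{1,1}` on the part of the reference simplex that is near the
origin. -/
lemma lintegral_rpow_le_refSimplex {d : ℕ} {r : ℝ} (hr : Real.HolderConjugate d r)
    {u : (Fin d → ℝ) → ℝ} (hu : ContDiff ℝ 1 u) :
    ∫⁻ x in refSimplex d ∩ {x | ∑ i, x i ≤ 1 - 1 / (d + 1)}, ‖u x‖ₑ ^ r ≤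
      (∫⁻ x in refSimplex d, (∑ i, ‖fderiv ℝ u x (Pi.single i 1)‖ₑ +
        ENNReal.ofReal (d + 1) * ‖u x‖ₑ)) ^ r := by
  set F0 : (Fin d → ℝ) → ℝ≥0∞ := fun x => ∑ i, ‖fderiv ℝ u x (Pi.single i 1)‖ₑ +
        ENNReal.ofReal (d + 1) * ‖u x‖ₑ with hF0
  set F := (refSimplex d).indicator F0 with hF
  have hdu : ∀ v, Continuous fun x => fderiv ℝ u x v := fun v =>
    (hu.continuous_fderiv (by simp)).clm_apply continuous_const
  have hF0m : Measurable F0 :=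
    (Finset.measurable_fun_sum _ fun i _ => (hdu _).enorm.measurable).add
      (hu.continuous.enorm.measurable.const_mul _)
  have hSm := (isClosed_refSimplex d).measurableSet
  have hFm : Measurable F := hF0m.indicator hSm
  have hd1 : (1 : ℝ) < d := hr.lt
  -- The line through `x` in direction `i` meets the simplex in the segment where coordinate `i`
  -- runs from `0` to `x i + (1 - ∑ x j)`. Staying `1 / (d + 1)` away from the slanted face makes
  -- this segment long enough for the one-dimensional bound.
  have pw : ∀ x ∈ refSimplex d ∩ {x | ∑ i, x i ≤ 1 - 1 / ((d : ℝ) + 1)}, ∀ i,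
      ‖u x‖ₑ ≤ ∫⁻ t, F (Function.update x i t) := by
    rintro x ⟨⟨hx0, hx1⟩, hx2⟩ i
    rw [Set.mem_ofPred_eq] at hx2
    set w : ℝ → ℝ := fun t => u (Function.update x i t) with hw
    have hwc : ContDiff ℝ 1 w := hu.comp (by convert! contDiff_update 1 x i)
    have hwd : ∀ t, deriv w t = fderiv ℝ u (Function.update x i t) (Pi.single i 1) := by
      intro t
      have h1 : HasFDerivAt u (fderiv ℝ u (Function.update x i t)) (Function.update x i t) :=
        (hu.differentiable (by simp) _).hasFDerivAt
      exact (h1.comp_hasDerivAt t (hasDerivAt_update x i t)).deriv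
    have h0 := enorm_le_lintegral_Icc_of_contDiff hwc (a := 0) (b := x i + (1 - ∑ j, x j))
      (s := x i) (δ := 1 / ((d : ℝ) + 1)) (by positivity)
      (by have := hx0 i; linarith) ⟨hx0 i, by linarith⟩
    simp only [hw, Function.update_eq_self, one_div, inv_inv] at h0
    refine h0.trans ?_
    rw [← lintegral_indicator measurableSet_Icc]
    refine lintegral_mono fun t => ?_
    by_cases ht : t ∈ Set.Icc 0 (x i + (1 - ∑ j, x j))
    · have hmem : Function.update x i t ∈ refSimplex d := by
        refine ⟨fun j => ?_, ?_⟩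
        · by_cases hj : j = i
          · subst hj; simpa using ht.1
          · simpa [Function.update_of_ne hj] using hx0 j
        · rw [sum_update]; linarith [ht.2]
      rw [Set.indicator_of_mem ht, hF, Set.indicator_of_mem hmem]
      refine add_le_add ?_ le_rfl
      change ‖deriv w t‖ₑ ≤ _
      rw [hwd]
      exact Finset.single_le_sum (f := fun j =>
        ‖fderiv ℝ u (Function.update x i t) (Pi.single j 1)‖ₑ) (fun _ _ => zero_le)
        (Finset.mem_univ i)
    · rw [Set.indicator_of_notMem ht]; exact zero_le
  -- The grid-lines inequality: a product of line integrals, each to the power `1 / (d - 1)`,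
  -- integrates to at most the full integral to the power `r = d / (d - 1)`. The pointwise bound in
  -- the `d` directions supplies exactly these `d` factors.
  have hgrid := lintegral_prod_lintegral_pow_le (fun _ : Fin d => (volume : Measure ℝ))
    (p := r) (by simpa using hr) hFm
  rw [← lintegral_indicator hSm, ← hF]
  refine le_trans ?_ hgrid
  have hS'm : MeasurableSet (refSimplex d ∩ {x | ∑ i, x i ≤ 1 - 1 / ((d : ℝ) + 1)}) :=
    hSm.inter (isClosed_le (by fun_prop) continuous_const).measurableSet
  rw [← lintegral_indicator hS'm]
  refine lintegral_mono fun x => ?_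
  by_cases hx : x ∈ refSimplex d ∩ {x | ∑ i, x i ≤ 1 - 1 / ((d : ℝ) + 1)}
  · rw [Set.indicator_of_mem hx]
    calc ‖u x‖ₑ ^ r = ∏ _i : Fin d, ‖u x‖ₑ ^ ((1 : ℝ) / (d - 1)) := by
          rw [Finset.prod_const, Finset.card_univ, Fintype.card_fin, ← ENNReal.rpow_natCast,
            ← ENNReal.rpow_mul, hr.conjugate_eq]
          congr 1
          field_simp
      _ ≤ _ := by
          simp only [Fintype.card_fin]
          gcongr with i
          exact pw x hx _
  · rw [Set.indicator_of_notMem hx]; exact zero_le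

end GridLines

/-! ### Affine charts at the vertices and the `W^{1,1}` Sobolev inequality on a simplex. -/

section Chart

open scoped ENNReal

variable {d : ℕ} (P : AffineBasis (Fin (d + 1)) ℝ (E d))

lemma mem_simplex_iff {x : E d} : x ∈ simplex P ↔ ∀ i, 0 ≤ P.coord i x := by
  rw [simplex, P.convexHull_eq_nonneg_coord]; rfl

lemma isCompact_simplex : IsCompact (simplex P) := (Set.finite_range P).isCompact_convexHull ℝ

lemma measurableSet_simplex : MeasurableSet (simplex P) := (isCompact_simplex P).isClosed.measurableSet

lemma convex_simplex : Convex ℝ (simplex P) := convex_convexHull ℝ _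

lemma interior_simplex_nonempty : (interior (simplex P)).Nonempty :=
  ⟨_, P.centroid_mem_interior_convexHull⟩

lemma volume_simplex_ne_zero : volume (simplex P) ≠ 0 :=
  (Measure.measure_pos_of_nonempty_interior _ (interior_simplex_nonempty P)).ne'

lemma volume_simplex_ne_top : volume (simplex P) ≠ ⊤ := (isCompact_simplex P).measure_lt_top.ne

/-- The boundary of a convex set is null, so Sobolev norms on the open simplex and integrals over
the closed one can be mixed freely. -/
lemma restrict_interior_simplex :
    (volume : Measure (E d)).restrict (interior (simplex P)) = volume.restrict (simplex P) :=
  Measure.restrict_congr_set (interior_ae_eq_of_null_frontier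
    ((convex_simplex P).addHaar_frontier volume))

/-- Normalized Lebesgue measure on the simplex. -/
noncomputable def simplexMeasure : Measure (E d) := ProbabilityTheory.cond volume (simplex P)

lemma simplexMeasure_eq :
    simplexMeasure P = (volume (simplex P))⁻¹ • volume.restrict (simplex P) := rfl

instance : IsProbabilityMeasure (simplexMeasure P) :=
  ProbabilityTheory.cond_isProbabilityMeasure_of_finite (volume_simplex_ne_zero P)
    (volume_simplex_ne_top P)

lemma ae_simplexMeasure_mem : ∀ᵐ x ∂(simplexMeasure P), x ∈ simplex P :=
  Measure.ae_smul_measure (ae_restrict_mem (measurableSet_simplex P)) _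

/-- The linear part of the chart of the simplex that is centred at the vertex `P i`. -/
noncomputable def chartLin (i : Fin (d + 1)) : (Fin d → ℝ) →ₗ[ℝ] E d :=
  ∑ k, (LinearMap.proj k).smulRight (P (i.succAbove k) - P i)

lemma chartLin_apply (i : Fin (d + 1)) (x : Fin d → ℝ) :
    chartLin P i x = ∑ k, x k • (P (i.succAbove k) - P i) := by
  simp [chartLin]

/-- The affine chart of the simplex that is centred at the vertex `P i`. -/
noncomputable def chart (i : Fin (d + 1)) (x : Fin d → ℝ) : E d := P i + chartLin P i x

/-- In the chart at `P i` the variables are the barycentric coordinates of the other vertices; this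
is what identifies the simplex with `refSimplex d`. -/
lemma coord_chart (i j : Fin (d + 1)) (x : Fin d → ℝ) :
    P.coord j (chart P i x) = (if i = j then 1 else 0) +
      ∑ k, x k * ((if i.succAbove k = j then 1 else 0) - if i = j then 1 else 0) := by
  have h1 : ∀ v, P.coord j (P i + v) = (P.coord j).linear v + P.coord j (P i) := by
    intro v
    rw [add_comm (P i) v, ← vadd_eq_add v (P i), AffineMap.map_vadd, vadd_eq_add]
  have h2 : ∀ a b, (P.coord j).linear (a - b) = P.coord j a - P.coord j b := by
    intro a b
    rw [← vsub_eq_sub, AffineMap.linearMap_vsub, vsub_eq_sub]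
  have h3 : ∀ k, P.coord j (P k) = if k = j then 1 else 0 := by
    intro k
    rw [P.coord_apply]
    simp only [eq_comm]
  rw [chart, h1, chartLin_apply, map_sum, add_comm]
  simp only [map_smul, h2, h3, smul_eq_mul]

lemma coord_chart_self (i : Fin (d + 1)) (x : Fin d → ℝ) :
    P.coord i (chart P i x) = 1 - ∑ k, x k := by
  rw [coord_chart]
  simp [Fin.succAbove_ne, sub_eq_add_neg]

lemma coord_chart_succAbove (i : Fin (d + 1)) (k : Fin d) (x : Fin d → ℝ) :
    P.coord (i.succAbove k) (chart P i x) = x k := by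
  rw [coord_chart]
  simp [(Fin.succAbove_ne i k).symm, (Fin.succAbove_right_injective).eq_iff]

lemma chart_injective (i : Fin (d + 1)) : Function.Injective (chart P i) := by
  intro x y h
  funext k
  rw [← coord_chart_succAbove P i k x, h, coord_chart_succAbove]

lemma chartLin_injective (i : Fin (d + 1)) : Function.Injective (chartLin P i) := by
  intro x y h
  exact chart_injective P i (by simp only [chart, h])

lemma continuous_chart (i : Fin (d + 1)) : Continuous (chart P i) :=
  continuous_const.add (chartLin P i).continuous_of_finiteDimensional

lemma chart_mem_simplex_iff (i : Fin (d + 1)) {x : Fin d → ℝ} :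
    chart P i x ∈ simplex P ↔ x ∈ refSimplex d := by
  rw [mem_simplex_iff, Fin.forall_iff_succAbove i, coord_chart_self]
  simp only [coord_chart_succAbove, refSimplex, Set.mem_ofPred_eq, sub_nonneg]
  exact and_comm

/-- Uniqueness of Haar measure. The value of the Jacobian is never needed, since it cancels in the
normalized measures. -/
lemma exists_map_chart (i : Fin (d + 1)) : ∃ κ : ℝ≥0∞, κ ≠ 0 ∧ κ ≠ ⊤ ∧
    Measure.map (chart P i) volume = κ • (volume : Measure (E d)) := by
  set L : (Fin d → ℝ) ≃L[ℝ] E d := (LinearMap.linearEquivOfInjective (chartLin P i)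
    (chartLin_injective P i) (by simp)).toContinuousLinearEquiv with hL
  have h1 : (Measure.map L volume).IsAddHaarMeasure := L.isAddHaarMeasure_map volume
  have h2 := Measure.isAddLeftInvariant_eq_smul (Measure.map L volume) (volume : Measure (E d))
  set κ := (Measure.map L volume).addHaarScalarFactor (volume : Measure (E d)) with hκ
  have h3 : Measure.map (chart P i) volume = (κ : ℝ≥0∞) • (volume : Measure (E d)) := by
    have e : chart P i = (fun y => P i + y) ∘ L := rfl
    rw [e, ← Measure.map_map (measurable_const_add _) L.continuous.measurable, h2,
      Measure.map_smul, map_add_left_eq_self]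
    rfl
  refine ⟨κ, ?_, ENNReal.coe_ne_top, h3⟩
  intro h0
  have h4 : Measure.map L volume = 0 := by
    have h5 : κ = 0 := by exact_mod_cast h0
    rw [h2, h5, zero_smul]
  exact h1.toIsOpenPosMeasure.open_pos Set.univ isOpen_univ Set.univ_nonempty (by simp [h4])

lemma chart_preimage_simplex (i : Fin (d + 1)) : chart P i ⁻¹' simplex P = refSimplex d := by
  ext x; exact chart_mem_simplex_iff P i

/-- The affine charts preserve the normalized measures. -/
lemma measurePreserving_chart (i : Fin (d + 1)) :
    MeasurePreserving (chart P i) (ProbabilityTheory.cond volume (refSimplex d))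
      (simplexMeasure P) := by
  refine ⟨(continuous_chart P i).measurable, ?_⟩
  obtain ⟨κ, h0, ht, hκ⟩ := exists_map_chart P i
  have h1 : Measure.map (chart P i) (volume.restrict (refSimplex d)) =
      κ • volume.restrict (simplex P) := by
    rw [← chart_preimage_simplex P i, ← Measure.restrict_map (continuous_chart P i).measurable
      (measurableSet_simplex P), hκ, Measure.restrict_smul]
  have h2 : volume (refSimplex d) = κ * volume (simplex P) := by
    rw [← chart_preimage_simplex P i, ← Measure.map_apply (continuous_chart P i).measurable
      (measurableSet_simplex P), hκ]
    rfl
  rw [ProbabilityTheory.cond, Measure.map_smul, h1, h2, simplexMeasure_eq, smul_smul,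
    ENNReal.mul_inv (Or.inl h0) (Or.inl ht), mul_right_comm, ENNReal.inv_mul_cancel h0 ht, one_mul]

lemma volume_refSimplex_ne_zero_ne_top : volume (refSimplex d) ≠ 0 ∧ volume (refSimplex d) ≠ ⊤ := by
  obtain ⟨P⟩ : Nonempty (AffineBasis (Fin (d + 1)) ℝ (E d)) :=
    ⟨(AffineBasis.exists_affineBasis_of_finiteDimensional (k := ℝ) (P := E d)
      (ι := Fin (d + 1)) (by simp)).some⟩
  obtain ⟨κ, h0, ht, hκ⟩ := exists_map_chart P 0
  have h2 : volume (refSimplex d) = κ * volume (simplex P) := by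
    rw [← chart_preimage_simplex P 0, ← Measure.map_apply (continuous_chart P 0).measurable
      (measurableSet_simplex P), hκ]
    rfl
  rw [h2]
  exact ⟨mul_ne_zero h0 (volume_simplex_ne_zero P), ENNReal.mul_ne_top ht (volume_simplex_ne_top P)⟩

/-- The sum of the moduli of the derivatives of `u` along the edges that start at `P 0`. -/
noncomputable def edgeGrad (u : E d → ℝ) (x : E d) : ℝ≥0∞ :=
  ∑ k : Fin d, ‖fderiv ℝ u x (P k.succ - P 0)‖ₑ

lemma measurable_edgeGrad {u : E d → ℝ} (hu : ContDiff ℝ 1 u) : Measurable (edgeGrad P u) :=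
  Finset.measurable_fun_sum _ fun _ _ =>
    ((hu.continuous_fderiv (by simp)).clm_apply continuous_const).enorm.measurable

/-- Every edge is a difference of two edges starting at `P 0`, so `edgeGrad` controls the edge
derivatives seen from any other vertex, at the cost of a factor 2. -/
lemma enorm_fderiv_sub_le (u : E d → ℝ) (x : E d) (i j : Fin (d + 1)) :
    ‖fderiv ℝ u x (P j - P i)‖ₑ ≤ 2 * edgeGrad P u x := by
  have h : ∀ j, ‖fderiv ℝ u x (P j - P 0)‖ₑ ≤ edgeGrad P u x := by
    intro j
    cases j using Fin.cases with
    | zero => simp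
    | succ k => exact Finset.single_le_sum (f := fun k : Fin d =>
        ‖fderiv ℝ u x (P k.succ - P 0)‖ₑ) (fun _ _ => zero_le) (Finset.mem_univ k)
  have e : P j - P i = (P j - P 0) - (P i - P 0) := by abel
  rw [e, map_sub, two_mul]
  exact enorm_sub_le.trans (add_le_add (h j) (h i))

/-- The Sobolev inequality for `W^{1,1}` of a simplex. -/
lemma exists_lintegral_rpow_le_edgeGrad {r : ℝ} (hr : Real.HolderConjugate d r) :
    ∃ C : ℝ≥0∞, C ≠ ⊤ ∧ ∀ P : AffineBasis (Fin (d + 1)) ℝ (E d), ∀ u : E d → ℝ, ContDiff ℝ 1 u →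
      ∫⁻ x, ‖u x‖ₑ ^ r ∂(simplexMeasure P) ≤
        C * (∫⁻ x, (edgeGrad P u x + ‖u x‖ₑ) ∂(simplexMeasure P)) ^ r := by
  obtain ⟨hV0, hVt⟩ := volume_refSimplex_ne_zero_ne_top (d := d)
  set V := volume (refSimplex d) with hV
  have hr0 : 0 < r := hr.symm.pos
  -- There are `d + 1` pieces, one per vertex. On each, `2 * d` comes from the `d` chart derivatives
  -- and `d + 1` is the weight of `|u|` in the reference inequality; `V` converts between Lebesgue
  -- and normalized measure.
  refine ⟨(d + 1) * (V⁻¹ * (V * (2 * d + (d + 1))) ^ r), ?_, ?_⟩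
  · refine ENNReal.mul_ne_top (by finiteness) (ENNReal.mul_ne_top (by simpa using hV0) ?_)
    exact ENNReal.rpow_ne_top_of_nonneg hr0.le (ENNReal.mul_ne_top hVt (by finiteness))
  intro P u hu
  set H := fun x => edgeGrad P u x + ‖u x‖ₑ with hH
  have hHm : Measurable H := (measurable_edgeGrad P hu).add hu.continuous.enorm.measurable
  have hum : Measurable fun x => ‖u x‖ₑ ^ r := hu.continuous.enorm.measurable.pow_const r
  -- The barycentric coordinates sum to one, so at every point one of the `d + 1` is at least `δ`.
  -- In the chart at that vertex this is the region covered by the reference inequality.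
  set δ : ℝ := 1 / ((d : ℝ) + 1) with hδ
  set ν := simplexMeasure P with hν
  have hcoord : ∀ i, Continuous (P.coord i) := fun i => continuous_barycentric_coord P i
  have hpm : ∀ i, MeasurableSet {x | δ ≤ P.coord i x} := fun i =>
    (isClosed_le continuous_const (hcoord i)).measurableSet
  have piece : ∀ i, ∫⁻ x in {x | δ ≤ P.coord i x}, ‖u x‖ₑ ^ r ∂ν ≤
      V⁻¹ * (V * (2 * d + (d + 1))) ^ r * (∫⁻ x, H x ∂ν) ^ r := by
    intro i
    set w := fun x => u (chart P i x) with hw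
    have hchd : ∀ x, HasFDerivAt (chart P i) (LinearMap.toContinuousLinearMap (chartLin P i)) x :=
      fun x => (LinearMap.toContinuousLinearMap (chartLin P i)).hasFDerivAt.const_add (P i)
    have hchc : ContDiff ℝ 1 (chart P i) :=
      contDiff_const.add (LinearMap.toContinuousLinearMap (chartLin P i)).contDiff
    have hwc : ContDiff ℝ 1 w := hu.comp hchc
    have hwd : ∀ x k, fderiv ℝ w x (Pi.single k 1) =
        fderiv ℝ u (chart P i x) (P (i.succAbove k) - P i) := by
      intro x k
      have h1 : HasFDerivAt w _ x :=
        HasFDerivAt.comp x (hu.differentiable (by simp) (chart P i x)).hasFDerivAt (hchd x)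
      rw [h1.fderiv]
      simp [chartLin_apply, Pi.single_apply]
    have hg := lintegral_rpow_le_refSimplex hr hwc
    have hset : chart P i ⁻¹' {x | δ ≤ P.coord i x} = {x | ∑ k, x k ≤ 1 - δ} := by
      ext x
      simp only [Set.mem_preimage, Set.mem_ofPred_eq, coord_chart_self]
      constructor <;> intro h <;> linarith
    have hcond : ∀ f : (Fin d → ℝ) → ℝ≥0∞, ∫⁻ x, f x ∂(ProbabilityTheory.cond volume (refSimplex d))
        = V⁻¹ * ∫⁻ x in refSimplex d, f x := by
      intro f
      rw [ProbabilityTheory.cond, lintegral_smul_measure, smul_eq_mul]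
    have hm' : MeasurableSet {x : Fin d → ℝ | ∑ k, x k ≤ 1 - δ} :=
      (isClosed_le (by fun_prop) continuous_const).measurableSet
    calc ∫⁻ x in {x | δ ≤ P.coord i x}, ‖u x‖ₑ ^ r ∂ν
        = V⁻¹ * ∫⁻ x in refSimplex d ∩ {x | ∑ k, x k ≤ 1 - δ}, ‖w x‖ₑ ^ r := by
          rw [← (measurePreserving_chart P i).setLIntegral_comp_preimage (hpm i) hum, hset,
            ← lintegral_indicator hm', hcond, lintegral_indicator hm',
            Measure.restrict_restrict hm', Set.inter_comm]
      _ ≤ V⁻¹ * (∫⁻ x in refSimplex d, (∑ k, ‖fderiv ℝ w x (Pi.single k 1)‖ₑ +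
            ENNReal.ofReal (d + 1) * ‖w x‖ₑ)) ^ r := by gcongr
      _ ≤ V⁻¹ * (∫⁻ x in refSimplex d, (2 * d + (d + 1)) * H (chart P i x)) ^ r := by
          gcongr with x
          simp only [hwd]
          calc _ ≤ ∑ _k : Fin d, 2 * edgeGrad P u (chart P i x) +
                (d + 1 : ℝ≥0∞) * ‖u (chart P i x)‖ₑ := by
                gcongr with k
                · exact enorm_fderiv_sub_le P u _ _ _
                · rw [ENNReal.ofReal_add (by positivity) (by positivity)]; simp
            _ = 2 * d * edgeGrad P u (chart P i x) +
                (d + 1 : ℝ≥0∞) * ‖u (chart P i x)‖ₑ := by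
                rw [Finset.sum_const, Finset.card_univ, Fintype.card_fin, nsmul_eq_mul]; ring
            _ ≤ (2 * d + (d + 1)) * H (chart P i x) := by
                rw [hH, mul_add]
                exact add_le_add (mul_le_mul' le_self_add le_rfl) (mul_le_mul' le_add_self le_rfl)
      _ = V⁻¹ * (V * (2 * d + (d + 1)) * ∫⁻ x, H x ∂ν) ^ r := by
          rw [← (measurePreserving_chart P i).lintegral_comp hHm, hcond,
            lintegral_const_mul (2 * d + (d + 1) : ℝ≥0∞)
              (f := fun x => H (chart P i x)) (hHm.comp (continuous_chart P i).measurable)]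
          congr 2
          rw [mul_comm V, mul_assoc, ← mul_assoc V, ENNReal.mul_inv_cancel hV0 hVt, one_mul]
      _ = _ := by rw [ENNReal.mul_rpow_of_nonneg _ _ hr0.le, mul_assoc]
  have hcover : ∀ x, ∃ i, δ ≤ P.coord i x := by
    intro x
    by_contra! h
    have h1 := P.sum_coord_apply_eq_one x
    have h2 : ∑ i, P.coord i x < ∑ _i : Fin (d + 1), δ :=
      Finset.sum_lt_sum_of_nonempty Finset.univ_nonempty fun i _ => h i
    rw [h1, Finset.sum_const, Finset.card_univ, Fintype.card_fin, nsmul_eq_mul, hδ] at h2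
    push_cast at h2
    rw [mul_one_div_cancel (by positivity)] at h2
    exact lt_irrefl _ h2
  calc ∫⁻ x, ‖u x‖ₑ ^ r ∂ν
      ≤ ∫⁻ x in ⋃ i, {x | δ ≤ P.coord i x}, ‖u x‖ₑ ^ r ∂ν := by
        rw [show (⋃ i, {x | δ ≤ P.coord i x}) = Set.univ by
          ext x; simpa using hcover x, Measure.restrict_univ]
    _ ≤ ∑' i, ∫⁻ x in {x | δ ≤ P.coord i x}, ‖u x‖ₑ ^ r ∂ν := lintegral_iUnion_le _ _
    _ ≤ ∑' _i : Fin (d + 1), V⁻¹ * (V * (2 * d + (d + 1))) ^ r * (∫⁻ x, H x ∂ν) ^ r :=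
        ENNReal.tsum_le_tsum piece
    _ = _ := by
        rw [tsum_fintype, Finset.sum_const, Finset.card_univ, Fintype.card_fin, nsmul_eq_mul]
        push_cast
        ring

end Chart

/-! ### Sobolev and Poincaré inequalities for smooth functions. -/

section SobolevPoincare

open scoped ENNReal

variable {d : ℕ}

lemma exists_forall_simplex_enorm_le (P : AffineBasis (Fin (d + 1)) ℝ (E d)) {u : E d → ℝ}
    (hu : Continuous u) : ∃ M : NNReal, ∀ x ∈ simplex P, ‖u x‖ₑ ≤ M := by
  obtain ⟨M, hM⟩ := (isCompact_simplex P).exists_bound_of_continuousOn hu.continuousOn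
  refine ⟨M.toNNReal, fun x hx => ?_⟩
  rw [enorm_le_coe]
  exact NNReal.le_toNNReal_of_coe_le (by simpa using hM x hx)

lemma lintegral_enorm_rpow_ne_top (P : AffineBasis (Fin (d + 1)) ℝ (E d)) {u : E d → ℝ}
    (hu : Continuous u) {q : ℝ} (hq : 0 ≤ q) : ∫⁻ x, ‖u x‖ₑ ^ q ∂(simplexMeasure P) ≠ ⊤ := by
  obtain ⟨M, hM⟩ := exists_forall_simplex_enorm_le P hu
  refine ne_top_of_le_ne_top (b := (M : ℝ≥0∞) ^ q)
    (ENNReal.rpow_ne_top_of_nonneg hq ENNReal.coe_ne_top) ?_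
  calc _ ≤ ∫⁻ _x, (M : ℝ≥0∞) ^ q ∂(simplexMeasure P) := by
        refine lintegral_mono_ae ?_
        filter_upwards [ae_simplexMeasure_mem P] with x hx
        gcongr
        exact hM x hx
    _ = _ := by simp

/-- The chain rule for `|u|^γ`; it also holds at the zeros of `u` because `γ > 1`. -/
lemma enorm_fderiv_norm_rpow_apply_le {u : E d → ℝ} (hu : Differentiable ℝ u) {γ : ℝ} (hγ : 1 < γ)
    (x v : E d) : ‖fderiv ℝ (fun x => ‖u x‖ ^ γ) x v‖ₑ ≤
      ENNReal.ofReal γ * ‖u x‖ₑ ^ (γ - 1) * ‖fderiv ℝ u x v‖ₑ := by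
  have h : |fderiv ℝ (fun x => ‖u x‖ ^ γ) x v| ≤ γ * ‖u x‖ ^ (γ - 1) * |fderiv ℝ u x v| := by
    rw [hu.fderiv_norm_rpow hγ]
    have e : ((γ * ‖u x‖ ^ (γ - 2)) • (innerSL ℝ (u x)).comp (fderiv ℝ u x)) v =
        γ * ‖u x‖ ^ (γ - 2) * (u x * fderiv ℝ u x v) := by
      simp [mul_comm]
    rw [e, abs_mul, abs_mul (u x), ← Real.norm_eq_abs (u x), ← mul_assoc,
      abs_of_nonneg (by positivity), mul_assoc γ, ← Real.rpow_add_one' (by positivity) (by linarith)]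
    ring_nf
    exact le_rfl
  rw [Real.enorm_eq_ofReal_abs, Real.enorm_eq_ofReal_abs, Real.enorm_eq_ofReal_abs,
    ENNReal.ofReal_rpow_of_nonneg (abs_nonneg _) (by linarith), ← ENNReal.ofReal_mul (by linarith),
    ← ENNReal.ofReal_mul (by positivity)]
  exact ENNReal.ofReal_le_ofReal h

/-- The Sobolev inequality on simplices with the sharp exponent. -/
lemma exists_lintegral_rpow_le_edgeGrad_sharp (hd : 2 ≤ d) {r p q : ℝ}
    (hr : Real.HolderConjugate d r) (hq : r ≤ q) (hpq : 1 / p = 1 / q + 1 / d) :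
    ∃ C : ℝ≥0∞, C ≠ ⊤ ∧ ∀ P : AffineBasis (Fin (d + 1)) ℝ (E d), ∀ u : E d → ℝ, ContDiff ℝ 1 u →
      (∫⁻ x, ‖u x‖ₑ ^ q ∂(simplexMeasure P)) ^ (1 / q) ≤
        C * (∫⁻ x, (edgeGrad P u x + ‖u x‖ₑ) ^ p ∂(simplexMeasure P)) ^ (1 / p) := by
  obtain ⟨C1, hC1, h1⟩ := exists_lintegral_rpow_le_edgeGrad hr
  have hr0 : 0 < r := hr.symm.pos
  have hinv : 1 / (d : ℝ) + 1 / r = 1 := by simpa using hr.inv_add_inv_eq_one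
  rcases hq.eq_or_lt with rfl | hlt
  · have hp1 : p = 1 := by
      have h2 : 1 / p = 1 := by linarith
      rw [one_div, inv_eq_one] at h2; exact h2
    subst hp1
    refine ⟨C1 ^ (1 / r), ENNReal.rpow_ne_top_of_nonneg (by positivity) hC1, fun P u hu => ?_⟩
    have := h1 P u hu
    simp only [ENNReal.rpow_one, div_one]
    calc _ ≤ (C1 * (∫⁻ x, (edgeGrad P u x + ‖u x‖ₑ) ∂(simplexMeasure P)) ^ r) ^ (1 / r) := by gcongr
      _ = _ := by
        rw [ENNReal.mul_rpow_of_nonneg _ _ (by positivity), ← ENNReal.rpow_mul,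
          mul_one_div_cancel hr0.ne', ENNReal.rpow_one]
  have hq0 : 0 < q := by linarith
  -- Applying the `W^{1,1}` inequality to `|u|^γ` puts `|u|^q` on the left, as `γ r = q`. On the
  -- right Hölder's inequality separates `|u|^(γ-1)`, whose `p'`-th power is again `|u|^q`.
  set γ := q / r with hγ
  have hγ1 : 1 < γ := by rw [hγ, one_lt_div hr0]; exact hlt
  have hrq : 1 / q < 1 / r := one_div_lt_one_div_of_lt hr0 hlt
  have hd0 : (0 : ℝ) < d := by positivity
  have hp0 : 0 < p := by
    rw [← one_div_pos, hpq]; positivity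
  have hp1 : 1 < p := by
    have h2 : 1 / p < 1 := by linarith
    rwa [div_lt_one hp0] at h2
  set p' := q / (γ - 1) with hp'
  have hp'inv : 1 / p' = 1 / r - 1 / q := by
    rw [hp', one_div_div, hγ]; field_simp
  have hp'0 : 0 < p' := div_pos hq0 (by linarith)
  have hconj : p'.HolderConjugate p := by
    rw [Real.holderConjugate_iff]
    have h3 : 1 / p' + 1 / p = 1 := by rw [hp'inv, hpq]; linarith
    refine ⟨?_, by simpa using h3⟩
    have h4 : 1 / p' < 1 := by
      have : 0 < 1 / p := by positivity
      linarith
    rwa [div_lt_one hp'0] at h4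
  refine ⟨C1 ^ (1 / r) * ENNReal.ofReal γ, ENNReal.mul_ne_top
    (ENNReal.rpow_ne_top_of_nonneg (by positivity) hC1) ENNReal.ofReal_ne_top, fun P u hu => ?_⟩
  set ν := simplexMeasure P with hν
  set A := ∫⁻ x, ‖u x‖ₑ ^ q ∂ν with hA
  set Y := (∫⁻ x, (edgeGrad P u x + ‖u x‖ₑ) ^ p ∂ν) ^ (1 / p) with hY
  have hum : Measurable fun x => ‖u x‖ₑ := hu.continuous.enorm.measurable
  have hHm : Measurable fun x => edgeGrad P u x + ‖u x‖ₑ := (measurable_edgeGrad P hu).add hum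
  have hAt : A ≠ ⊤ := lintegral_enorm_rpow_ne_top P hu.continuous hq0.le
  rcases eq_or_ne A 0 with hA0 | hA0
  · rw [hA0, ENNReal.zero_rpow_of_pos (by positivity)]; exact zero_le
  have key : A ≤ C1 * (ENNReal.ofReal γ * (A ^ (1 / p') * Y)) ^ r := by
    have hw := h1 P _ (hu.norm_rpow hγ1)
    have e1 : ∀ x, ‖‖u x‖ ^ γ‖ₑ = ‖u x‖ₑ ^ γ := by
      intro x
      rw [Real.enorm_of_nonneg (by positivity), ← ENNReal.ofReal_rpow_of_nonneg (norm_nonneg _)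
        (by linarith), ofReal_norm]
    simp only [e1, ← ENNReal.rpow_mul] at hw
    rw [show γ * r = q by rw [hγ]; field_simp] at hw
    refine hw.trans ?_
    gcongr
    calc ∫⁻ x, (edgeGrad P (fun x => ‖u x‖ ^ γ) x + ‖u x‖ₑ ^ γ) ∂ν
        ≤ ∫⁻ x, ENNReal.ofReal γ * (‖u x‖ₑ ^ (γ - 1) * (edgeGrad P u x + ‖u x‖ₑ)) ∂ν := by
          refine lintegral_mono fun x => ?_
          have e2 : ‖u x‖ₑ ^ γ = ‖u x‖ₑ ^ (γ - 1) * ‖u x‖ₑ := by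
            conv_lhs => rw [show γ = (γ - 1) + 1 by ring]
            rw [ENNReal.rpow_add_of_nonneg _ _ (by linarith) zero_le_one, ENNReal.rpow_one]
          have e3 : edgeGrad P (fun x => ‖u x‖ ^ γ) x ≤
              ENNReal.ofReal γ * ‖u x‖ₑ ^ (γ - 1) * edgeGrad P u x := by
            unfold edgeGrad
            rw [Finset.mul_sum]
            exact Finset.sum_le_sum fun k _ =>
              enorm_fderiv_norm_rpow_apply_le (hu.differentiable (by simp)) hγ1 _ _
          have e4 : (1 : ℝ≥0∞) ≤ ENNReal.ofReal γ := by
            rw [ENNReal.one_le_ofReal]; exact hγ1.le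
          rw [e2, mul_add, mul_add, ← mul_assoc]
          refine add_le_add e3 ?_
          calc _ = 1 * (‖u x‖ₑ ^ (γ - 1) * ‖u x‖ₑ) := (one_mul _).symm
            _ ≤ _ := by gcongr
      _ = ENNReal.ofReal γ * ∫⁻ x, ‖u x‖ₑ ^ (γ - 1) * (edgeGrad P u x + ‖u x‖ₑ) ∂ν :=
          lintegral_const_mul _ ((hum.pow_const _).mul hHm)
      _ ≤ _ := by
          gcongr
          refine (ENNReal.lintegral_mul_le_Lp_mul_Lq ν hconj (hum.pow_const _).aemeasurable
            hHm.aemeasurable).trans_eq ?_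
          simp only [← ENNReal.rpow_mul]
          rw [show (γ - 1) * p' = q by
            rw [hp', mul_div_cancel₀]; linarith]
  have key2 : A ^ (1 / r) ≤ C1 ^ (1 / r) * (ENNReal.ofReal γ * (A ^ (1 / p') * Y)) := by
    calc A ^ (1 / r) ≤ (C1 * (ENNReal.ofReal γ * (A ^ (1 / p') * Y)) ^ r) ^ (1 / r) := by gcongr
      _ = _ := by
        rw [ENNReal.mul_rpow_of_nonneg _ _ (by positivity), ← ENNReal.rpow_mul,
          mul_one_div_cancel hr0.ne', ENNReal.rpow_one]
  -- The power of `A` on the right is absorbed by dividing, which requires `A` to be neither `0` nor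
  -- `∞`.
  calc A ^ (1 / q) = A ^ (1 / r) * A ^ (-(1 / p')) := by
        rw [← ENNReal.rpow_add _ _ hA0 hAt]; congr 1; rw [hp'inv]; ring
    _ ≤ C1 ^ (1 / r) * (ENNReal.ofReal γ * (A ^ (1 / p') * Y)) * A ^ (-(1 / p')) := by gcongr
    _ = C1 ^ (1 / r) * ENNReal.ofReal γ * Y * (A ^ (1 / p') * A ^ (-(1 / p'))) := by ring
    _ = _ := by
        rw [← ENNReal.rpow_add _ _ hA0 hAt, add_neg_cancel, ENNReal.rpow_zero, mul_one]

/-- Contracting towards a point of the convex set `T` keeps `T` inside itself, and for a ratio at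
least `1/2` the Jacobian factor is at most `2^d`. -/
lemma lintegral_comp_dilate_le (P : AffineBasis (Fin (d + 1)) ℝ (E d)) {g : E d → ℝ≥0∞}
    (hg : Measurable g) {y : E d} (hy : y ∈ simplex P) {t : ℝ} (ht : 1 / 2 ≤ t) (ht1 : t ≤ 1) :
    ∫⁻ x, g (y + t • (x - y)) ∂(simplexMeasure P) ≤ 2 ^ d * ∫⁻ x, g x ∂(simplexMeasure P) := by
  have ht0 : 0 < t := by linarith
  have hm : Measurable fun x : E d => y + t • (x - y) :=
    (by fun_prop : Continuous fun x : E d => y + t • (x - y)).measurable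
  have hT := measurableSet_simplex P
  rw [simplexMeasure_eq, lintegral_smul_measure, lintegral_smul_measure, smul_eq_mul, smul_eq_mul,
    mul_left_comm]
  gcongr
  calc ∫⁻ x in simplex P, g (y + t • (x - y))
      ≤ ∫⁻ x, (simplex P).indicator g (y + t • (x - y)) := by
        rw [← lintegral_indicator hT]
        refine lintegral_mono fun x => ?_
        by_cases hx : x ∈ simplex P
        · have : y + t • (x - y) ∈ simplex P :=
            (convex_simplex P).add_smul_sub_mem hy hx ⟨ht0.le, ht1⟩
          rw [Set.indicator_of_mem hx, Set.indicator_of_mem this]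
        · rw [Set.indicator_of_notMem hx]; exact zero_le
    _ = ENNReal.ofReal |(t ^ d)⁻¹| * ∫⁻ x in simplex P, g x := by
        rw [← lintegral_map (hg.indicator hT) hm, map_dilate y ht0, lintegral_smul_measure,
          lintegral_indicator hT, smul_eq_mul]
    _ ≤ _ := by
        gcongr
        exact ofReal_abs_inv_pow_le d ht

/-- Since the coordinates sum to one, `P 0` can be eliminated. Between points of `T` the
coefficients are at most 1 in modulus, so derivatives along any segment in `T` are bounded by
`edgeGrad` without reference to the shape of `T`. -/
lemma sub_eq_sum_coord (P : AffineBasis (Fin (d + 1)) ℝ (E d)) (x y : E d) :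
    y - x = ∑ k : Fin d, (P.coord k.succ y - P.coord k.succ x) • (P k.succ - P 0) := by
  have h : ∀ z, z - P 0 = ∑ k : Fin d, P.coord k.succ z • (P k.succ - P 0) := by
    intro z
    have h1 := P.linear_combination_coord_eq_self z
    have h2 := P.sum_coord_apply_eq_one z
    rw [Fin.sum_univ_succ] at h1 h2
    simp only [smul_sub, Finset.sum_sub_distrib, ← Finset.sum_smul]
    have h3 : ∑ k : Fin d, P.coord k.succ z • P k.succ = z - P.coord 0 z • P 0 :=
      eq_sub_of_add_eq' h1
    rw [h3, show ∑ k : Fin d, P.coord k.succ z = 1 - P.coord 0 z by linarith, sub_smul, one_smul]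
    abel
  have e : y - x = (y - P 0) - (x - P 0) := by abel
  rw [e, h, h, ← Finset.sum_sub_distrib]
  simp only [sub_smul]

lemma coord_mem_Icc (P : AffineBasis (Fin (d + 1)) ℝ (E d)) {x : E d} (hx : x ∈ simplex P)
    (i : Fin (d + 1)) : P.coord i x ∈ Set.Icc (0 : ℝ) 1 := by
  rw [mem_simplex_iff] at hx
  refine ⟨hx i, ?_⟩
  rw [← P.sum_coord_apply_eq_one x]
  exact Finset.single_le_sum (fun i _ => hx i) (Finset.mem_univ i)

/-- The fundamental theorem of calculus along the segment from `x` to `y`, whose direction is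
expanded in the edges. -/
lemma enorm_sub_le_lintegral_edgeGrad (P : AffineBasis (Fin (d + 1)) ℝ (E d)) {u : E d → ℝ}
    (hu : ContDiff ℝ 1 u) {x y : E d} (hx : x ∈ simplex P) (hy : y ∈ simplex P) :
    ‖u y - u x‖ₑ ≤ ∫⁻ s in Set.Icc (0 : ℝ) 1, edgeGrad P u (x + s • (y - x)) := by
  set w : ℝ → ℝ := fun s => u (x + s • (y - x)) with hw
  have hwc : ContDiff ℝ 1 w := hu.comp (by fun_prop)
  have h := enorm_sub_le_lintegral_deriv_of_contDiffOn_Icc hwc.contDiffOn zero_le_one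
  simp only [hw, one_smul, zero_smul, add_zero, add_sub_cancel] at h
  refine h.trans (lintegral_mono fun s => ?_)
  have h1 : HasDerivAt (fun s : ℝ => x + s • (y - x)) (y - x) s := by
    simpa using ((hasDerivAt_id s).smul_const (y - x)).const_add x
  have h2 := ((hu.differentiable (by simp) (x + s • (y - x))).hasFDerivAt).comp_hasDerivAt s h1
  have h3 : deriv (fun s : ℝ => u (x + s • (y - x))) s = fderiv ℝ u (x + s • (y - x)) (y - x) :=
    h2.deriv
  rw [h3, sub_eq_sum_coord P x y, map_sum, ← sub_eq_sum_coord P x y]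
  refine (enorm_sum_le _ _).trans (Finset.sum_le_sum fun k _ => ?_)
  rw [map_smul, smul_eq_mul, enorm_mul]
  calc _ ≤ 1 * ‖fderiv ℝ u (x + s • (y - x)) (P k.succ - P 0)‖ₑ := by
        gcongr
        have hx' := coord_mem_Icc P hx k.succ
        have hy' := coord_mem_Icc P hy k.succ
        rw [Real.enorm_eq_ofReal_abs, ENNReal.ofReal_le_one, abs_le]
        constructor <;> linarith [hx'.1, hx'.2, hy'.1, hy'.2]
    _ = _ := one_mul _

/-- The Poincaré inequality on simplices. -/
lemma lintegral_sub_integral_rpow_le (P : AffineBasis (Fin (d + 1)) ℝ (E d)) {u : E d → ℝ}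
    (hu : ContDiff ℝ 1 u) {p : ℝ} (hp : 1 ≤ p) :
    ∫⁻ x, ‖u x - ∫ y, u y ∂(simplexMeasure P)‖ₑ ^ p ∂(simplexMeasure P) ≤
      2 ^ d * ∫⁻ x, edgeGrad P u x ^ p ∂(simplexMeasure P) := by
  set ν := simplexMeasure P with hν
  have hp0 : 0 ≤ p := by linarith
  have hGm := (measurable_edgeGrad P hu).pow_const p
  have hui : Integrable u ν := by
    refine ⟨hu.continuous.aestronglyMeasurable, ?_⟩
    have := lintegral_enorm_rpow_ne_top P hu.continuous zero_le_one
    simp only [ENNReal.rpow_one] at this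
    exact this.lt_top
  have : IsProbabilityMeasure (volume.restrict (Set.Icc (0 : ℝ) 1)) := ⟨by simp⟩
  have hcm : Measurable fun z : (E d × E d) × ℝ => edgeGrad P u (z.1.1 + z.2 • (z.1.2 - z.1.1)) ^ p :=
    hGm.comp (by fun_prop : Continuous fun z : (E d × E d) × ℝ =>
      z.1.1 + z.2 • (z.1.2 - z.1.1)).measurable
  have step1 : ∀ x ∈ simplex P, ‖u x - ∫ y, u y ∂ν‖ₑ ^ p ≤
      ∫⁻ y, (∫⁻ s in Set.Icc (0 : ℝ) 1, edgeGrad P u (x + s • (y - x)) ^ p) ∂ν := by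
    intro x hx
    have e : u x - ∫ y, u y ∂ν = ∫ y, (u x - u y) ∂ν := by
      rw [integral_sub (integrable_const _) hui]; simp
    calc ‖u x - ∫ y, u y ∂ν‖ₑ ^ p ≤ (∫⁻ y, ‖u x - u y‖ₑ ∂ν) ^ p := by
          rw [e]; gcongr; exact enorm_integral_le_lintegral_enorm _
      _ ≤ ∫⁻ y, ‖u x - u y‖ₑ ^ p ∂ν := lintegral_rpow_le_of_isProbabilityMeasure
          (continuous_const.sub hu.continuous).enorm.measurable.aemeasurable hp
      _ ≤ _ := by
          refine lintegral_mono_ae ?_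
          filter_upwards [ae_simplexMeasure_mem P] with y hy
          rw [← enorm_neg, neg_sub]
          refine (ENNReal.rpow_le_rpow (enorm_sub_le_lintegral_edgeGrad P hu hx hy) hp0).trans ?_
          refine lintegral_rpow_le_of_isProbabilityMeasure ?_ hp
          exact ((measurable_edgeGrad P hu).comp (by fun_prop : Continuous fun s : ℝ =>
            x + s • (y - x)).measurable).aemeasurable
  calc _ ≤ ∫⁻ x, ∫⁻ y, (∫⁻ s in Set.Icc (0 : ℝ) 1, edgeGrad P u (x + s • (y - x)) ^ p) ∂ν ∂ν := by
        refine lintegral_mono_ae ?_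
        filter_upwards [ae_simplexMeasure_mem P] with x hx using step1 x hx
    _ = ∫⁻ x, (∫⁻ s in Set.Icc (0 : ℝ) 1, ∫⁻ y, edgeGrad P u (x + s • (y - x)) ^ p ∂ν) ∂ν := by
        refine lintegral_congr fun x => lintegral_lintegral_swap ?_
        exact (hGm.comp (by fun_prop : Continuous fun z : E d × ℝ =>
          x + z.2 • (z.1 - x)).measurable).aemeasurable
    _ = ∫⁻ s in Set.Icc (0 : ℝ) 1, ∫⁻ x, ∫⁻ y, edgeGrad P u (x + s • (y - x)) ^ p ∂ν ∂ν := by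
        refine lintegral_lintegral_swap ?_
        have : Measurable fun z : (E d × ℝ) × E d =>
            edgeGrad P u (z.1.1 + z.1.2 • (z.2 - z.1.1)) ^ p :=
          hGm.comp (by fun_prop : Continuous fun z : (E d × ℝ) × E d =>
            z.1.1 + z.1.2 • (z.2 - z.1.1)).measurable
        exact this.lintegral_prod_right'.aemeasurable
    _ ≤ ∫⁻ _s in Set.Icc (0 : ℝ) 1, 2 ^ d * ∫⁻ x, edgeGrad P u x ^ p ∂ν := by
        refine setLIntegral_mono measurable_const fun s hs => ?_
        -- The point `x + s (y - x)` is a dilation of `y` about `x` with ratio `s`, and a dilation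
        -- of `x` about `y` with ratio `1 - s`. Integrating first in the variable whose ratio is at
        -- least `1/2` avoids the singular Jacobian.
        rcases le_total (1 / 2) s with h | h
        · calc _ ≤ ∫⁻ _x, 2 ^ d * ∫⁻ x, edgeGrad P u x ^ p ∂ν ∂ν := by
                refine lintegral_mono_ae ?_
                filter_upwards [ae_simplexMeasure_mem P] with x hx
                exact lintegral_comp_dilate_le P hGm hx h hs.2
            _ = _ := by simp
        · have hsw : ∫⁻ x, ∫⁻ y, edgeGrad P u (x + s • (y - x)) ^ p ∂ν ∂ν =
              ∫⁻ y, ∫⁻ x, edgeGrad P u (x + s • (y - x)) ^ p ∂ν ∂ν :=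
            lintegral_lintegral_swap (hGm.comp (by fun_prop : Continuous fun z : E d × E d =>
              z.1 + s • (z.2 - z.1)).measurable).aemeasurable
          rw [hsw]
          calc _ ≤ ∫⁻ _x, 2 ^ d * ∫⁻ x, edgeGrad P u x ^ p ∂ν ∂ν := by
                refine lintegral_mono_ae ?_
                filter_upwards [ae_simplexMeasure_mem P] with y hy
                have e : ∀ x, x + s • (y - x) = y + (1 - s) • (x - y) := by
                  intro x; simp only [smul_sub, sub_smul, one_smul]; abel
                simp only [e]
                exact lintegral_comp_dilate_le P hGm hy (by linarith) (by linarith [hs.1])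
            _ = _ := by simp
    _ = _ := by simp

/-- The Sobolev-Poincaré inequality on simplices, for smooth functions. -/
theorem exists_sobolev_poincare (hd : 2 ≤ d) {p q : ℝ} (hp : 1 ≤ p) (hq : 1 ≤ q)
    (hpq : 1 / p - 1 / d ≤ 1 / q) :
    ∃ C : ℝ≥0∞, C ≠ ⊤ ∧ ∀ P : AffineBasis (Fin (d + 1)) ℝ (E d), ∀ u : E d → ℝ, ContDiff ℝ 1 u →
      (∫⁻ x, ‖u x - ∫ y, u y ∂(simplexMeasure P)‖ₑ ^ q ∂(simplexMeasure P)) ^ (1 / q) ≤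
        C * (∫⁻ x, edgeGrad P u x ^ p ∂(simplexMeasure P)) ^ (1 / p) := by
  have hd1 : (1 : ℝ) < d := by exact_mod_cast hd
  set r := Real.conjExponent d with hr
  have hconj : Real.HolderConjugate d r := Real.HolderConjugate.conjExponent hd1
  have hinv : 1 / (d : ℝ) + 1 / r = 1 := by simpa using hconj.inv_add_inv_eq_one
  have hr0 : 0 < r := hconj.symm.pos
  -- The critical inequality requires a target exponent at least `r`, so `q` is raised to `q₀`. The
  -- matching source exponent `p₀` still satisfies `p₀ ≤ p`, and Hölder on the probability space
  -- bridges both gaps.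
  set q₀ := max q r with hq₀
  have hq₀0 : 0 < q₀ := lt_max_of_lt_right hr0
  set p₀ := 1 / (1 / q₀ + 1 / d) with hp₀
  have hp₀0 : 0 < p₀ := by positivity
  have hp₀' : 1 / p₀ = 1 / q₀ + 1 / d := by rw [hp₀, one_div_one_div]
  have hpp : p₀ ≤ p := by
    rw [← one_div_le_one_div (by linarith) hp₀0, hp₀']
    rcases le_total q r with h | h
    · rw [hq₀, max_eq_right h]
      have : 1 / p ≤ 1 := by rw [div_le_one (by linarith)]; exact hp
      linarith
    · rw [hq₀, max_eq_left h]; linarith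
  obtain ⟨C, hC, h⟩ := exists_lintegral_rpow_le_edgeGrad_sharp hd hconj (le_max_right q r) hp₀'
  have hp0 : 0 < p := by linarith
  refine ⟨C * (1 + (2 ^ d) ^ (1 / p)), ENNReal.mul_ne_top hC (ENNReal.add_ne_top.2 ⟨by simp,
    ENNReal.rpow_ne_top_of_nonneg (by positivity) (by finiteness)⟩), fun P u hu => ?_⟩
  set ν := simplexMeasure P with hν
  set v : E d → ℝ := fun x => u x - ∫ y, u y ∂ν with hv
  have hvc : ContDiff ℝ 1 v := hu.sub contDiff_const
  have hG : edgeGrad P v = edgeGrad P u := by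
    funext x
    simp only [edgeGrad, hv, fderiv_sub_const]
  have hvm : Measurable fun x => ‖v x‖ₑ := hvc.continuous.enorm.measurable
  have hGm := measurable_edgeGrad P hu
  have mono : ∀ {g : E d → ℝ≥0∞}, Measurable g → ∀ {a b : ℝ}, 0 < a → a ≤ b →
      (∫⁻ x, g x ^ a ∂ν) ^ (1 / a) ≤ (∫⁻ x, g x ^ b ∂ν) ^ (1 / b) := by
    intro g hg a b ha hab
    have := eLpNorm'_le_eLpNorm'_of_exponent_le (μ := ν) (f := g) ha hab
      hg.aestronglyMeasurable
    simpa only [eLpNorm', enorm_eq_self] using this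
  have hP := lintegral_sub_integral_rpow_le P hu hp
  have hS := h P v hvc
  rw [hG] at hS
  set Z := (∫⁻ x, edgeGrad P u x ^ p ∂ν) ^ (1 / p) with hZ
  calc (∫⁻ x, ‖v x‖ₑ ^ q ∂ν) ^ (1 / q) ≤ (∫⁻ x, ‖v x‖ₑ ^ q₀ ∂ν) ^ (1 / q₀) :=
        mono hvm (by linarith) (le_max_left _ _)
    _ ≤ C * (∫⁻ x, (edgeGrad P u x + ‖v x‖ₑ) ^ p₀ ∂ν) ^ (1 / p₀) := hS
    _ ≤ C * (∫⁻ x, (edgeGrad P u x + ‖v x‖ₑ) ^ p ∂ν) ^ (1 / p) := by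
        gcongr 1
        exact mono (hGm.add hvm) hp₀0 hpp
    _ ≤ C * (Z + (∫⁻ x, ‖v x‖ₑ ^ p ∂ν) ^ (1 / p)) := by
        gcongr 1
        exact ENNReal.lintegral_Lp_add_le hGm.aemeasurable hvm.aemeasurable hp
    _ ≤ C * (Z + (2 ^ d * ∫⁻ x, edgeGrad P u x ^ p ∂ν) ^ (1 / p)) := by gcongr
    _ = _ := by
        rw [ENNReal.mul_rpow_of_nonneg _ _ (by positivity), ← hZ]; ring

end SobolevPoincare

/-! ### Extension to weakly differentiable functions. -/

section WeakSobolevPoincare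

open scoped ENNReal

variable {d : ℕ}

lemma fderiv_apply_eq_sum (u : E d → ℝ) (x w : E d) :
    fderiv ℝ u x w = ∑ l, w l * fderiv ℝ u x (EuclideanSpace.single l 1) := by
  have e : w = ∑ l, w l • EuclideanSpace.single l (1 : ℝ) := by
    ext j; simp [Pi.single_apply]
  conv_lhs => rw [e]
  simp

/-- Comparing this factor for `p` and for `q` is the origin of the power of `|T|` in the estimate.
-/
lemma eLpNorm_simplexMeasure (P : AffineBasis (Fin (d + 1)) ℝ (E d)) (f : E d → ℝ) {p : ℝ}
    (hp : 1 ≤ p) : eLpNorm f (ENNReal.ofReal p) (simplexMeasure P) =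
      (volume (simplex P))⁻¹ ^ (1 / p) *
        eLpNorm f (ENNReal.ofReal p) (volume.restrict (interior (simplex P))) := by
  rw [simplexMeasure_eq, eLpNorm_smul_measure_of_ne_top ENNReal.ofReal_ne_top,
    restrict_interior_simplex, smul_eq_mul, ENNReal.toReal_div, ENNReal.toReal_one,
    ENNReal.toReal_ofReal (by linarith)]

lemma memLp_simplexMeasure {P : AffineBasis (Fin (d + 1)) ℝ (E d)} {f : E d → ℝ} {p : ℝ≥0∞}
    (hf : MemLp f p (volume.restrict (interior (simplex P)))) : MemLp f p (simplexMeasure P) := by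
  rw [simplexMeasure_eq, ← restrict_interior_simplex]
  exact hf.smul_measure (ENNReal.inv_ne_top.2 (volume_simplex_ne_zero P))

lemma tendsto_eLpNorm_simplexMeasure (P : AffineBasis (Fin (d + 1)) ℝ (E d)) {f : ℕ → E d → ℝ}
    {p : ℝ} (hp : 1 ≤ p) (h : Tendsto (fun n => eLpNorm (f n) (ENNReal.ofReal p)
      (volume.restrict (interior (simplex P)))) atTop (𝓝 0)) :
    Tendsto (fun n => eLpNorm (f n) (ENNReal.ofReal p) (simplexMeasure P)) atTop (𝓝 0) := by
  simp only [eLpNorm_simplexMeasure P _ hp]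
  have := ENNReal.Tendsto.const_mul (a := (volume (simplex P))⁻¹ ^ (1 / p)) h (Or.inr
    (ENNReal.rpow_ne_top_of_nonneg (by positivity)
      (ENNReal.inv_ne_top.2 (volume_simplex_ne_zero P))))
  simpa using this

/-- The Sobolev-Poincaré inequality on simplices. -/
theorem exists_weak_sobolev_poincare (hd : 2 ≤ d) {p q : ℝ} (hp : 1 ≤ p) (hq : 1 ≤ q)
    (hpq : 1 / p - 1 / d ≤ 1 / q) :
    ∃ C : ℝ≥0∞, C ≠ ⊤ ∧ ∀ P : AffineBasis (Fin (d + 1)) ℝ (E d), ∀ v : E d → ℝ,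
      ∀ g : Fin d → E d → ℝ,
      MemLp v (ENNReal.ofReal p) (volume.restrict (interior (simplex P))) →
      (∀ l, MemLp (g l) (ENNReal.ofReal p) (volume.restrict (interior (simplex P)))) →
      (∀ l, HasWeakPartial (interior (simplex P)) l v (g l)) →
      eLpNorm (fun x => v x - ∫ y, v y ∂(simplexMeasure P)) (ENNReal.ofReal q) (simplexMeasure P) ≤
        C * ∑ k : Fin d, eLpNorm (fun x => ∑ l, (P k.succ - P 0) l * g l x) (ENNReal.ofReal p)
          (simplexMeasure P) := by
  obtain ⟨C, hC, h⟩ := exists_sobolev_poincare hd hp hq hpq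
  refine ⟨C, hC, fun P v g hv hg hw => ?_⟩
  have hp1 : 1 ≤ ENNReal.ofReal p := by simpa using hp
  have hq0 : 0 < q := by linarith
  have hp0 : 0 < p := by linarith
  obtain ⟨u, huc, hu0, hug⟩ := exists_contDiff_approx isOpen_interior
    ((isCompact_simplex P).isBounded.subset interior_subset) (convex_simplex P).interior
    (interior_simplex_nonempty P) hp hv hg hw
  set ν := simplexMeasure P with hν
  replace hu0 := tendsto_eLpNorm_simplexMeasure P hp hu0
  replace hug := fun l => tendsto_eLpNorm_simplexMeasure P hp (hug l)
  replace hv := memLp_simplexMeasure hv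
  replace hg := fun l => memLp_simplexMeasure (hg l)
  have huc1 : ∀ n, ContDiff ℝ 1 (u n) := fun n => (huc n).of_le (by simp)
  have hum : ∀ n, AEStronglyMeasurable (u n) ν := fun n => (huc n).continuous.aestronglyMeasurable
  -- The smooth functions converge only in `Lᵖ`, while `v` is not yet known to be in `L^q`. An
  -- almost everywhere convergent subsequence makes Fatou's lemma available for the `L^q` norm.
  obtain ⟨ns, hns, hae⟩ := (tendstoInMeasure_of_tendsto_eLpNorm (p := ENNReal.ofReal p)
    (by simpa using hp0) hum hv.1 hu0).exists_seq_tendsto_ae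
  have hui : ∀ n, Integrable (u n) ν := fun n => by
    refine ⟨hum n, ?_⟩
    have := lintegral_enorm_rpow_ne_top P (huc n).continuous zero_le_one
    simp only [ENNReal.rpow_one] at this
    exact this.lt_top
  have hmean : Tendsto (fun n => ∫ y, u n y ∂ν) atTop (𝓝 (∫ y, v y ∂ν)) := by
    refine tendsto_integral_of_L1' _ hv.1 (Eventually.of_forall hui) ?_
    refine tendsto_of_tendsto_of_tendsto_of_le_of_le tendsto_const_nhds hu0 (fun _ => zero_le) ?_
    intro n
    exact eLpNorm_le_eLpNorm_of_exponent_le hp1 ((hum n).sub hv.1)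
  have hderm : ∀ n w, AEStronglyMeasurable (fun x => fderiv ℝ (u n) x w) ν := fun n w =>
    (contDiff_fderiv_apply (huc n) w).continuous.aestronglyMeasurable
  -- The edge derivative of `u n` is that of `v` plus a combination of gradient errors, which tend
  -- to zero.
  have hbound : ∀ n, eLpNorm (fun x => u n x - ∫ y, u n y ∂ν) (ENNReal.ofReal q) ν ≤
      C * ∑ k : Fin d, (eLpNorm (fun x => ∑ l, (P k.succ - P 0) l * g l x) (ENNReal.ofReal p) ν +
        ∑ l, ‖(P k.succ - P 0) l‖ₑ * eLpNorm (fun x => fderiv ℝ (u n) x (EuclideanSpace.single l 1)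
          - g l x) (ENNReal.ofReal p) ν) := by
    intro n
    have h1 := h P (u n) (huc1 n)
    rw [eLpNorm_eq_lintegral_rpow_enorm_toReal (by simpa using hq0) ENNReal.ofReal_ne_top,
      ENNReal.toReal_ofReal hq0.le]
    refine h1.trans ?_
    gcongr 1
    have h2 : (∫⁻ x, edgeGrad P (u n) x ^ p ∂ν) ^ (1 / p) =
        eLpNorm (edgeGrad P (u n)) (ENNReal.ofReal p) ν := by
      rw [eLpNorm_eq_lintegral_rpow_enorm_toReal (by simpa using hp0) ENNReal.ofReal_ne_top,
        ENNReal.toReal_ofReal hp0.le]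
      simp only [enorm_eq_self]
    have h3 : edgeGrad P (u n) = ∑ k : Fin d, fun x => ‖fderiv ℝ (u n) x (P k.succ - P 0)‖ₑ := by
      funext x; simp [edgeGrad]
    rw [h2, h3]
    refine (eLpNorm_sum_le (fun k _ => (hderm n _).enorm.aestronglyMeasurable) hp1).trans ?_
    refine Finset.sum_le_sum fun k _ => ?_
    rw [eLpNorm_enorm]
    have h4 : (fun x => fderiv ℝ (u n) x (P k.succ - P 0)) =
        (fun x => ∑ l, (P k.succ - P 0) l * g l x) + ∑ l, (P k.succ - P 0) l •
          fun x => fderiv ℝ (u n) x (EuclideanSpace.single l 1) - g l x := by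
      funext x
      rw [fderiv_apply_eq_sum]
      simp only [Pi.add_apply, Finset.sum_apply, Pi.smul_apply, smul_eq_mul]
      rw [← Finset.sum_add_distrib]
      exact Finset.sum_congr rfl fun l _ => by ring
    have m1 : AEStronglyMeasurable (fun x => ∑ l, (P k.succ - P 0) l * g l x) ν :=
      Finset.aestronglyMeasurable_fun_sum _ fun l _ => (hg l).1.const_mul _
    have m2 : ∀ l, AEStronglyMeasurable ((P k.succ - P 0) l •
          fun x => fderiv ℝ (u n) x (EuclideanSpace.single l 1) - g l x) ν := fun l =>
      ((hderm n _).sub (hg l).1).const_smul _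
    rw [h4]
    refine (eLpNorm_add_le m1 (Finset.aestronglyMeasurable_sum _ fun l _ => m2 l) hp1).trans ?_
    gcongr 1
    refine (eLpNorm_sum_le (fun l _ => m2 l) hp1).trans ?_
    exact Finset.sum_le_sum fun l _ => (eLpNorm_const_smul _ _ _ _).le
  have hlim : Tendsto (fun n => C * ∑ k : Fin d,
      (eLpNorm (fun x => ∑ l, (P k.succ - P 0) l * g l x) (ENNReal.ofReal p) ν +
        ∑ l, ‖(P k.succ - P 0) l‖ₑ * eLpNorm (fun x => fderiv ℝ (u n) x (EuclideanSpace.single l 1)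
          - g l x) (ENNReal.ofReal p) ν)) atTop (𝓝 (C * ∑ k : Fin d,
      (eLpNorm (fun x => ∑ l, (P k.succ - P 0) l * g l x) (ENNReal.ofReal p) ν +
        ∑ l, ‖(P k.succ - P 0) l‖ₑ * 0))) := by
    refine ENNReal.Tendsto.const_mul (tendsto_finsetSum _ fun k _ => tendsto_const_nhds.add
      (tendsto_finsetSum _ fun l _ => ?_)) (Or.inr hC)
    exact ENNReal.Tendsto.const_mul (hug l) (Or.inr enorm_ne_top)
  simp only [mul_zero, Finset.sum_const_zero, add_zero] at hlim
  have hF := Lp.eLpNorm_lim_le_liminf_eLpNorm (p := ENNReal.ofReal q) (μ := ν)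
    (f := fun n x => u (ns n) x - ∫ y, u (ns n) y ∂ν)
    (fun n => (hum _).sub aestronglyMeasurable_const) (fun x => v x - ∫ y, v y ∂ν) (by
      filter_upwards [hae] with x hx
      exact hx.sub (hmean.comp hns.tendsto_atTop))
  refine hF.trans ?_
  refine (liminf_le_liminf (Eventually.of_forall fun n => hbound (ns n))).trans ?_
  exact ((hlim.comp hns.tendsto_atTop).liminf_eq).le

end WeakSobolevPoincare

/-! ### Surface measure on a face and integration in cone coordinates. -/

section Faces

open scoped ENNReal

variable {n : ℕ} (P : AffineBasis (Fin (n + 2)) ℝ (E (n + 1))) (i : Fin (n + 2))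

/-- The coordinates of the chart `chart P i` in terms of the height over `P i` and of the position
in the cross section. -/
noncomputable def coneCoord (z : ℝ × E n) : Fin (n + 1) → ℝ :=
  Fin.cons (z.1 - ∑ k, z.2 k) z.2

lemma coneCoord_injective : Function.Injective (coneCoord (n := n)) := by
  rintro ⟨t, z⟩ ⟨t', z'⟩ h
  have h1 : ∀ k : Fin n, z k = z' k := fun k => by
    simpa [coneCoord] using congrFun h k.succ
  have h0 := congrFun h 0
  simp only [coneCoord, Fin.cons_zero, h1] at h0
  have hz : z = z' := by ext k; exact h1 k
  rw [hz, show t = t' by linarith]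

/-- The linear part of the parametrization of the face opposite to `P i`. -/
noncomputable def faceLin : E n →ₗ[ℝ] E (n + 1) :=
  ∑ k : Fin n, (EuclideanSpace.proj k : E n →L[ℝ] ℝ).toLinearMap.smulRight
    (P (i.succAbove k.succ) - P (i.succAbove 0))

lemma faceLin_apply (z : E n) :
    faceLin P i z = ∑ k : Fin n, z k • (P (i.succAbove k.succ) - P (i.succAbove 0)) := by
  simp [faceLin]

/-- The linear part of the parametrization of the simplex as a cone with apex `P i`. -/
noncomputable def coneLin : ℝ × E n →ₗ[ℝ] E (n + 1) :=
  (LinearMap.toSpanSingleton ℝ (E (n + 1)) (P (i.succAbove 0) - P i)).coprod (faceLin P i)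

lemma coneLin_apply (z : ℝ × E n) :
    coneLin P i z = z.1 • (P (i.succAbove 0) - P i) + faceLin P i z.2 := by
  simp [coneLin]

lemma add_coneLin (z : ℝ × E n) : P i + coneLin P i z = chart P i (coneCoord z) := by
  rw [coneLin_apply, faceLin_apply, chart, chartLin_apply, Fin.sum_univ_succ]
  simp only [coneCoord, Fin.cons_zero, Fin.cons_succ]
  have e : ∀ k : Fin n, z.2 k • (P (i.succAbove k.succ) - P (i.succAbove 0)) =
      z.2 k • (P (i.succAbove k.succ) - P i) - z.2 k • (P (i.succAbove 0) - P i) := by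
    intro k; rw [← smul_sub]; congr 1; abel
  simp only [e, Finset.sum_sub_distrib, ← Finset.sum_smul]
  rw [sub_smul]
  abel

lemma coneLin_injective : Function.Injective (coneLin P i) := by
  intro x y h
  apply coneCoord_injective
  apply chart_injective P i
  rw [← add_coneLin, ← add_coneLin, h]

lemma faceLin_injective : Function.Injective (faceLin P i) := by
  intro x y h
  have : coneLin P i (0, x) = coneLin P i (0, y) := by
    rw [coneLin_apply, coneLin_apply, h]
  exact (Prod.ext_iff.1 (coneLin_injective P i this)).2

/-- The parametrization of the face opposite to `P i`. -/
noncomputable def faceChart (y : E n) : E (n + 1) := P (i.succAbove 0) + faceLin P i y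

lemma continuous_faceChart : Continuous (faceChart P i) :=
  continuous_const.add (faceLin P i).continuous_of_finiteDimensional

/-- The reference simplex in Euclidean space. -/
def refFace (n : ℕ) : Set (E n) := {y | (∀ k, 0 ≤ y k) ∧ ∑ k, y k ≤ 1}

lemma isClosed_refFace : IsClosed (refFace n) := by
  have : refFace n = (⋂ k, {y : E n | 0 ≤ y k}) ∩ {y : E n | ∑ k, y k ≤ 1} := by
    ext y; simp [refFace]
  rw [this]
  exact (isClosed_iInter fun k => isClosed_le continuous_const (by fun_prop)).inter
    (isClosed_le (by fun_prop) continuous_const)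

lemma faceChart_eq_sum (y : E n) : faceChart P i y =
    (1 - ∑ k, y k) • P (i.succAbove 0) + ∑ k : Fin n, y k • P (i.succAbove k.succ) := by
  rw [faceChart, faceLin_apply]
  simp only [smul_sub, Finset.sum_sub_distrib, ← Finset.sum_smul, sub_smul, one_smul]
  abel

lemma face_eq_image : face P i = faceChart P i '' refFace n := by
  have hset : P '' {i}ᶜ = Set.range fun j => P (i.succAbove j) := by
    rw [← Fin.range_succAbove, ← Set.range_comp]; rfl
  rw [face, hset]
  apply Set.Subset.antisymm
  · refine convexHull_min ?_ ?_
    · rintro _ ⟨j, rfl⟩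
      cases j using Fin.cases with
      | zero => exact ⟨0, by simp [refFace], by simp [faceChart]⟩
      | succ k =>
        refine ⟨EuclideanSpace.single k 1, ⟨fun j => ?_, ?_⟩, ?_⟩
        · by_cases h : j = k <;> simp [h]
        · simp
        · simp [faceChart, faceLin_apply]
    · have hconv : Convex ℝ (refFace n) := by
        rintro x ⟨hx, hx'⟩ y ⟨hy, hy'⟩ a b ha hb hab
        refine ⟨fun k => ?_, ?_⟩
        · have := mul_nonneg ha (hx k)
          have := mul_nonneg hb (hy k)
          simp only [PiLp.add_apply, PiLp.smul_apply, smul_eq_mul]; linarith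
        · simp only [PiLp.add_apply, PiLp.smul_apply, smul_eq_mul, Finset.sum_add_distrib,
            ← Finset.mul_sum]
          nlinarith
      have : faceChart P i '' refFace n = (fun v => P (i.succAbove 0) + v) ''
          (faceLin P i '' refFace n) := by rw [Set.image_image]; rfl
      rw [this]
      exact (hconv.linear_image _).translate _
  · rintro _ ⟨y, ⟨hy, hy'⟩, rfl⟩
    rw [faceChart_eq_sum]
    have hmem : ∀ j, P (i.succAbove j) ∈ convexHull ℝ (Set.range fun j => P (i.succAbove j)) :=
      fun j => subset_convexHull _ _ ⟨j, rfl⟩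
    have := (convex_convexHull ℝ (Set.range fun j => P (i.succAbove j))).sum_mem
      (t := Finset.univ) (w := Fin.cons (1 - ∑ k, y k) fun k => y k)
      (z := fun j => P (i.succAbove j)) (by
        intro j _
        cases j using Fin.cases with
        | zero => simpa using hy'
        | succ k => simpa using hy k) (by rw [Fin.sum_univ_succ]; simp) (fun j _ => hmem j)
    rw [Fin.sum_univ_succ] at this
    simpa using this

/-- An injective linear map scales Hausdorff measure by the constant `normDet`, so the surface
measure is a multiple of Lebesgue measure in the face chart. -/
lemma exists_faceMeasure_eq : ∃ c : ℝ≥0∞, c ≠ 0 ∧ c ≠ ⊤ ∧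
    faceMeasure P i = c • Measure.map (faceChart P i) (volume.restrict (refFace n)) := by
  refine ⟨ENNReal.ofReal (faceLin P i).normDet, ?_, ENNReal.ofReal_ne_top, ?_⟩
  · rw [Ne, ENNReal.ofReal_eq_zero, not_le]
    refine lt_of_le_of_ne (faceLin P i).normDet_nonneg (Ne.symm ?_)
    exact ((faceLin P i).normDet_ne_zero_tfae.out 0 1).2
      (LinearMap.ker_eq_bot.2 (faceLin_injective P i))
  · have hm := (continuous_faceChart P i).measurable
    ext s hs
    have h1 : faceMeasure P i s = Measure.euclideanHausdorffMeasure n (s ∩ face P i) := by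
      rw [faceMeasure, Measure.restrict_apply hs]; rfl
    have h2 : s ∩ face P i = (fun v => P (i.succAbove 0) + v) ''
        (faceLin P i '' (faceChart P i ⁻¹' s ∩ refFace n)) := by
      rw [face_eq_image, Set.image_image, Set.inter_comm s, Set.inter_comm _ (refFace n)]
      exact (Set.image_inter_preimage (faceChart P i) (refFace n) s).symm
    have h3 := (faceLin P i).euclideanHausdorffMeasure_image_eq_normDet_mul_volume
      (faceChart P i ⁻¹' s ∩ refFace n)
    rw [finrank_euclideanSpace_fin] at h3
    rw [h1, h2, (isometry_add_left _).euclideanHausdorffMeasure_image, h3, Measure.smul_apply,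
      Measure.map_apply hm hs, Measure.restrict_apply (hm hs), smul_eq_mul]

lemma isCompact_face : IsCompact (face P i) :=
  ((Set.toFinite {i}ᶜ).image P).isCompact_convexHull ℝ

lemma volume_refFace_ne_top : volume (refFace n) ≠ ⊤ := by
  have h := (volume_refSimplex_ne_zero_ne_top (d := n)).2
  rw [← (EuclideanSpace.volume_preserving_symm_measurableEquiv_toLp (Fin n)).measure_preimage_equiv]
    at h
  exact h

instance : IsFiniteMeasure (faceMeasure P i) := by
  obtain ⟨c, -, hc, h⟩ := exists_faceMeasure_eq P i
  refine ⟨?_⟩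
  rw [h, Measure.smul_apply, Measure.map_apply (continuous_faceChart P i).measurable
    MeasurableSet.univ, Set.preimage_univ, Measure.restrict_apply_univ, smul_eq_mul]
  exact ENNReal.mul_lt_top hc.lt_top volume_refFace_ne_top.lt_top

/-- The radial measure in cone coordinates. -/
noncomputable def radialMeasure (n : ℕ) : Measure ℝ :=
  (volume.restrict (Set.Ioc 0 1)).withDensity fun t => ENNReal.ofReal (t ^ n)

instance : IsFiniteMeasure (radialMeasure n) := by
  refine ⟨?_⟩
  rw [radialMeasure, withDensity_apply _ MeasurableSet.univ, Measure.restrict_univ]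
  calc ∫⁻ t in Set.Ioc (0 : ℝ) 1, ENNReal.ofReal (t ^ n) ≤ ∫⁻ _t in Set.Ioc (0 : ℝ) 1, 1 := by
        refine setLIntegral_mono measurable_const fun t ht => ?_
        rw [ENNReal.ofReal_le_one]
        exact pow_le_one₀ ht.1.le ht.2
    _ < ⊤ := by simp

/-- The cone map with apex `P i`. -/
noncomputable def coneMap (z : ℝ × E (n + 1)) : E (n + 1) := P i + z.1 • (z.2 - P i)

lemma continuous_coneMap : Continuous (coneMap P i) := by
  unfold coneMap; fun_prop

/-- At height `t` over `P i` the simplex is cut in a copy of the face scaled by `t`; in the linear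
coordinates `coneLin` this is `y ↦ t • y`. -/
lemma coneMap_faceChart (t : ℝ) (y : E n) :
    coneMap P i (t, faceChart P i y) = P i + coneLin P i (t, t • y) := by
  simp only [coneMap, coneLin_apply, faceChart, map_smul]
  rw [← smul_add]
  congr 2
  abel

lemma mem_simplex_coneLin_iff (t : ℝ) (z : E n) : P i + coneLin P i (t, z) ∈ simplex P ↔
    t ≤ 1 ∧ (∀ k, 0 ≤ z k) ∧ ∑ k, z k ≤ t := by
  rw [add_coneLin, chart_mem_simplex_iff]
  simp only [refSimplex, Set.mem_ofPred_eq, Fin.forall_fin_succ, coneCoord, Fin.cons_zero,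
    Fin.cons_succ, Fin.sum_univ_succ, sub_nonneg, sub_add_cancel]
  tauto

/-- As for the vertex charts, uniqueness of Haar measure gives a constant Jacobian whose value is
irrelevant. -/
lemma exists_map_coneLin : ∃ κ : ℝ≥0∞, κ ≠ 0 ∧ κ ≠ ⊤ ∧
    Measure.map (fun z => P i + coneLin P i z) (volume : Measure (ℝ × E n)) =
      κ • (volume : Measure (E (n + 1))) := by
  set L : (ℝ × E n) ≃L[ℝ] E (n + 1) := (LinearMap.linearEquivOfInjective (coneLin P i)
    (coneLin_injective P i) (by simp [add_comm])).toContinuousLinearEquiv with hL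
  have h0 : (volume : Measure (ℝ × E n)).IsAddHaarMeasure := by
    rw [Measure.volume_eq_prod]; infer_instance
  have h1 : (Measure.map L volume).IsAddHaarMeasure := L.isAddHaarMeasure_map volume
  have h2 := Measure.isAddLeftInvariant_eq_smul (Measure.map L volume)
    (volume : Measure (E (n + 1)))
  set κ := (Measure.map L volume).addHaarScalarFactor (volume : Measure (E (n + 1))) with hκ
  refine ⟨κ, ?_, ENNReal.coe_ne_top, ?_⟩
  · intro h0
    have h4 : Measure.map L volume = 0 := by
      have h5 : κ = 0 := by exact_mod_cast h0
      rw [h2, h5, zero_smul]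
    exact h1.toIsOpenPosMeasure.open_pos Set.univ isOpen_univ Set.univ_nonempty (by simp [h4])
  · have e : (fun z => P i + coneLin P i z) = (fun y => P i + y) ∘ L := rfl
    rw [e, ← Measure.map_map (measurable_const_add _) L.continuous.measurable, h2,
      Measure.map_smul, map_add_left_eq_self]
    rfl

/-- Integration over the simplex in cone coordinates with apex `P i`. -/
lemma exists_map_coneMap : ∃ κ : ℝ≥0∞, κ ≠ 0 ∧ κ ≠ ⊤ ∧
    Measure.map (coneMap P i) ((radialMeasure n).prod (faceMeasure P i)) =
      κ • volume.restrict (simplex P) := by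
  obtain ⟨c, hc0, hct, hc⟩ := exists_faceMeasure_eq P i
  obtain ⟨κ, hκ0, hκt, hκ⟩ := exists_map_coneLin P i
  refine ⟨c * κ, mul_ne_zero hc0 hκ0, ENNReal.mul_ne_top hct hκt, ?_⟩
  have hK : Continuous fun z => P i + coneLin P i z :=
    continuous_const.add (coneLin P i).continuous_of_finiteDimensional
  have hT := measurableSet_simplex P
  refine Measure.ext_of_lintegral _ fun f hf => ?_
  have hfc : Measurable fun z => f (coneMap P i z) := hf.comp (continuous_coneMap P i).measurable
  set F := (simplex P).indicator f with hF
  have hFm : Measurable F := hf.indicator hT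
  have hFK : Measurable fun z => F (P i + coneLin P i z) := hFm.comp hK.measurable
  have right : ∫⁻ x, f x ∂((c * κ) • volume.restrict (simplex P)) =
      c * ∫⁻ t, ∫⁻ z, F (P i + coneLin P i (t, z)) := by
    rw [lintegral_smul_measure, smul_eq_mul, mul_assoc]
    congr 1
    rw [← lintegral_indicator hT, ← smul_eq_mul, ← lintegral_smul_measure, ← hκ,
      lintegral_map hFm hK.measurable, Measure.volume_eq_prod, lintegral_prod _ hFK.aemeasurable]
  -- Rescaling the slice at height `t` to the reference face has Jacobian `t^n`, the density of
  -- `radialMeasure`. The rescaling needs `t > 0`; the height `0` is null.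
  have slice : ∀ t ∈ Set.Ioc (0 : ℝ) 1, ∫⁻ z, F (P i + coneLin P i (t, z)) =
      ENNReal.ofReal (t ^ n) * ∫⁻ y in refFace n, f (coneMap P i (t, faceChart P i y)) := by
    intro t ht
    have hFt : Measurable fun z => F (P i + coneLin P i (t, z)) :=
      hFK.comp measurable_prodMk_left
    have hmap := Measure.map_addHaar_smul (volume : Measure (E n)) ht.1.ne'
    have h1 : ∫⁻ y, F (P i + coneLin P i (t, t • y)) =
        ENNReal.ofReal |(t ^ n)⁻¹| * ∫⁻ z, F (P i + coneLin P i (t, z)) := by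
      rw [← lintegral_map hFt (measurable_const_smul t), hmap, lintegral_smul_measure,
        finrank_euclideanSpace_fin, smul_eq_mul]
    have h2 : ∫⁻ y, F (P i + coneLin P i (t, t • y)) =
        ∫⁻ y in refFace n, f (coneMap P i (t, faceChart P i y)) := by
      rw [← lintegral_indicator isClosed_refFace.measurableSet]
      refine lintegral_congr fun y => ?_
      have hiff : P i + coneLin P i (t, t • y) ∈ simplex P ↔ y ∈ refFace n := by
        rw [mem_simplex_coneLin_iff]
        simp only [PiLp.smul_apply, smul_eq_mul, ← Finset.mul_sum, refFace, Set.mem_ofPred_eq,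
          mul_nonneg_iff_of_pos_left ht.1]
        constructor
        · rintro ⟨-, h, h'⟩
          exact ⟨h, by nlinarith [ht.1]⟩
        · rintro ⟨h, h'⟩
          exact ⟨ht.2, h, by nlinarith [ht.1]⟩
      by_cases hy : y ∈ refFace n
      · rw [Set.indicator_of_mem hy, hF, Set.indicator_of_mem (hiff.2 hy), coneMap_faceChart]
      · rw [Set.indicator_of_notMem hy, hF, Set.indicator_of_notMem (fun h => hy (hiff.1 h))]
    have htn : 0 < t ^ n := pow_pos ht.1 n
    rw [← h2, h1, ← mul_assoc, ← ENNReal.ofReal_mul htn.le, abs_of_pos (inv_pos.2 htn),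
      mul_inv_cancel₀ htn.ne', ENNReal.ofReal_one, one_mul]
  have outside : ∀ t ∉ Set.Icc (0 : ℝ) 1, ∫⁻ z, F (P i + coneLin P i (t, z)) = 0 := by
    intro t ht
    rw [← lintegral_zero (α := E n) (μ := volume)]
    refine lintegral_congr fun z => ?_
    refine Set.indicator_of_notMem (fun h => ht ?_) _
    rw [mem_simplex_coneLin_iff] at h
    exact ⟨(Finset.sum_nonneg fun k _ => h.2.1 k).trans h.2.2, h.1⟩
  rw [right, lintegral_map hf (continuous_coneMap P i).measurable,
    lintegral_prod _ hfc.aemeasurable, radialMeasure,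
    lintegral_withDensity_eq_lintegral_mul _ (by fun_prop) hfc.lintegral_prod_right']
  have hout : ∫⁻ t, ∫⁻ z, F (P i + coneLin P i (t, z)) =
      ∫⁻ t in Set.Ioc (0 : ℝ) 1, ∫⁻ z, F (P i + coneLin P i (t, z)) := by
    rw [Measure.restrict_congr_set Ioc_ae_eq_Icc, ← lintegral_indicator measurableSet_Icc]
    refine lintegral_congr fun t => ?_
    by_cases ht : t ∈ Set.Icc (0 : ℝ) 1
    · rw [Set.indicator_of_mem ht]
    · rw [Set.indicator_of_notMem ht, outside t ht]
  rw [hout, ← lintegral_const_mul _ hFK.lintegral_prod_right']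
  refine setLIntegral_congr_fun measurableSet_Ioc fun t ht => ?_
  simp only [Pi.mul_apply]
  have hft : Measurable fun y => f (coneMap P i (t, y)) := hfc.comp measurable_prodMk_left
  rw [slice t ht, hc, lintegral_smul_measure,
    lintegral_map hft (continuous_faceChart P i).measurable, smul_eq_mul]
  ring

end Faces

/-! ### Face integrals as integrals over the simplex, and traces. -/

section Traces

open scoped ENNReal

variable {n : ℕ} (P : AffineBasis (Fin (n + 2)) ℝ (E (n + 1))) (i : Fin (n + 2))

/-- The density `(n + 1) f + (x - pᵢ) · g` on the simplex whose integral is, for `g = ∇f`, a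
multiple of the integral of `f` over the face opposite to `pᵢ`. -/
noncomputable def coneDensity (f : E (n + 1) → ℝ) (g : Fin (n + 1) → E (n + 1) → ℝ)
    (x : E (n + 1)) : ℝ := (n + 1) * f x + ∑ l, (x - P i) l * g l x

/-- The classical gradient in coordinates. -/
noncomputable def grad (u : E (n + 1) → ℝ) (l : Fin (n + 1)) (x : E (n + 1)) : ℝ :=
  fderiv ℝ u x (EuclideanSpace.single l 1)

variable {P i} in
lemma coneDensity_grad (u : E (n + 1) → ℝ) (x : E (n + 1)) :
    coneDensity P i u (grad u) x = (n + 1) * u x + fderiv ℝ u x (x - P i) := by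
  rw [fderiv_apply_eq_sum]; rfl

lemma continuous_coneDensity {u : E (n + 1) → ℝ} (hu : ContDiff ℝ 1 u) :
    Continuous (coneDensity P i u (grad u)) := by
  have h := hu.continuous
  have h1 : Continuous (fderiv ℝ u) := hu.continuous_fderiv (by simp)
  have e : coneDensity P i u (grad u) = fun x => (n + 1) * u x + fderiv ℝ u x (x - P i) :=
    funext (coneDensity_grad u)
  rw [e]
  exact (continuous_const.mul h).add (h1.clm_apply (continuous_id.sub continuous_const))

lemma integral_radialMeasure (f : ℝ → ℝ) :
    ∫ t, f t ∂(radialMeasure n) = ∫ t in (0 : ℝ)..1, t ^ n * f t := by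
  rw [intervalIntegral.integral_of_le zero_le_one, radialMeasure,
    integral_withDensity_eq_integral_toReal_smul (by fun_prop) (by simp)]
  refine setIntegral_congr_fun measurableSet_Ioc fun t ht => ?_
  simp only [ENNReal.toReal_ofReal (pow_nonneg ht.1.le n), smul_eq_mul]

/-- Along the ray from `P i` through `y`, `t^n` times the density is the derivative of `t^(n+1) u(P
i + t (y - P i))`, which is `0` at `t = 0` and `u y` at `t = 1`. -/
lemma integral_radialMeasure_coneDensity {u : E (n + 1) → ℝ} (hu : ContDiff ℝ 1 u)
    (y : E (n + 1)) :
    ∫ t, coneDensity P i u (grad u) (coneMap P i (t, y)) ∂(radialMeasure n) = u y := by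
  have hc : Continuous fun t : ℝ => coneMap P i (t, y) :=
    (continuous_coneMap P i).comp (by fun_prop)
  rw [integral_radialMeasure, intervalIntegral.integral_eq_sub_of_hasDerivAt
    (f := fun t => t ^ (n + 1) * u (coneMap P i (t, y)))]
  · simp [coneMap]
  · intro t _
    have h1 : HasDerivAt (fun t : ℝ => coneMap P i (t, y)) (y - P i) t := by
      simpa [coneMap] using ((hasDerivAt_id t).smul_const (y - P i)).const_add (P i)
    have h2 := (hu.differentiable (by simp) (coneMap P i (t, y))).hasFDerivAt.comp_hasDerivAt t h1
    refine ((hasDerivAt_pow (n + 1) t).mul h2).congr_deriv ?_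
    rw [coneDensity_grad]
    have e : coneMap P i (t, y) - P i = t • (y - P i) := by simp [coneMap]
    rw [e, map_smul, smul_eq_mul]
    push_cast
    simp only [Function.comp_apply]
    ring
  · exact ((continuous_pow n).mul
      ((continuous_coneDensity P i hu).comp hc)).intervalIntegrable _ _

lemma integrable_faceMeasure {u : E (n + 1) → ℝ} (hu : Continuous u) :
    Integrable u (faceMeasure P i) := by
  obtain ⟨K, hK⟩ := (isCompact_face P i).exists_bound_of_continuousOn hu.continuousOn
  refine Integrable.of_bound hu.aestronglyMeasurable K ?_
  filter_upwards [ae_restrict_mem (isCompact_face P i).isClosed.measurableSet] with x hx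
  exact hK x hx

/-- Integrals of smooth functions over a face are integrals over the simplex. -/
lemma exists_face_integral_eq : ∃ κ : ℝ≥0∞, κ ≠ 0 ∧ κ ≠ ⊤ ∧ ∀ u : E (n + 1) → ℝ, ContDiff ℝ 1 u →
    ∫ y, u y ∂(faceMeasure P i) =
        κ.toReal * ∫ x in simplex P, coneDensity P i u (grad u) x ∧
      eLpNorm u 1 (faceMeasure P i) ≤
        κ * eLpNorm (coneDensity P i u (grad u)) 1 (volume.restrict (simplex P)) := by
  obtain ⟨κ, h0, ht, hκ⟩ := exists_map_coneMap P i
  refine ⟨κ, h0, ht, fun u hu => ?_⟩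
  have hw := continuous_coneDensity P i hu
  have hm := (continuous_coneMap P i).measurable
  have hi : Integrable (coneDensity P i u (grad u)) (κ • volume.restrict (simplex P)) :=
    (hw.continuousOn.integrableOn_compact (isCompact_simplex P)).smul_measure ht
  have hi2 : Integrable (fun z => coneDensity P i u (grad u) (coneMap P i z))
      ((radialMeasure n).prod (faceMeasure P i)) := by
    rw [← hκ] at hi
    exact (integrable_map_measure hw.aestronglyMeasurable hm.aemeasurable).1 hi
  constructor
  · calc ∫ y, u y ∂(faceMeasure P i) = ∫ y, ∫ t, coneDensity P i u (grad u) (coneMap P i (t, y))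
          ∂(radialMeasure n) ∂(faceMeasure P i) := by
          simp only [integral_radialMeasure_coneDensity P i hu]
      _ = ∫ x, coneDensity P i u (grad u) x ∂(κ • volume.restrict (simplex P)) := by
          rw [← hκ, integral_map hm.aemeasurable hw.aestronglyMeasurable,
            integral_prod_symm _ hi2]
      _ = _ := by rw [integral_smul_measure, smul_eq_mul]
  · rw [eLpNorm_one_eq_lintegral_enorm, eLpNorm_one_eq_lintegral_enorm]
    calc ∫⁻ y, ‖u y‖ₑ ∂(faceMeasure P i)
        ≤ ∫⁻ y, ∫⁻ t, ‖coneDensity P i u (grad u) (coneMap P i (t, y))‖ₑ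
          ∂(radialMeasure n) ∂(faceMeasure P i) := by
          refine lintegral_mono fun y => ?_
          conv_lhs => rw [← integral_radialMeasure_coneDensity P i hu y]
          exact enorm_integral_le_lintegral_enorm _
      _ = ∫⁻ x, ‖coneDensity P i u (grad u) x‖ₑ ∂(κ • volume.restrict (simplex P)) := by
          rw [← hκ, lintegral_map hw.enorm.measurable hm, lintegral_prod_symm]
          exact (hw.comp (continuous_coneMap P i)).enorm.measurable.aemeasurable
      _ = _ := by rw [lintegral_smul_measure, smul_eq_mul]

/-- On the bounded simplex the coefficients `x - P i` are bounded, so `coneDensity` is continuous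
from `W^{1,1}` to `L¹`. This passes the face formula to weak limits. -/
lemma tendsto_coneDensity {φ : E (n + 1) → ℝ} {g : Fin (n + 1) → E (n + 1) → ℝ}
    {u : ℕ → E (n + 1) → ℝ} (huc : ∀ m, ContDiff ℝ 1 (u m))
    (hφm : AEStronglyMeasurable φ (volume.restrict (simplex P)))
    (hgm : ∀ l, AEStronglyMeasurable (g l) (volume.restrict (simplex P)))
    (h0 : Tendsto (fun m => eLpNorm (fun x => u m x - φ x) 1 (volume.restrict (simplex P)))
      atTop (𝓝 0))
    (hg : ∀ l, Tendsto (fun m => eLpNorm (fun x => fderiv ℝ (u m) x (EuclideanSpace.single l 1)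
      - g l x) 1 (volume.restrict (simplex P))) atTop (𝓝 0)) :
    Tendsto (fun m => eLpNorm (fun x => coneDensity P i (u m) (grad (u m)) x -
      coneDensity P i φ g x) 1 (volume.restrict (simplex P))) atTop (𝓝 0) := by
  have hK : ∀ l : Fin (n + 1), ∃ K : ℝ, 0 ≤ K ∧ ∀ x ∈ simplex P, ‖(x - P i) l‖ ≤ K := by
    intro l
    obtain ⟨K, hK⟩ := (isCompact_simplex P).exists_bound_of_continuousOn
      (f := fun x : E (n + 1) => (x - P i) l) (by fun_prop)
    exact ⟨max K 0, le_max_right _ _, fun x hx => (hK x hx).trans (le_max_left _ _)⟩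
  choose K hK0 hK using hK
  set μ := volume.restrict (simplex P) with hμ
  have hmem : ∀ᵐ x ∂μ, x ∈ simplex P := ae_restrict_mem (measurableSet_simplex P)
  have hum : ∀ m, AEStronglyMeasurable (fun x => u m x - φ x) μ := fun m =>
    (huc m).continuous.aestronglyMeasurable.sub hφm
  have hgrad : ∀ m l, AEStronglyMeasurable
      (fun x => fderiv ℝ (u m) x (EuclideanSpace.single l 1) - g l x) μ := fun m l =>
    (((huc m).continuous_fderiv (by simp)).clm_apply
      continuous_const).aestronglyMeasurable.sub (hgm l)
  have hxm : ∀ l : Fin (n + 1), AEStronglyMeasurable (fun x : E (n + 1) => (x - P i) l) μ :=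
    fun l => Continuous.aestronglyMeasurable (by fun_prop)
  have hbound : ∀ m, eLpNorm (fun x => coneDensity P i (u m) (grad (u m)) x -
      coneDensity P i φ g x) 1 μ ≤ ENNReal.ofReal (n + 1) * eLpNorm (fun x => u m x - φ x) 1 μ +
        ∑ l, ENNReal.ofReal (K l) * eLpNorm (fun x => fderiv ℝ (u m) x
          (EuclideanSpace.single l 1) - g l x) 1 μ := by
    intro m
    have e : (fun x => coneDensity P i (u m) (grad (u m)) x - coneDensity P i φ g x) =
        (fun x => ((n : ℝ) + 1) * (u m x - φ x)) + ∑ l, fun x : E (n + 1) =>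
          (x - P i) l * (fderiv ℝ (u m) x (EuclideanSpace.single l 1) - g l x) := by
      funext x
      simp only [coneDensity, grad, Pi.add_apply, Finset.sum_apply, mul_sub,
        Finset.sum_sub_distrib]
      ring
    have m2 : ∀ l ∈ Finset.univ, AEStronglyMeasurable (fun x : E (n + 1) =>
        (x - P i) l * (fderiv ℝ (u m) x (EuclideanSpace.single l 1) - g l x)) μ := fun l _ =>
      (hxm l).mul (hgrad m l)
    rw [e]
    refine (eLpNorm_add_le ((hum m).const_mul _) (Finset.aestronglyMeasurable_sum _ m2)
      le_rfl).trans (add_le_add ?_ ((eLpNorm_sum_le m2 le_rfl).trans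
        (Finset.sum_le_sum fun l _ => ?_)))
    · refine eLpNorm_le_mul_eLpNorm_of_ae_le_mul (Eventually.of_forall fun x => ?_) 1
      rw [norm_mul, Real.norm_of_nonneg (by positivity : (0 : ℝ) ≤ n + 1)]
    · refine eLpNorm_le_mul_eLpNorm_of_ae_le_mul ?_ 1
      filter_upwards [hmem] with x hx
      rw [norm_mul]
      exact mul_le_mul_of_nonneg_right (hK l x hx) (norm_nonneg _)
  refine tendsto_of_tendsto_of_tendsto_of_le_of_le tendsto_const_nhds ?_ (fun _ => zero_le) hbound
  have : Tendsto (fun m => ENNReal.ofReal (n + 1) * eLpNorm (fun x => u m x - φ x) 1 μ +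
        ∑ l, ENNReal.ofReal (K l) * eLpNorm (fun x => fderiv ℝ (u m) x
          (EuclideanSpace.single l 1) - g l x) 1 μ) atTop
      (𝓝 (ENNReal.ofReal (n + 1) * 0 + ∑ l, ENNReal.ofReal (K l) * 0)) :=
    (ENNReal.Tendsto.const_mul h0 (Or.inr ENNReal.ofReal_ne_top)).add
      (tendsto_finsetSum _ fun l _ =>
        ENNReal.Tendsto.const_mul (hg l) (Or.inr ENNReal.ofReal_ne_top))
  simpa using this

lemma coneDensity_sub {u v : E (n + 1) → ℝ} (hu : ContDiff ℝ 1 u) (hv : ContDiff ℝ 1 v) :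
    coneDensity P i (fun x => u x - v x) (grad fun x => u x - v x) =
      fun x => coneDensity P i u (grad u) x - coneDensity P i v (grad v) x := by
  funext x
  rw [coneDensity_grad, coneDensity_grad, coneDensity_grad,
    fderiv_fun_sub (hu.differentiable (by simp) x) (hv.differentiable (by simp) x)]
  simp only [sub_apply]
  ring

/-- Functions in `W^{1,1}(T)` have traces on the faces. -/
lemma exists_isFaceTrace {φ : E (n + 1) → ℝ} {g : Fin (n + 1) → E (n + 1) → ℝ}
    (hφ : MemLp φ 1 (volume.restrict (interior (simplex P))))
    (hg : ∀ l, MemLp (g l) 1 (volume.restrict (interior (simplex P))))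
    (hw : ∀ l, HasWeakPartial (interior (simplex P)) l φ (g l)) :
    ∃ f, IsFaceTrace P i φ f := by
  obtain ⟨u, huc, hu0, hug⟩ := exists_contDiff_approx (p := 1) isOpen_interior
    ((isCompact_simplex P).isBounded.subset interior_subset) (convex_simplex P).interior
    (interior_simplex_nonempty P) le_rfl (by simpa using hφ) (by simpa using hg) hw
  simp only [ENNReal.ofReal_one] at hu0 hug
  have hlim := tendsto_coneDensity P i (φ := φ) (g := g) (u := u)
    (fun m => (huc m).of_le (by simp)) (restrict_interior_simplex P ▸ hφ.1)
    (fun l => restrict_interior_simplex P ▸ (hg l).1) (restrict_interior_simplex P ▸ hu0)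
    (fun l => restrict_interior_simplex P ▸ (hug l))
  obtain ⟨κ, -, hκt, hκ⟩ := exists_face_integral_eq P i
  have huc1 : ∀ m, ContDiff ℝ 1 (u m) := fun m => (huc m).of_le (by simp)
  have hwm : AEStronglyMeasurable (coneDensity P i φ g) (volume.restrict (simplex P)) := by
    refine ((restrict_interior_simplex P ▸ hφ.1).const_mul _).add
      (Finset.aestronglyMeasurable_fun_sum _ fun l _ => ?_)
    exact (Continuous.aestronglyMeasurable (by fun_prop)).mul
      (restrict_interior_simplex P ▸ (hg l).1)
  have hmem : ∀ m, MemLp (u m) 1 (faceMeasure P i) := by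
    intro m
    rw [memLp_one_iff_integrable]
    exact integrable_faceMeasure P i (huc m).continuous
  set a := fun m => eLpNorm (fun x => coneDensity P i (u m) (grad (u m)) x -
      coneDensity P i φ g x) 1 (volume.restrict (simplex P)) with ha
  -- The `L¹` norm on the face is bounded by that of `coneDensity` on the simplex, so convergence in
  -- `W^{1,1}` makes the restrictions Cauchy; their limit is the trace.
  have hcauchy : CauchySeq fun m => (hmem m).toLp := by
    rw [Lp.cauchySeq_Lp_iff_cauchySeq_eLpNorm]
    have h2 : Tendsto (fun z : ℕ × ℕ => κ * (a z.1 + a z.2)) atTop (𝓝 (κ * (0 + 0))) := by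
      rw [← prod_atTop_atTop_eq]
      exact ENNReal.Tendsto.const_mul ((hlim.comp tendsto_fst).add (hlim.comp tendsto_snd))
        (Or.inr hκt)
    simp only [add_zero, mul_zero] at h2
    refine tendsto_of_tendsto_of_tendsto_of_le_of_le tendsto_const_nhds h2 (fun _ => zero_le) ?_
    rintro ⟨m, k⟩
    have h3 : eLpNorm (⇑(hmem m).toLp - ⇑(hmem k).toLp) 1 (faceMeasure P i) =
        eLpNorm (fun x => u m x - u k x) 1 (faceMeasure P i) :=
      eLpNorm_congr_ae ((hmem m).coeFn_toLp.sub (hmem k).coeFn_toLp)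
    have h4 := (hκ (fun x => u m x - u k x) ((huc1 m).sub (huc1 k))).2
    rw [coneDensity_sub P i (huc1 m) (huc1 k)] at h4
    refine h3.le.trans (h4.trans ?_)
    refine mul_le_mul' le_rfl ?_
    have h5 : (fun x => coneDensity P i (u m) (grad (u m)) x -
        coneDensity P i (u k) (grad (u k)) x) =
        (fun x => coneDensity P i (u m) (grad (u m)) x - coneDensity P i φ g x) -
        fun x => coneDensity P i (u k) (grad (u k)) x - coneDensity P i φ g x := by
      funext x; simp
    have hm : ∀ m, AEStronglyMeasurable (fun x => coneDensity P i (u m) (grad (u m)) x -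
        coneDensity P i φ g x) (volume.restrict (simplex P)) := fun m =>
      (continuous_coneDensity P i (huc1 m)).aestronglyMeasurable.sub hwm
    rw [h5]
    exact eLpNorm_sub_le (hm m) (hm k) le_rfl
  obtain ⟨f, hf⟩ := cauchySeq_tendsto_of_complete hcauchy
  refine ⟨f, Lp.memLp f, u, huc, hu0, fun l => ?_, ?_⟩
  · refine (hug l).congr fun m => eLpNorm_congr_ae ?_
    filter_upwards [(hw l).weakPartial_ae_eq isOpen_interior] with x hx
    rw [hx]
  · rw [Lp.tendsto_Lp_iff_tendsto_eLpNorm'] at hf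
    refine hf.congr fun m => eLpNorm_congr_ae ?_
    filter_upwards [(hmem m).coeFn_toLp] with x hx
    simp [hx]

/-- The mean of the trace over a face is determined by the weak gradient on the simplex. -/
lemma faceMean_eq {φ : E (n + 1) → ℝ} {g : Fin (n + 1) → E (n + 1) → ℝ}
    (hφ : MemLp φ 1 (volume.restrict (interior (simplex P))))
    (hg : ∀ l, MemLp (g l) 1 (volume.restrict (interior (simplex P))))
    (hw : ∀ l, HasWeakPartial (interior (simplex P)) l φ (g l)) :
    faceMean P i φ = 1 / (n + 1) * ∫ x, coneDensity P i φ g x ∂(simplexMeasure P) := by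
  have hex := exists_isFaceTrace P i hφ hg hw
  have htr : IsFaceTrace P i φ (faceTrace P i φ) := by
    rw [faceTrace, dif_pos hex]; exact hex.choose_spec
  -- The approximating sequence is the one attached to the chosen trace, so no uniqueness of traces
  -- is needed: the integral is identified for whichever trace was chosen.
  obtain ⟨hf, u, huc, hu0, hug, huf⟩ := htr
  obtain ⟨κ, hκ0, hκt, hκ⟩ := exists_face_integral_eq P i
  have huc1 : ∀ m, ContDiff ℝ 1 (u m) := fun m => (huc m).of_le (by simp)
  replace hug : ∀ l, Tendsto (fun m => eLpNorm (fun x => fderiv ℝ (u m) x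
      (EuclideanSpace.single l 1) - g l x) 1 (volume.restrict (interior (simplex P))))
      atTop (𝓝 0) := by
    intro l
    refine (hug l).congr fun m => eLpNorm_congr_ae ?_
    filter_upwards [(hw l).weakPartial_ae_eq isOpen_interior] with x hx
    rw [hx]
  rw [restrict_interior_simplex] at hu0 hφ
  simp only [restrict_interior_simplex] at hug hg
  have hlim := tendsto_coneDensity P i huc1 hφ.1 (fun l => (hg l).1) hu0 hug
  have hwi : AEStronglyMeasurable (coneDensity P i φ g) (volume.restrict (simplex P)) := by
    refine (hφ.1.const_mul _).add (Finset.aestronglyMeasurable_fun_sum _ fun l _ => ?_)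
    exact (Continuous.aestronglyMeasurable (by fun_prop)).mul (hg l).1
  have t1 : Tendsto (fun m => ∫ x, u m x ∂(faceMeasure P i)) atTop
      (𝓝 (∫ x, faceTrace P i φ x ∂(faceMeasure P i))) := by
    refine tendsto_integral_of_L1' _ hf.1 (Eventually.of_forall fun m => ?_) huf
    exact integrable_faceMeasure P i (huc m).continuous
  have t2 : Tendsto (fun m => ∫ x in simplex P, coneDensity P i (u m) (grad (u m)) x) atTop
      (𝓝 (∫ x in simplex P, coneDensity P i φ g x)) :=
    tendsto_integral_of_L1' _ hwi (Eventually.of_forall fun m =>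
      (continuous_coneDensity P i (huc1 m)).continuousOn.integrableOn_compact
        (isCompact_simplex P)) hlim
  have h1 : ∫ x, faceTrace P i φ x ∂(faceMeasure P i) =
      κ.toReal * ∫ x in simplex P, coneDensity P i φ g x := by
    refine tendsto_nhds_unique t1 ((t2.const_mul κ.toReal).congr fun m => ?_)
    exact (hκ (u m) (huc1 m)).1.symm
  -- The constant function calibrates `κ`: the measure of the face is `κ (n + 1) |T|`, so `κ` drops
  -- out of the mean.
  have h2 := (hκ (fun _ => 1) contDiff_const).1
  have h3 : coneDensity P i (fun _ => 1) (grad fun _ => 1) = fun _ => (n : ℝ) + 1 := by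
    funext x; rw [coneDensity_grad]; simp
  rw [h3] at h2
  simp only [integral_const, smul_eq_mul, mul_one, measureReal_restrict_apply_univ] at h2
  have hV : volume.real (simplex P) ≠ 0 :=
    (ENNReal.toReal_pos (volume_simplex_ne_zero P) (volume_simplex_ne_top P)).ne'
  have hκr : κ.toReal ≠ 0 := (ENNReal.toReal_pos hκ0 hκt).ne'
  have hn : (n : ℝ) + 1 ≠ 0 := by positivity
  rw [faceMean, h1, h2, simplexMeasure_eq, integral_smul_measure, ENNReal.toReal_inv,
    show (volume (simplex P)).toReal = volume.real (simplex P) from rfl, smul_eq_mul]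
  field_simp

end Traces

/-! ### The gradient of the interpolant. -/

section Interpolant

variable {n : ℕ} (P : AffineBasis (Fin (n + 2)) ℝ (E (n + 1)))

lemma coord_eq_linear_add (i : Fin (n + 2)) (x : E (n + 1)) :
    P.coord i x = (P.coord i).linear.toContinuousLinearMap x + P.coord i 0 := by
  have := congrFun (P.coord i).decomp x
  simpa using this

/-- The barycentric coordinates have constant sum, so their linear parts cancel. -/
lemma sum_coord_linear (w : E (n + 1)) :
    ∑ i, (P.coord i).linear.toContinuousLinearMap w = 0 := by
  have h := fun i => eq_sub_of_add_eq (coord_eq_linear_add P i w).symm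
  simp only [h, Finset.sum_sub_distrib, P.sum_coord_apply_eq_one, sub_self]

/-- The linear part of the identity `x = ∑ λᵢ(x) pᵢ`. -/
lemma sum_coord_linear_mul (w : E (n + 1)) (l : Fin (n + 1)) :
    ∑ i, (P.coord i).linear.toContinuousLinearMap w * P i l = w l := by
  have h := fun i => eq_sub_of_add_eq (coord_eq_linear_add P i w).symm
  have h1 : ∀ x : E (n + 1), ∑ i, P.coord i x * P i l = x l := by
    intro x
    have := congrArg (fun z : E (n + 1) => z l) (P.linear_combination_coord_eq_self x)
    simpa [-AffineBasis.linear_combination_coord_eq_self] using this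
  simp only [h, sub_mul, Finset.sum_sub_distrib, h1]
  simp

lemma hasFDerivAt_crInterp (φ : E (n + 1) → ℝ) (x : E (n + 1)) :
    HasFDerivAt (crInterp P φ) (∑ i, faceMean P i φ •
      (((n + 1 : ℕ) : ℝ) • -(P.coord i).linear.toContinuousLinearMap)) x := by
  refine HasFDerivAt.fun_sum fun i _ => ?_
  have h : (fun x => faceMean P i φ * crBasis P i x) = fun x => faceMean P i φ *
      (((n + 1 : ℕ) : ℝ) * (1 / ((n + 1 : ℕ) : ℝ) -
        ((P.coord i).linear.toContinuousLinearMap x + P.coord i 0))) := by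
    funext x
    rw [crBasis, coord_eq_linear_add]
  rw [h]
  exact (((((P.coord i).linear.toContinuousLinearMap.hasFDerivAt).add_const _).const_sub _).const_mul
    _).const_mul _

lemma contDiff_crInterp (φ : E (n + 1) → ℝ) : ContDiff ℝ 1 (crInterp P φ) := by
  rw [contDiff_one_iff_fderiv]
  refine ⟨fun x => (hasFDerivAt_crInterp P φ x).differentiableAt, ?_⟩
  rw [show fderiv ℝ (crInterp P φ) = fun _ => _ from
    funext fun x => (hasFDerivAt_crInterp P φ x).fderiv]
  exact continuous_const

/-- The gradient of the interpolant is the mean of the gradient. -/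
lemma fderiv_crInterp {φ : E (n + 1) → ℝ} {g : Fin (n + 1) → E (n + 1) → ℝ}
    (hφ : MemLp φ 1 (volume.restrict (interior (simplex P))))
    (hg : ∀ l, MemLp (g l) 1 (volume.restrict (interior (simplex P))))
    (hw : ∀ l, HasWeakPartial (interior (simplex P)) l φ (g l)) (x : E (n + 1))
    (j : Fin (n + 1)) :
    fderiv ℝ (crInterp P φ) x (EuclideanSpace.single j 1) = ∫ y, g j y ∂(simplexMeasure P) := by
  set ν := simplexMeasure P with hν
  have hφν : Integrable φ ν := (memLp_simplexMeasure hφ).integrable le_rfl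
  have hgν : ∀ l, Integrable (g l) ν := fun l => (memLp_simplexMeasure (hg l)).integrable le_rfl
  have hxg : ∀ l, Integrable (fun y : E (n + 1) => y l * g l y) ν := by
    intro l
    obtain ⟨K, hK⟩ := (isCompact_simplex P).exists_bound_of_continuousOn
      (f := fun x : E (n + 1) => x l) (by fun_prop)
    refine (hgν l).bdd_mul (c := K) (Continuous.aestronglyMeasurable (by fun_prop)) ?_
    filter_upwards [ae_simplexMeasure_mem P] with x hx
    exact hK x hx
  -- The part of `(n + 1) * faceMean` that does not depend on the vertex. What remains is affine in
  -- `P i`, with the mean gradient as its slope.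
  set a := ∫ y, ((n + 1) * φ y + ∑ l, y l * g l y) ∂ν with ha
  have hn : (n : ℝ) + 1 ≠ 0 := by positivity
  have hmean : ∀ i, ((n : ℝ) + 1) * faceMean P i φ = a - ∑ l, P i l * ∫ y, g l y ∂ν := by
    intro i
    rw [faceMean_eq P i hφ hg hw, ← mul_assoc, mul_one_div_cancel hn, one_mul, ha]
    have e : coneDensity P i φ g = fun y => ((n + 1) * φ y + ∑ l, y l * g l y) -
        ∑ l, P i l * g l y := by
      funext y
      simp only [coneDensity, PiLp.sub_apply, sub_mul, Finset.sum_sub_distrib]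
      ring
    have i1 : Integrable (fun y => ((n : ℝ) + 1) * φ y + ∑ l, y l * g l y) ν :=
      (hφν.const_mul _).add (integrable_finsetSum _ fun l _ => hxg l)
    rw [e, integral_sub i1 (integrable_finsetSum _ fun l _ => (hgν l).const_mul _),
      integral_finsetSum _ fun l _ => (hgν l).const_mul _]
    simp only [integral_const_mul]
  rw [(hasFDerivAt_crInterp P φ x).fderiv]
  set w : E (n + 1) := EuclideanSpace.single j 1 with hw'
  set L : Fin (n + 2) → ℝ := fun i => (P.coord i).linear.toContinuousLinearMap w with hL
  have h1 : ∑ i, L i = 0 := sum_coord_linear P w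
  have h2 : ∀ l, ∑ i, L i * P i l = w l := sum_coord_linear_mul P w
  calc _ = -∑ i, (((n : ℝ) + 1) * faceMean P i φ) * L i := by
        rw [sum_apply, ← Finset.sum_neg_distrib]
        refine Finset.sum_congr rfl fun i _ => ?_
        change faceMean P i φ * (((n + 1 : ℕ) : ℝ) * -L i) = _
        push_cast
        ring
    -- The common part `a` is killed because the `L i` sum to zero; the rest reproduces `w`, hence
    -- the mean of `g j`.
    _ = -(a * ∑ i, L i) + ∑ l, (∑ i, L i * P i l) * ∫ y, g l y ∂ν := by
        simp only [hmean, sub_mul, Finset.sum_sub_distrib, Finset.mul_sum, Finset.sum_mul]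
        rw [Finset.sum_comm (f := fun i l => P i l * (∫ y, g l y ∂ν) * L i), neg_sub,
          sub_eq_neg_add]
        congr 1
        exact Finset.sum_congr rfl fun l _ => Finset.sum_congr rfl fun i _ => by ring
    _ = _ := by
        simp [h1, h2, hw']

end Interpolant

/-! ### The anisotropic error estimate. -/

section ErrorEstimate

variable {d : ℕ}

/-- Undoing the normalization turns the factors `|T|^(-1/q)` and `|T|^(-1/p)` into the power of the
volume. Finiteness of the right-hand side gives membership in `L^q`, that is, the Sobolev embedding.
-/
lemma exists_memLp_sub_mean (hd : 2 ≤ d) {p q : ℝ} (hp : 1 ≤ p) (hq : 1 ≤ q)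
    (hpq : 1 / p - 1 / d ≤ 1 / q) :
    ∃ C : ℝ, 0 ≤ C ∧ ∀ P : AffineBasis (Fin (d + 1)) ℝ (E d), ∀ v : E d → ℝ,
      ∀ g : Fin d → E d → ℝ,
      MemLp v (ENNReal.ofReal p) (volume.restrict (interior (simplex P))) →
      (∀ l, MemLp (g l) (ENNReal.ofReal p) (volume.restrict (interior (simplex P)))) →
      (∀ l, HasWeakPartial (interior (simplex P)) l v (g l)) →
      MemLp (fun x => v x - ∫ y, v y ∂(simplexMeasure P)) (ENNReal.ofReal q)
        (volume.restrict (interior (simplex P))) ∧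
      (eLpNorm (fun x => v x - ∫ y, v y ∂(simplexMeasure P)) (ENNReal.ofReal q)
        (volume.restrict (interior (simplex P)))).toReal ≤
        C * volume.real (simplex P) ^ (1 / q - 1 / p) * ∑ k : Fin d,
          (eLpNorm (fun x => ∑ l, (P k.succ - P 0) l * g l x) (ENNReal.ofReal p)
            (volume.restrict (interior (simplex P)))).toReal := by
  obtain ⟨C, hC, h⟩ := exists_weak_sobolev_poincare hd hp hq hpq
  refine ⟨C.toReal, ENNReal.toReal_nonneg, fun P v g hv hg hw => ?_⟩
  have key := h P v g hv hg hw
  simp only [eLpNorm_simplexMeasure P _ hp, eLpNorm_simplexMeasure P _ hq] at key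
  set Ω := interior (simplex P) with hΩ
  set V := volume (simplex P) with hV
  have hV0 : V⁻¹ ≠ 0 := ENNReal.inv_ne_zero.2 (volume_simplex_ne_top P)
  have hVt : V⁻¹ ≠ ⊤ := ENNReal.inv_ne_top.2 (volume_simplex_ne_zero P)
  have hgk : ∀ k : Fin d, MemLp (fun x => ∑ l, (P k.succ - P 0) l * g l x) (ENNReal.ofReal p)
      (volume.restrict Ω) := fun k => memLp_finsetSum _ fun l _ => (hg l).const_mul _
  have hfin : C * ∑ k : Fin d, V⁻¹ ^ (1 / p) * eLpNorm (fun x => ∑ l, (P k.succ - P 0) l * g l x)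
      (ENNReal.ofReal p) (volume.restrict Ω) ≠ ⊤ := by
    refine ENNReal.mul_ne_top hC (ENNReal.sum_ne_top.2 fun k _ => ENNReal.mul_ne_top ?_ (hgk k).2.ne)
    exact ENNReal.rpow_ne_top_of_nonneg (by positivity) hVt
  have hq0 : V⁻¹ ^ (1 / q) ≠ 0 := by simp [ENNReal.rpow_eq_zero_iff, hV0, hVt]
  refine ⟨⟨hv.1.sub aestronglyMeasurable_const, ?_⟩, ?_⟩
  · rw [lt_top_iff_ne_top]
    intro htop
    rw [htop, ENNReal.mul_top hq0, top_le_iff] at key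
    exact hfin key
  · have key2 := ENNReal.toReal_mono hfin key
    rw [ENNReal.toReal_mul, ENNReal.toReal_mul, ENNReal.toReal_sum fun k _ =>
      ENNReal.mul_ne_top (ENNReal.rpow_ne_top_of_nonneg (by positivity) hVt) (hgk k).2.ne] at key2
    simp only [ENNReal.toReal_mul, ← ENNReal.toReal_rpow, ENNReal.toReal_inv,
      ← Finset.mul_sum] at key2
    have hVr : 0 < V.toReal :=
      ENNReal.toReal_pos (volume_simplex_ne_zero P) (volume_simplex_ne_top P)
    rw [Real.inv_rpow hVr.le, Real.inv_rpow hVr.le] at key2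
    have hq1 : 0 < V.toReal ^ (1 / q) := Real.rpow_pos_of_pos hVr _
    rw [inv_mul_le_iff₀ hq1] at key2
    refine key2.trans (le_of_eq ?_)
    rw [show volume.real (simplex P) = V.toReal from rfl, Real.rpow_sub hVr]
    ring

/-- The anisotropic interpolation error estimate for directions that generate the edges. -/
theorem exists_crInterp_estimate {n : ℕ} (hn : 1 ≤ n) {p q : ℝ} (hp : 1 ≤ p) (hq : 1 ≤ q)
    (hpq : 1 / p - 1 / ((n + 1 : ℕ) : ℝ) ≤ 1 / q) :
    ∃ C : ℝ, 0 < C ∧ ∀ (P : AffineBasis (Fin (n + 2)) ℝ (E (n + 1))) (φ : E (n + 1) → ℝ),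
      MemSobolev (interior (simplex P)) p 2 φ →
      MemSobolev (interior (simplex P)) q 1 (crInterp P φ - φ) ∧
      ∀ (h : Fin (n + 1) → ℝ) (r : Fin (n + 1) → E (n + 1))
        (a : Fin (n + 1) → Fin (n + 1) → ℝ) (K : ℝ), (∀ i, 0 ≤ h i) → (∀ k i, |a k i| ≤ K) →
        (∀ k : Fin (n + 1), P k.succ - P 0 = ∑ i, (a k i * h i) • r i) →
        sobolevSeminorm (interior (simplex P)) q (crInterp P φ - φ) ≤
          C * K * edgeBound P p q h r φ := by
  obtain ⟨C, hC, hmain⟩ := exists_memLp_sub_mean (d := n + 1) (by omega) hp hq hpq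
  -- One factor `n + 1` counts the components of the gradient, the other the edges; `C + 1` ensures
  -- strict positivity.
  refine ⟨(C + 1) * ((n : ℝ) + 1) ^ 2, by positivity, fun P φ hφ => ?_⟩
  set Ω := interior (simplex P) with hΩ
  obtain ⟨hφp, hex⟩ := hφ
  choose g hg hgp hgh using hex
  choose h2 hh2 hh2p using hgh
  have hΩo : IsOpen Ω := isOpen_interior
  have hΩfin : IsFiniteMeasure (volume.restrict Ω) := ⟨by
    rw [Measure.restrict_apply_univ]
    exact (measure_mono interior_subset).trans_lt (volume_simplex_ne_top P).lt_top⟩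
  have hp1 : 1 ≤ ENNReal.ofReal p := by simpa using hp
  have hφ1 := hφp.mono_exponent hp1
  have hg1 := fun l => (hgp l).mono_exponent hp1
  set m : Fin (n + 1) → ℝ := fun j => ∫ y, g j y ∂(simplexMeasure P) with hm
  -- The reduction: the gradient of the interpolant is the mean `m`, so the error has weak
  -- derivatives `m j - g j`.
  have hwe : ∀ j, HasWeakPartial Ω j (crInterp P φ - φ) (fun x => m j - g j x) := by
    intro j
    have h1 := hasWeakPartial_of_contDiff (Ω := Ω) (contDiff_crInterp P φ) j
    simp only [fderiv_crInterp P hφ1 hg1 hg] at h1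
    exact h1.sub (hg j)
  have hneg : ∀ j, (fun x => m j - g j x) = -fun x => g j x - m j := by
    intro j; funext x; simp
  have hgj := fun j => hmain P (g j) (h2 j) (hgp j) (hh2p j) (hh2 j)
  have hweq : ∀ j, MemLp (fun x => m j - g j x) (ENNReal.ofReal q) (volume.restrict Ω) := by
    intro j
    rw [hneg]
    exact (hgj j).1.neg
  have hφq := (hmain P φ g hφp hgp hg).1
  have hcr : MemLp (crInterp P φ) (ENNReal.ofReal q) (volume.restrict Ω) := by
    have hc := (contDiff_crInterp P φ).continuous
    obtain ⟨K, hK⟩ := (isCompact_simplex P).exists_bound_of_continuousOn hc.continuousOn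
    refine MemLp.of_bound hc.aestronglyMeasurable K ?_
    filter_upwards [ae_restrict_mem hΩo.measurableSet] with x hx
    exact hK x (interior_subset hx)
  refine ⟨⟨?_, fun j => ⟨_, hwe j, hweq j⟩⟩, fun h r a K hh ha hedge => ?_⟩
  · have e : crInterp P φ - φ = (crInterp P φ - fun _ => ∫ y, φ y ∂(simplexMeasure P)) -
        fun x => φ x - ∫ y, φ y ∂(simplexMeasure P) := by
      funext x; simp
    rw [e]
    exact (hcr.sub (memLp_const _)).sub hφq
  · have hK : 0 ≤ K := (abs_nonneg _).trans (ha 0 0)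
    set S : Fin (n + 1) → ℝ := fun i => sobolevSeminorm Ω p (dirDeriv Ω (r i) φ) with hS
    set V := volume.real (simplex P) ^ (1 / q - 1 / p) with hV
    have hV0 : 0 ≤ V := Real.rpow_nonneg measureReal_nonneg _
    -- Sobolev–Poincaré for `∂ⱼφ` yields `∂ᵣ∂ⱼφ`, while the right-hand side of the estimate contains
    -- `∂ⱼ∂ᵣφ`; `HasWeakPartial.comm` identifies them.
    have hdir : ∀ j i, (eLpNorm (fun x => ∑ l, r i l * h2 j l x) (ENNReal.ofReal p)
        (volume.restrict Ω)).toReal ≤ S i := by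
      intro j i
      exact eLpNorm_le_sobolevSeminorm hΩo hp (g := fun j x => ∑ l, r i l * h2 j l x)
        (fun j => hasWeakPartial_dirDeriv (h := fun l j => h2 j l) hΩo hg
          (fun l j => (hg j).comm (hg l) (hh2 j l)) (r i) j)
        (fun j => memLp_finsetSum _ fun l _ => (hh2p j l).const_mul _) j
    have hk : ∀ j (k : Fin (n + 1)), (eLpNorm (fun x => ∑ l, (P k.succ - P 0) l * h2 j l x) (ENNReal.ofReal p)
        (volume.restrict Ω)).toReal ≤ K * ∑ i, h i * S i := by
      intro j k
      have e : (fun x => ∑ l, (P k.succ - P 0) l * h2 j l x) =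
          ∑ i, (a k i * h i) • fun x => ∑ l, r i l * h2 j l x := by
        funext x
        rw [hedge k]
        simp only [WithLp.ofLp_sum, WithLp.ofLp_smul, Finset.sum_apply, Pi.smul_apply, smul_eq_mul,
          Finset.sum_mul, Finset.mul_sum]
        rw [Finset.sum_comm]
        exact Finset.sum_congr rfl fun i _ => Finset.sum_congr rfl fun l _ => by ring
      have hmem : ∀ i, MemLp (fun x => ∑ l, r i l * h2 j l x) (ENNReal.ofReal p)
        (volume.restrict Ω) := fun i => memLp_finsetSum _ fun l _ => (hh2p j l).const_mul _
      have h3 : eLpNorm (fun x => ∑ l, (P k.succ - P 0) l * h2 j l x) (ENNReal.ofReal p)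
          (volume.restrict Ω) ≤ ∑ i, ‖a k i * h i‖ₑ * eLpNorm (fun x => ∑ l, r i l * h2 j l x)
            (ENNReal.ofReal p) (volume.restrict Ω) := by
        rw [e]
        refine (eLpNorm_sum_le (fun i _ => ((hmem i).1.const_smul _)) hp1).trans ?_
        exact Finset.sum_le_sum fun i _ => (eLpNorm_const_smul _ _ _ _).le
      have h4 : ∀ i, ‖a k i * h i‖ₑ * eLpNorm (fun x => ∑ l, r i l * h2 j l x)
            (ENNReal.ofReal p) (volume.restrict Ω) ≠ ⊤ := fun i =>
        ENNReal.mul_ne_top enorm_ne_top (hmem i).2.ne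
      refine (ENNReal.toReal_mono (ENNReal.sum_ne_top.2 fun i _ => h4 i) h3).trans ?_
      rw [ENNReal.toReal_sum fun i _ => h4 i, Finset.mul_sum]
      refine Finset.sum_le_sum fun i _ => ?_
      rw [ENNReal.toReal_mul, toReal_enorm, norm_mul, Real.norm_of_nonneg (hh i), mul_assoc]
      exact mul_le_mul (ha k i) (mul_le_mul_of_nonneg_left (hdir j i) (hh i))
        (mul_nonneg (hh i) ENNReal.toReal_nonneg) hK
    have hsum : 0 ≤ ∑ i, h i * S i :=
      Finset.sum_nonneg fun i _ => mul_nonneg (hh i) sobolevSeminorm_nonneg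
    have hj : ∀ j, (eLpNorm (fun x => m j - g j x) (ENNReal.ofReal q)
        (volume.restrict Ω)).toReal ≤ C * V * (((n : ℝ) + 1) * (K * ∑ i, h i * S i)) := by
      intro j
      rw [hneg, eLpNorm_neg]
      refine (hgj j).2.trans (mul_le_mul_of_nonneg_left ?_ (by positivity))
      refine (Finset.sum_le_sum fun k _ => hk j k).trans (le_of_eq ?_)
      simp
    calc sobolevSeminorm Ω q (crInterp P φ - φ)
        ≤ ∑ j, (eLpNorm (fun x => m j - g j x) (ENNReal.ofReal q)
          (volume.restrict Ω)).toReal := sobolevSeminorm_le_sum hΩo hq hwe hweq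
      _ ≤ ∑ _j : Fin (n + 1), C * V * (((n : ℝ) + 1) * (K * ∑ i, h i * S i)) :=
          Finset.sum_le_sum fun j _ => hj j
      _ = C * (((n : ℝ) + 1) ^ 2 * K * (V * ∑ i, h i * S i)) := by
          simp only [Finset.sum_const, Finset.card_univ, Fintype.card_fin, nsmul_eq_mul]
          push_cast
          ring
      _ ≤ (C + 1) * (((n : ℝ) + 1) ^ 2 * K * (V * ∑ i, h i * S i)) :=
          mul_le_mul_of_nonneg_right (by linarith) (by positivity)
      _ = _ := by
          rw [edgeBound]
          ring

end ErrorEstimate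

/-! ### The estimate in rotated coordinates. -/

section Rotated

variable {d : ℕ} {Ω : Set (E d)} {p : ℝ} {φ : E d → ℝ} (A : E d ≃ₗᵢ[ℝ] E d) (b : E d)

lemma euclidean_eq_sum_single (w : E d) : w = ∑ k, w k • EuclideanSpace.single k (1 : ℝ) := by
  ext j; simp [Pi.single_apply]

/-- Second derivatives in rotated coordinates. -/
lemma sobolevSeminorm_dirDeriv_le (hΩ : IsOpen Ω) (hp : 1 ≤ p) (hφ : MemSobolev Ω p 2 φ)
    (i : Fin d) :
    sobolevSeminorm Ω p (dirDeriv Ω (A (EuclideanSpace.single i 1)) φ) ≤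
      (d : ℝ) ^ 2 * sobolevSeminorm (rigidMap A b ⁻¹' Ω) p
        (weakPartial (rigidMap A b ⁻¹' Ω) i (φ ∘ rigidMap A b)) := by
  have hp1 : 1 ≤ ENNReal.ofReal p := by simpa using hp
  obtain ⟨-, hex⟩ := hφ
  choose g' hg' hgp' hgh' using hex
  choose h hh' hhp using hgh'
  have hg : ∀ l, HasWeakPartial Ω l φ (weakPartial Ω l φ) := fun l => (hg' l).weakPartial
  have hh : ∀ l j, HasWeakPartial Ω j (weakPartial Ω l φ) (h l j) := fun l j =>
    (hh' l j).congr ((hg' l).weakPartial_ae_eq hΩ).symm .rfl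
  set f := dirDeriv Ω (A (EuclideanSpace.single i 1)) φ with hf
  set Ω' := rigidMap A b ⁻¹' Ω with hΩ'
  have hc : Continuous (rigidMap A b) := (rigidEquiv A b).continuous
  have hΩo' : IsOpen Ω' := hΩ.preimage hc
  set F : Fin d → E d → ℝ := fun j x =>
    ∑ k, A (EuclideanSpace.single i 1) k * h k j x with hF
  have hfF : ∀ j, HasWeakPartial Ω j f (F j) := hasWeakPartial_dirDeriv hΩ hg hh _
  have hFp : ∀ j, MemLp (F j) (ENNReal.ofReal p) (volume.restrict Ω) := fun j =>
    memLp_finsetSum _ fun k _ => (hhp k j).const_mul _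
  set G : Fin d → E d → ℝ := fun k y =>
    ∑ j, A (EuclideanSpace.single k 1) j * F j y with hG
  have hGp : ∀ k, MemLp (G k) (ENNReal.ofReal p) (volume.restrict Ω) := fun k =>
    memLp_finsetSum _ fun j _ => (hFp j).const_mul _
  have hGn : ∀ k, eLpNorm (G k ∘ rigidMap A b) (ENNReal.ofReal p) (volume.restrict Ω') =
      eLpNorm (G k) (ENNReal.ofReal p) (volume.restrict Ω) := fun k =>
    eLpNorm_comp_rigidMap A b (hGp k).1
  have hGp' : ∀ k, MemLp (G k ∘ rigidMap A b) (ENNReal.ofReal p) (volume.restrict Ω') := by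
    intro k
    refine ⟨?_, by rw [hGn]; exact (hGp k).2⟩
    exact (hGp k).1.comp_measurePreserving ((rigidMap_measurePreserving A b).restrict_preimage_emb
      (rigidMap_measurableEmbedding A b) Ω)
  set W := weakPartial Ω' i (φ ∘ rigidMap A b) with hW
  have hWf : W =ᵐ[volume.restrict Ω'] f ∘ rigidMap A b :=
    (HasWeakPartial.comp_rigidMap A b hg i).weakPartial_ae_eq hΩo'
  have hWG : ∀ k, HasWeakPartial Ω' k W (G k ∘ rigidMap A b) := fun k =>
    (HasWeakPartial.comp_rigidMap A b hfF k).congr hWf.symm .rfl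
  have hGS : ∀ k, (eLpNorm (G k) (ENNReal.ofReal p) (volume.restrict Ω)).toReal ≤
      sobolevSeminorm Ω' p W := by
    intro k
    rw [← hGn]
    exact eLpNorm_le_sobolevSeminorm hΩo' hp hWG hGp' k
  -- The functions `G k` are the rotated components of the vector `F`; the inverse rotation recovers
  -- `F`. Its matrix entries are at most 1 in modulus, so one sum over `k` and one over `j` account
  -- for the factor `d ^ 2`.
  have hFG : ∀ j, F j = ∑ k, A.symm (EuclideanSpace.single j 1) k • G k := by
    intro j
    funext x
    have e : ∀ l, ∑ k, A.symm (EuclideanSpace.single j 1) k * A (EuclideanSpace.single k 1) l =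
        EuclideanSpace.single (𝕜 := ℝ) j 1 l := by
      intro l
      have h1 := congrArg (fun z => A z l)
        (euclidean_eq_sum_single (A.symm (EuclideanSpace.single j 1)))
      simp only [LinearIsometryEquiv.apply_symm_apply, map_sum, map_smul] at h1
      rw [h1]
      simp
    simp only [Finset.sum_apply, Pi.smul_apply, smul_eq_mul, hG, Finset.mul_sum]
    rw [Finset.sum_comm]
    simp only [← mul_assoc, ← Finset.sum_mul, e]
    simp
  have hcoef : ∀ j k, ‖A.symm (EuclideanSpace.single j 1) k‖ ≤ 1 := by
    intro j k
    refine (PiLp.norm_apply_le _ k).trans ?_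
    simp
  have hS : 0 ≤ sobolevSeminorm Ω' p W := sobolevSeminorm_nonneg
  have hFS : ∀ j, (eLpNorm (F j) (ENNReal.ofReal p) (volume.restrict Ω)).toReal ≤
      d * sobolevSeminorm Ω' p W := by
    intro j
    have h1 : eLpNorm (F j) (ENNReal.ofReal p) (volume.restrict Ω) ≤
        ∑ k, ‖A.symm (EuclideanSpace.single j 1) k‖ₑ *
          eLpNorm (G k) (ENNReal.ofReal p) (volume.restrict Ω) := by
      rw [hFG]
      refine (eLpNorm_sum_le (fun k _ => (hGp k).1.const_smul _) hp1).trans ?_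
      exact Finset.sum_le_sum fun k _ => (eLpNorm_const_smul _ _ _ _).le
    have h2 : ∀ k, ‖A.symm (EuclideanSpace.single j 1) k‖ₑ *
        eLpNorm (G k) (ENNReal.ofReal p) (volume.restrict Ω) ≠ ⊤ := fun k =>
      ENNReal.mul_ne_top enorm_ne_top (hGp k).2.ne
    refine (ENNReal.toReal_mono (ENNReal.sum_ne_top.2 fun k _ => h2 k) h1).trans ?_
    rw [ENNReal.toReal_sum fun k _ => h2 k]
    calc _ ≤ ∑ _k : Fin d, 1 * sobolevSeminorm Ω' p W := by
          refine Finset.sum_le_sum fun k _ => ?_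
          rw [ENNReal.toReal_mul, toReal_enorm]
          exact mul_le_mul (hcoef j k) (hGS k) ENNReal.toReal_nonneg zero_le_one
      _ = _ := by simp
  calc sobolevSeminorm Ω p f
      ≤ ∑ j, (eLpNorm (F j) (ENNReal.ofReal p) (volume.restrict Ω)).toReal :=
        sobolevSeminorm_le_sum hΩ hp hfF hFp
    _ ≤ ∑ _j : Fin d, d * sobolevSeminorm Ω' p W := Finset.sum_le_sum fun j _ => hFS j
    _ = _ := by simp; ring

lemma edgeBound_le_rotatedBound (P : AffineBasis (Fin (d + 1)) ℝ (E d)) {q : ℝ} (hp : 1 ≤ p)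
    (hφ : MemSobolev (interior (simplex P)) p 2 φ) {H : Fin d → ℝ} (hH : ∀ i, 0 ≤ H i) :
    edgeBound P p q H (fun i => A (EuclideanSpace.single i 1)) φ ≤
      (d : ℝ) ^ 2 * rotatedBound P p q H (rigidMap A b) φ := by
  rw [edgeBound, rotatedBound, rigidMap_preimage_interior, mul_left_comm]
  refine mul_le_mul_of_nonneg_left ?_ (Real.rpow_nonneg measureReal_nonneg _)
  rw [Finset.mul_sum]
  refine Finset.sum_le_sum fun i _ => ?_
  rw [mul_left_comm]
  exact mul_le_mul_of_nonneg_left (sobolevSeminorm_dirDeriv_le A b isOpen_interior hp hφ i) (hH i)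

/-- The anisotropic interpolation error estimate in rotated coordinates. -/
theorem exists_crInterp_rotated_estimate {n : ℕ} (hn : 1 ≤ n) {p q : ℝ} (hp : 1 ≤ p) (hq : 1 ≤ q)
    (hpq : 1 / p - 1 / ((n + 1 : ℕ) : ℝ) ≤ 1 / q) :
    ∃ C : ℝ, 0 < C ∧ ∀ (P : AffineBasis (Fin (n + 2)) ℝ (E (n + 1))) (φ : E (n + 1) → ℝ),
      MemSobolev (interior (simplex P)) p 2 φ →
      ∀ (A : E (n + 1) ≃ₗᵢ[ℝ] E (n + 1)) (b : E (n + 1)) (v : Fin (n + 2) → E (n + 1))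
        (H : Fin (n + 1) → ℝ) (K : ℝ), (∀ i, P i = rigidMap A b (v i)) → (∀ i, 0 < H i) →
        (∀ (k : Fin (n + 1)) i, |(v k.succ - v 0) i| ≤ K * H i) →
        sobolevSeminorm (interior (simplex P)) q (crInterp P φ - φ) ≤
          C * K * rotatedBound P p q H (rigidMap A b) φ := by
  obtain ⟨C, hC, h⟩ := exists_crInterp_estimate hn hp hq hpq
  refine ⟨C * ((n + 1 : ℕ) : ℝ) ^ 2, by positivity, fun P φ hφ A b v H K hP hH hv => ?_⟩
  have hK : 0 ≤ K := by
    have := (abs_nonneg _).trans (hv 0 0)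
    exact nonneg_of_mul_nonneg_left this (hH 0)
  -- The directions are the rotated coordinate axes, and the coefficients are the components of the
  -- edges in standard position relative to `H`.
  have h1 := (h P φ hφ).2 H (fun i => A (EuclideanSpace.single i 1))
    (fun k i => (v k.succ - v 0) i / H i) K (fun i => (hH i).le) (fun k i => by
      rw [abs_div, abs_of_pos (hH i), div_le_iff₀ (hH i)]
      exact hv k i) (fun k => by
      have e : P k.succ - P 0 = A (v k.succ - v 0) := by
        rw [hP, hP, rigidMap, rigidMap, map_sub]; abel
      rw [e]
      conv_lhs => rw [euclidean_eq_sum_single (v k.succ - v 0)]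
      rw [map_sum]
      refine Finset.sum_congr rfl fun i _ => ?_
      rw [map_smul, div_mul_cancel₀ _ (hH i).ne'])
  refine h1.trans ?_
  calc _ ≤ C * K * (((n + 1 : ℕ) : ℝ) ^ 2 * rotatedBound P p q H (rigidMap A b) φ) :=
        mul_le_mul_of_nonneg_left (edgeBound_le_rotatedBound A b P hp hφ fun i => (hH i).le)
          (by positivity)
    _ = _ := by ring

end Rotated

/-! ### Edge vectors of labelled triangles and tetrahedra. -/

section Geometry

lemma dist_smul_unitVec {d : ℕ} (x y : E d) : dist x y • unitVec x y = y - x := by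
  rw [unitVec, smul_smul, dist_comm, dist_eq_norm]
  rcases eq_or_ne (y - x) 0 with h | h
  · rw [h, smul_zero]
  · rw [mul_one_div_cancel (norm_ne_zero_iff.2 h), one_smul]

lemma dist_rigidMap {d : ℕ} (A : E d ≃ₗᵢ[ℝ] E d) (b x y : E d) :
    dist (rigidMap A b x) (rigidMap A b y) = dist x y := (rigidEquiv A b).dist_eq x y

lemma tri_edges (P : Fin 3 → E 2) (k : Fin 2) :
    P k.succ - P 0 = ∑ i, ((if i = k then 1 else 0) * triH P i) • triR P i := by
  fin_cases k <;> simp [triH, triR, dist_smul_unitVec]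

/-- The coefficients of the edges `P k.succ - P 0` in terms of the edges of the labelling. -/
def tetCoeff : TetType → Fin 3 → Fin 3 → ℝ
  | .one => ![![1, 0, 0], ![0, 1, 0], ![0, 0, 1]]
  | .two => ![![1, 0, 0], ![1, 1, 0], ![0, 0, 1]]

lemma abs_tetCoeff_le (τ : TetType) (k i : Fin 3) : |tetCoeff τ k i| ≤ 1 := by
  cases τ <;> fin_cases k <;> fin_cases i <;> simp [tetCoeff]

/-- In type (i) the three labelled edges all start at `p₁`. In type (ii) the second starts at `p₂`,
and `p₃ - p₁ = (p₂ - p₁) + (p₃ - p₂)`. -/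
lemma tet_edges (τ : TetType) (P : Fin 4 → E 3) (k : Fin 3) :
    P k.succ - P 0 = ∑ i, (tetCoeff τ k i * tetH τ P i) • tetR τ P i := by
  cases τ <;> fin_cases k <;>
    simp [Fin.sum_univ_three, tetCoeff, tetH, tetR, TetType.base, dist_smul_unitVec]

/-- The only entry needing the labelling is the off-diagonal one: `h₂ |s| ≤ h₂ ≤ h₁`. -/
lemma TriParam.abs_vertex_le {P : Fin 3 → E 2} (hP : TriLabelled P) (θ : TriParam)
    {A : E 2 ≃ₗᵢ[ℝ] E 2} {b : E 2} (h : ∀ i, P i = rigidMap A b (θ.vertex i)) (k : Fin 2)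
    (i : Fin 2) : |(θ.vertex k.succ - θ.vertex 0) i| ≤ 1 * θ.H i := by
  obtain ⟨h₁, h₂, s, t, hh1, hh2, hst, ht⟩ := θ
  have hle := hP.h_le
  simp only [h, dist_rigidMap] at hle
  have hs : |s| ≤ 1 := abs_le_one_iff_mul_self_le_one.2 (by nlinarith)
  have h21 : h₂ ≤ h₁ := by
    have e1 : dist (!₂[(0 : ℝ), 0] : E 2) !₂[h₁, 0] = h₁ := by
      rw [EuclideanSpace.dist_eq, Fin.sum_univ_two]
      simp [Real.dist_eq, hh1.le]
    have e2 : dist (!₂[(0 : ℝ), 0] : E 2) !₂[h₂ * s, h₂ * t] = h₂ := by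
      rw [EuclideanSpace.dist_eq, Fin.sum_univ_two]
      simp only [Real.dist_eq, sq_abs]
      rw [Real.sqrt_eq_iff_mul_self_eq_of_pos hh2]
      simp
      linear_combination (-h₂ ^ 2) * hst
    simpa [TriParam.vertex, e1, e2] using hle
  have hs2 : h₂ * |s| ≤ h₁ := by nlinarith [abs_nonneg s]
  fin_cases k <;> fin_cases i <;>
    simp [TriParam.vertex, TriParam.H, abs_mul, abs_of_pos, hh1, hh2, ht, hs2,
      (mul_pos hh2 ht).le]

/-- The first components are controlled by `h₃ ≤ 2 h₁` and `h₂ s₁ ≤ h₁ / 2`. The second component of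
`p₄` is the one that requires the condition on `s₂₂`, which says `h₃ |s₂₂| ≤ M H̃₂`. -/
lemma TetParam.abs_vertex_le {τ : TetType} {P : Fin 4 → E 3} (hP : TetLabelled τ P) (θ : TetParam)
    {A : E 3 ≃ₗᵢ[ℝ] E 3} {b : E 3} (h : ∀ i, P i = rigidMap A b (θ.vertex τ i)) {M : ℝ}
    (hM : 0 < M) (hs : |θ.s₂₂| ≤ M * (θ.h₂ * θ.t₁ / θ.h₃)) (k : Fin 3) (i : Fin 3) :
    |(θ.vertex τ k.succ - θ.vertex τ 0) i| ≤ (M + 2) * θ.H i := by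
  -- In type (i) the edge `p₁p₄` is one of the four edges compared with `p₁p₂`; in type (ii) `p₂p₄`
  -- is, and the triangle inequality costs the factor 2.
  have h31 : dist (P 0) (P 3) ≤ 2 * dist (P 0) (P 1) := by
    have hl := (hP.longest 3 (by cases τ <;> decide) (by decide)).1
    cases τ with
    | one =>
      simp only [TetType.base] at hl
      linarith [dist_nonneg (x := P 0) (y := P 1)]
    | two =>
      simp only [TetType.base] at hl
      linarith [dist_triangle (P 0) (P 1) (P 3)]
  simp only [h, dist_rigidMap] at h31
  obtain ⟨h₁, h₂, h₃, s₁, t₁, s₂₁, s₂₂, t₂, hh1, hh2, hh3, hu1, hs1, ht1, hhs, hu2, ht2, hhs2⟩ := θ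
  simp only at hs
  have e1 : dist (!₂[(0 : ℝ), 0, 0] : E 3) !₂[h₁, 0, 0] = h₁ := by
    rw [EuclideanSpace.dist_eq, Fin.sum_univ_three]
    simp [Real.dist_eq, hh1.le]
  have e2 : dist (!₂[(0 : ℝ), 0, 0] : E 3) !₂[h₃ * s₂₁, h₃ * s₂₂, h₃ * t₂] = h₃ := by
    rw [EuclideanSpace.dist_eq, Fin.sum_univ_three]
    simp only [Real.dist_eq, sq_abs]
    rw [Real.sqrt_eq_iff_mul_self_eq_of_pos hh3]
    simp
    linear_combination (-h₃ ^ 2) * hu2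
  have h32 : h₃ ≤ 2 * h₁ := by simpa [TetParam.vertex, e1, e2] using h31
  have hs21 : |s₂₁| ≤ 1 := abs_le_one_iff_mul_self_le_one.2 (by nlinarith [sq_nonneg s₂₂])
  have b1 : h₃ * |s₂₁| ≤ (M + 2) * h₁ := by nlinarith [mul_pos hM hh1]
  have hH2 : 0 < h₂ * t₁ := mul_pos hh2 ht1
  have hH3 : 0 < h₃ * t₂ := mul_pos hh3 ht2
  have b2 : h₃ * |s₂₂| ≤ (M + 2) * (h₂ * t₁) := by
    rw [← mul_div_assoc, le_div_iff₀ hh3] at hs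
    nlinarith
  have b3 : h₂ * t₁ ≤ (M + 2) * (h₂ * t₁) := by nlinarith
  have b4 : h₃ * t₂ ≤ (M + 2) * (h₃ * t₂) := by nlinarith
  have b5 : h₁ ≤ (M + 2) * h₁ := by nlinarith
  have p12 : 0 < h₂ * s₁ := mul_pos hh2 hs1
  have b6 : |h₂ * s₁| ≤ (M + 2) * h₁ := by rw [abs_of_pos p12]; linarith
  have b7 : |h₁ - h₂ * s₁| ≤ (M + 2) * h₁ := by rw [abs_of_pos (by linarith)]; linarith
  have hM2 : 0 ≤ M + 2 := by linarith
  cases τ <;> fin_cases k <;> fin_cases i <;>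
    simp [TetParam.vertex, TetParam.H] <;>
    first
      | positivity
      | (simp only [abs_mul, abs_of_pos, hh1, hh2, hh3, ht1, ht2] at *; assumption)

end Geometry

end AnisoCR

theorem mainTheorem10 (p q : ℝ) (hp : 1 ≤ p) (hq : 1 ≤ q) :
    -- dimension two
    (1 - 2 / p ≥ -(2 / q) →
      (∃ c : ℝ, 0 < c ∧ ∀ P : AffineBasis (Fin 3) ℝ (E 2), TriLabelled P →
        ∀ φ : E 2 → ℝ, MemSobolev (interior (simplex P)) p 2 φ →
          MemSobolev (interior (simplex P)) q 1 (crInterp P φ - φ) ∧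
          sobolevSeminorm (interior (simplex P)) q (crInterp P φ - φ) ≤
            c * edgeBound P p q (triH P) (triR P) φ) ∧
      (∃ c : ℝ, 0 < c ∧ ∀ P : AffineBasis (Fin 3) ℝ (E 2), TriLabelled P →
        ∀ (θ : TriParam) (A : E 2 ≃ₗᵢ[ℝ] E 2) (b : E 2),
          (∀ i, P i = rigidMap A b (θ.vertex i)) →
        ∀ φ : E 2 → ℝ, MemSobolev (interior (simplex P)) p 2 φ →
          sobolevSeminorm (interior (simplex P)) q (crInterp P φ - φ) ≤
            c * rotatedBound P p q θ.H (rigidMap A b) φ)) ∧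
    -- dimension three
    (1 - 3 / p ≥ -(3 / q) →
      (∃ c : ℝ, 0 < c ∧ ∀ (τ : TetType) (P : AffineBasis (Fin 4) ℝ (E 3)), TetLabelled τ P →
        ∀ φ : E 3 → ℝ, MemSobolev (interior (simplex P)) p 2 φ →
          MemSobolev (interior (simplex P)) q 1 (crInterp P φ - φ) ∧
          sobolevSeminorm (interior (simplex P)) q (crInterp P φ - φ) ≤
            c * edgeBound P p q (tetH τ P) (tetR τ P) φ) ∧
      (∀ M : ℝ, 0 < M → ∃ c : ℝ, 0 < c ∧
        ∀ (τ : TetType) (P : AffineBasis (Fin 4) ℝ (E 3)), TetLabelled τ P →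
        ∀ (θ : TetParam) (A : E 3 ≃ₗᵢ[ℝ] E 3) (b : E 3),
          (∀ i, P i = rigidMap A b (θ.vertex τ i)) →
          |θ.s₂₂| ≤ M * (θ.h₂ * θ.t₁ / θ.h₃) →
        ∀ φ : E 3 → ℝ, MemSobolev (interior (simplex P)) p 2 φ →
          sobolevSeminorm (interior (simplex P)) q (crInterp P φ - φ) ≤
            c * rotatedBound P p q θ.H (rigidMap A b) φ)) := by
  refine ⟨fun hpq => ?_, fun hpq => ?_⟩
  -- The embedding condition divided by the dimension.
  · have hpq' : 1 / p - 1 / ((1 + 1 : ℕ) : ℝ) ≤ 1 / q := by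
      rw [div_eq_mul_one_div 2 p, div_eq_mul_one_div 2 q] at hpq
      push_cast
      linarith
    constructor
    · obtain ⟨C, hC, h⟩ := exists_crInterp_estimate le_rfl hp hq hpq'
      refine ⟨C, hC, fun P _ φ hφ => ⟨(h P φ hφ).1, ?_⟩⟩
      have := (h P φ hφ).2 (triH P) (triR P) (fun k i => if i = k then 1 else 0) 1
        (fun i => by fin_cases i <;> simp [triH]) (fun k i => by split_ifs <;> simp) (tri_edges P)
      rwa [mul_one] at this
    · obtain ⟨C, hC, h⟩ := exists_crInterp_rotated_estimate le_rfl hp hq hpq'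
      refine ⟨C, hC, fun P hP θ A b hA φ hφ => ?_⟩
      have := h P φ hφ A b θ.vertex θ.H 1 hA
        (fun i => by fin_cases i; exacts [θ.h₁_pos, mul_pos θ.h₂_pos θ.t_pos])
        (θ.abs_vertex_le hP hA)
      rwa [mul_one] at this
  · have hpq' : 1 / p - 1 / ((2 + 1 : ℕ) : ℝ) ≤ 1 / q := by
      rw [div_eq_mul_one_div 3 p, div_eq_mul_one_div 3 q] at hpq
      push_cast
      linarith
    constructor
    · obtain ⟨C, hC, h⟩ := exists_crInterp_estimate one_le_two hp hq hpq'
      refine ⟨C, hC, fun τ P _ φ hφ => ⟨(h P φ hφ).1, ?_⟩⟩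
      have := (h P φ hφ).2 (tetH τ P) (tetR τ P) (tetCoeff τ) 1
        (fun i => by fin_cases i <;> simp [tetH]) (abs_tetCoeff_le τ) (tet_edges τ P)
      rwa [mul_one] at this
    · intro M hM
      obtain ⟨C, hC, h⟩ := exists_crInterp_rotated_estimate one_le_two hp hq hpq'
      -- `M + 2` bounds all coefficients of the edges relative to `θ.H`: `M` comes from the
      -- condition on `s₂₂`, and `2` from `h₃ ≤ 2 h₁`.
      refine ⟨C * (M + 2), by positivity, fun τ P hP θ A b hA hs φ hφ => ?_⟩
      exact h P φ hφ A b (θ.vertex τ) θ.H (M + 2) hA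
        (fun i => by
          fin_cases i
          exacts [θ.h₁_pos, mul_pos θ.h₂_pos θ.t₁_pos, mul_pos θ.h₃_pos θ.t₂_pos])
        (θ.abs_vertex_le hP hA hM hs)
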